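/- **Theorem (quantum approximate summation).** *Computational model.* A classical random access machine (registers holding natural numbers; instructions: constants, addition, truncated subtraction, halving, indirect load and store, tests for zero) controls a quantum computer. It writes a quantum circuit gate by gate, has it run on the all-zeros state, has all qubits measured in the computational basis, and reads the bits of the outcome; it may do so repeatedly and adaptively. The gates are Hadamard, $T$, controlled-NOT, controlled rotations over the angles $2\pi/2^s$ ($s\in\mathbb N$), and queries to an input oracle. The time is the number of classical steps (including those for writing down the circuits) plus the total number of gates and queries in the circuits that are run. A number is in $(b_1,b_2)$ fixed-point format if it is of the form $\pm\sum_{i=-b_2}^{b_1-1}a_i2^i$ with $a_i\in\{0,1\}$. *Problem.* The input consists of numbers $n,b\in\mathbb N$, a rational precision $\delta\in(0,1/2]$, a rational failure probability $\eta>0$, and a quantum oracle $U_{\mathbf v}\colon|j\rangle|z\rangle\mapsto|j\rangle|z\oplus v_j\rangle$ for a vector $\mathbf v\in[0,3/4]^n$ whose entries are in $(0,b)$ fixed-point format and of which at least one entry is $\ge 1/4$ (the index register has $\lceil\log_2 n\rceil$ qubits, and $U_{\mathbf v}$ acts as the identity on indices outside of $[n]$). *Claim.* There are a single algorithm (a program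 that does not depend on the input) and constants $C>0$, $k\in\mathbb N$ such that on every such input the algorithm always halts, within time $$C\cdot\Bigl((1+b)(1+\ln n)\bigl(1+\ln\tfrac1\delta\bigr)\Bigr)^{k}\cdot\sqrt n\cdot\frac1\delta\cdot\max\Bigl\{1,\ln\frac1\eta\Bigr\},$$ that is, in time $\widetilde O\bigl(\sqrt n\cdot\frac1\delta\cdot\ln\frac1\eta\bigr)$, where $\widetilde O$ hides polynomial factors in $b$ and polylogarithmic factors in $1/\delta$ and $n$. It always outputs a number $\tilde s$ in $(\lceil\log_2(n)+1\rceil,b)$ fixed-point format, and if $b\ge\lceil\log_2(1/\delta)\rceil+6$, then with probability at least $1-\eta$ $$(1-\delta)\sum_{j=1}^n v_j\;\le\;\tilde s\;\le\;(1+\delta)\sum_{j=1}^n v_j .$$ -/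

import Mathlib

/-! ### Fixed-point numbers -/

/-- `a = ± ∑_{i=-b₂}^{b₁-1} aᵢ 2^i` with bits `aᵢ ∈ {0,1}`: the bits are those of the natural
number `m`. -/
def IsFixedPoint (b₁ b₂ : ℕ) (a : ℝ) : Prop :=
  ∃ m : ℕ, m < 2 ^ (b₁ + b₂) ∧ |a| = (m : ℝ) / 2 ^ b₂

/-- `a'` is a `(1 ± δ)`-multiplicative approximation of `a`. -/
def IsMulApprox (δ a' a : ℝ) : Prop :=
  (1 - δ) * a ≤ a' ∧ a' ≤ (1 + δ) * a

namespace QC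

/-! ### Quantum circuits

Qubits are numbered `0, 1, 2, …`; the computational basis state in which qubit `q` has the value
`x.testBit q` is labelled by the natural number `x`. All but finitely many qubits of a basis state
are `0`, and every circuit touches only finitely many qubits. -/

/-- State vectors: finite linear combinations of computational basis states. -/
abbrev StateVec : Type := ℕ →₀ ℂ

/-- An oracle `|i⟩|z⟩ ↦ |i⟩|z ⊕ val i⟩`, whose index register consists of the qubits
`0, …, idx - 1`, and whose value register consists of the qubits from `idx` on. -/
structure Oracle where
  idx : ℕ
  val : ℕ → ℕ

/-- The gate set: Hadamard, `T`, controlled-NOT, controlled rotations over the angles `2π/2^s`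
(the gates of the quantum Fourier transform), and queries to the oracle. -/
inductive Gate where
  | had (q : ℕ)
  | tgate (q : ℕ)
  | cnot (c t : ℕ)
  | crot (s c t : ℕ)
  | query

/-- The image of the basis state `|x⟩` under a gate. A controlled-NOT whose control and target
coincide is not a gate, and does nothing. -/
noncomputable def Gate.onBasis (O : Oracle) : Gate → ℕ → StateVec
  | .had q, x =>
      Finsupp.single x ((if x.testBit q then -1 else 1) / (Real.sqrt 2 : ℂ))
        + Finsupp.single (x ^^^ 2 ^ q) (1 / (Real.sqrt 2 : ℂ))
  | .tgate q, x =>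
      Finsupp.single x (if x.testBit q then Complex.exp (Real.pi / 4 * Complex.I) else 1)
  | .cnot c t, x =>
      Finsupp.single (if c ≠ t ∧ x.testBit c then x ^^^ 2 ^ t else x) 1
  | .crot s c t, x =>
      Finsupp.single x
        (if x.testBit c ∧ x.testBit t then
          Complex.exp (2 * Real.pi / 2 ^ s * Complex.I) else 1)
  | .query, x => Finsupp.single (x ^^^ (O.val (x % 2 ^ O.idx) <<< O.idx)) 1

/-- The action of a gate on state vectors. -/
noncomputable def Gate.apply (O : Oracle) (g : Gate) : StateVec →ₗ[ℂ] StateVec :=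
  Finsupp.linearCombination ℂ (g.onBasis O)

/-- The final state of a circuit started with all qubits `0`. The gate that is applied last is the
head of the list. -/
noncomputable def finalState (O : Oracle) : List Gate → StateVec
  | [] => Finsupp.single 0 1
  | g :: gs => g.apply O (finalState O gs)

/-- The standard inner product of state vectors. -/
noncomputable def ip (ψ φ : StateVec) : ℂ := ψ.sum fun x a => star a * φ x

lemma ip_add_left (ψ ψ' φ : StateVec) : ip (ψ + ψ') φ = ip ψ φ + ip ψ' φ := by
  unfold ip
  exact Finsupp.sum_add_index' (by simp) (by intros; simp [add_mul])

lemma ip_add_right (ψ φ φ' : StateVec) : ip ψ (φ + φ') = ip ψ φ + ip ψ φ' := by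
  unfold ip
  simp [mul_add, Finsupp.sum_add]

lemma ip_single_single (x y : ℕ) (a c : ℂ) :
    ip (Finsupp.single x a) (Finsupp.single y c) = if x = y then star a * c else 0 := by
  unfold ip
  rw [Finsupp.sum_single_index (by simp), Finsupp.single_apply]
  by_cases h : x = y
  · simp [h]
  · simp [h, Ne.symm h]

lemma ip_smul_left (a : ℂ) (ψ φ : StateVec) : ip (a • ψ) φ = star a * ip ψ φ := by
  unfold ip
  rw [Finsupp.sum_smul_index' (by simp), Finsupp.mul_sum]
  simp [mul_assoc]

lemma ip_smul_right (a : ℂ) (ψ φ : StateVec) : ip ψ (a • φ) = a * ip ψ φ := by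
  unfold ip
  rw [Finsupp.mul_sum]
  congr 1
  funext x c
  simp only [Finsupp.smul_apply, smul_eq_mul]
  ring

lemma xor_flip_iff (x y m : ℕ) : x ^^^ m = y ↔ x = y ^^^ m := by
  constructor
  · rintro rfl
    simp
  · rintro rfl
    simp

lemma ip_onBasis_perm (f : ℕ → ℕ) (hf : Function.Injective f) (x y : ℕ) :
    ip (Finsupp.single (f x) 1) (Finsupp.single (f y) 1) = if x = y then 1 else 0 := by
  rw [ip_single_single]
  simp [hf.eq_iff]

lemma ip_onBasis_diag (u : ℕ → ℂ) (hu : ∀ x, star (u x) * u x = 1) (x y : ℕ) :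
    ip (Finsupp.single x (u x)) (Finsupp.single y (u y)) = if x = y then 1 else 0 := by
  rw [ip_single_single]
  by_cases h : x = y
  · subst h; simp only [if_true, hu]
  · simp [h]

lemma star_exp_mul (θ : ℝ) :
    star (Complex.exp (θ * Complex.I)) * Complex.exp (θ * Complex.I) = 1 := by
  have h : star (Complex.exp (θ * Complex.I)) * Complex.exp (θ * Complex.I)
      = ((‖Complex.exp (θ * Complex.I)‖ ^ 2 : ℝ) : ℂ) := by
    rw [mul_comm]; simpa using Complex.mul_conj' (Complex.exp (θ * Complex.I))
  rw [h, Complex.norm_exp_ofReal_mul_I]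
  simp

lemma testBit_flip_self (x q : ℕ) : (x ^^^ 2 ^ q).testBit q = !x.testBit q := by
  simp [Nat.testBit_xor, Nat.testBit_two_pow_self]

lemma testBit_flip_ne (x : ℕ) {c t : ℕ} (h : c ≠ t) : (x ^^^ 2 ^ t).testBit c = x.testBit c := by
  simp [Nat.testBit_xor, Ne.symm h]

lemma ip_onBasis (O : Oracle) (g : Gate) (x y : ℕ) :
    ip (g.onBasis O x) (g.onBasis O y) = if x = y then 1 else 0 := by
  cases g with
  | had q =>
    have hs : (Real.sqrt 2 : ℂ) * (Real.sqrt 2 : ℂ) = 2 := by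
      rw [← Complex.ofReal_mul, Real.mul_self_sqrt (by norm_num)]; norm_num
    have hs0 : (Real.sqrt 2 : ℂ) ≠ 0 := by
      intro h; rw [h] at hs; norm_num at hs
    have hpos : 2 ^ q ≠ 0 := by positivity
    have hne : ∀ z : ℕ, z ^^^ 2 ^ q ≠ z := by
      intro z hz
      have := testBit_flip_self z q
      rw [hz] at this
      cases h : z.testBit q <;> simp [h] at this
    have hhalf : ((Real.sqrt 2 : ℂ))⁻¹ * (Real.sqrt 2 : ℂ)⁻¹ = 1 / 2 := by
      rw [← mul_inv, hs]; norm_num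
    simp only [Gate.onBasis, ip_add_left, ip_add_right, ip_single_single]
    by_cases hxy : x = y
    · subst hxy
      have h1 : x ≠ x ^^^ 2 ^ q := (hne x).symm
      simp only [if_true, hne x, h1, if_false]
      cases x.testBit q <;> simp [hhalf, neg_div] <;> norm_num
    · have h2 : ¬ (x ^^^ 2 ^ q = y ^^^ 2 ^ q) := by
        intro h
        apply hxy
        rw [xor_flip_iff] at h
        simpa [Nat.xor_assoc] using h
      by_cases hf : x ^^^ 2 ^ q = y
      · have h3 : x = y ^^^ 2 ^ q := (xor_flip_iff _ _ _).1 hf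
        have h4 : y.testBit q = !x.testBit q := by rw [← hf, testBit_flip_self]
        rw [if_neg hxy, if_pos h3, if_pos hf, if_neg h2, h4]
        cases x.testBit q <;> simp [neg_div, hxy]
      · have h3 : ¬ x = y ^^^ 2 ^ q := fun h => hf ((xor_flip_iff _ _ _).2 h)
        simp [hxy, h2, hf, h3]
  | tgate q =>
    refine ip_onBasis_diag
      (fun x => if x.testBit q then Complex.exp (Real.pi / 4 * Complex.I) else 1) ?_ x y
    intro z
    have := star_exp_mul (Real.pi / 4)
    push_cast at this
    split_ifs
    · exact this
    · simp
  | cnot c t =>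
    refine ip_onBasis_perm (fun x => if c ≠ t ∧ x.testBit c then x ^^^ 2 ^ t else x) ?_ x y
    apply Function.Involutive.injective
    intro z
    by_cases h : c ≠ t ∧ z.testBit c
    · have h' : c ≠ t ∧ (z ^^^ 2 ^ t).testBit c := ⟨h.1, by rw [testBit_flip_ne z h.1]; exact h.2⟩
      simp only [if_pos h, if_pos h']
      simp
    · simp only [if_neg h]
  | crot s c t =>
    refine ip_onBasis_diag (fun x => if x.testBit c ∧ x.testBit t then
          Complex.exp (2 * Real.pi / 2 ^ s * Complex.I) else 1) ?_ x y
    intro z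
    have := star_exp_mul (2 * Real.pi / 2 ^ s)
    push_cast at this
    split_ifs
    · exact this
    · simp
  | query =>
    refine ip_onBasis_perm (fun x => x ^^^ (O.val (x % 2 ^ O.idx) <<< O.idx)) ?_ x y
    apply Function.Involutive.injective
    intro z
    have h : (z ^^^ (O.val (z % 2 ^ O.idx) <<< O.idx)) % 2 ^ O.idx = z % 2 ^ O.idx := by
      apply Nat.eq_of_testBit_eq
      intro i
      by_cases hi : i < O.idx
      · simp [Nat.testBit_mod_two_pow, Nat.testBit_xor, Nat.testBit_shiftLeft, hi,
          Nat.not_le.2 hi]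
      · simp [Nat.testBit_mod_two_pow, hi]
    simp only [h]
    simp

/-- Gates are isometries. -/
lemma ip_apply (O : Oracle) (g : Gate) (ψ φ : StateVec) :
    ip (g.apply O ψ) (g.apply O φ) = ip ψ φ := by
  induction ψ using Finsupp.induction_linear with
  | zero => simp [ip]
  | add ψ ψ' h h' => rw [map_add, ip_add_left, ip_add_left, h, h']
  | single x a =>
    induction φ using Finsupp.induction_linear with
    | zero => simp [ip]
    | add φ φ' h h' => rw [map_add, ip_add_right, ip_add_right, h, h']
    | single y c =>
      simp only [Gate.apply, Finsupp.linearCombination_single, ip_smul_left, ip_smul_right,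
        ip_onBasis, ip_single_single]
      by_cases h : x = y <;> simp [h, mul_comm]

lemma ip_finalState (O : Oracle) (gs : List Gate) :
    ip (finalState O gs) (finalState O gs) = 1 := by
  induction gs with
  | nil => simp [finalState, ip_single_single]
  | cons g gs h => rw [finalState, ip_apply, h]

lemma sum_normSq_finalState (O : Oracle) (gs : List Gate) :
    ∑ x ∈ (finalState O gs).support, ENNReal.ofReal (‖finalState O gs x‖ ^ 2) = 1 := by
  rw [← ENNReal.ofReal_sum_of_nonneg (fun _ _ => by positivity)]
  have h : ((∑ x ∈ (finalState O gs).support, ‖finalState O gs x‖ ^ 2 : ℝ) : ℂ) = 1 := by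
    rw [← ip_finalState O gs, ip, Finsupp.sum]
    push_cast
    refine Finset.sum_congr rfl fun x _ => ?_
    rw [mul_comm]
    simpa using (Complex.mul_conj' (finalState O gs x)).symm
  rw [Complex.ofReal_eq_one.1 h]
  simp

/-- The measurement of all qubits in the computational basis: the outcome `x` has probability
`|⟨x|ψ⟩|²`, where `ψ` is the final state of the circuit. -/
noncomputable def measureCircuit (O : Oracle) (gs : List Gate) : PMF ℕ :=
  PMF.ofFinset (fun x => ENNReal.ofReal (‖finalState O gs x‖ ^ 2)) (finalState O gs).support
    (sum_normSq_finalState O gs) (by intro x hx; simp [Finsupp.notMem_support_iff.1 hx])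

/-! ### A random access machine that controls a quantum computer

The classical memory consists of registers `0, 1, 2, …` that hold natural numbers. The machine
writes the description of a circuit gate by gate, has it run and measured, and reads the bits of
the outcome. -/

/-- Elementary instructions; the arguments are (addresses of) registers, except for the constant
`k` in `const`. -/
inductive Op where
  /-- `R[d] := k` -/
  | const (d k : ℕ)
  /-- `R[d] := R[a] + R[e]` -/
  | add (d a e : ℕ)
  /-- `R[d] := max (R[a] - R[e]) 0` -/
  | sub (d a e : ℕ)
  /-- `R[d] := ⌊R[a] / 2⌋` -/
  | half (d a : ℕ)
  /-- `R[d] := R[R[a]]` -/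
  | load (d a : ℕ)
  /-- `R[R[d]] := R[a]` -/
  | store (d a : ℕ)
  /-- append a Hadamard gate on qubit `R[a]` to the circuit description -/
  | had (a : ℕ)
  /-- append a `T` gate on qubit `R[a]` -/
  | tgate (a : ℕ)
  /-- append a controlled-NOT with control qubit `R[a]` and target qubit `R[e]` -/
  | cnot (a e : ℕ)
  /-- append a rotation over `2π/2^R[s]` of qubit `R[e]`, controlled by qubit `R[a]` -/
  | crot (s a e : ℕ)
  /-- append an oracle query -/
  | query
  /-- run the circuit on the all-zeros state, measure all qubits, and start a new circuit -/
  | run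
  /-- `R[d] :=` the value of qubit `R[a]` in the last measurement outcome -/
  | readBit (d a : ℕ)

/-- Programs; the tests are whether a register is nonzero. -/
inductive Prog where
  | skip
  | op (o : Op)
  | seq (P Q : Prog)
  | ifElse (r : ℕ) (P Q : Prog)
  | whileDo (r : ℕ) (P : Prog)

/-- Configurations: the program that remains to be executed (the machine has halted when nothing
remains), the memory, the circuit description (last gate first), the last measurement outcome,
and the time spent so far. -/
structure Config where
  todo : List Prog
  mem : ℕ → ℕ
  circuit : List Gate
  outcome : ℕ
  time : ℕ

/-- Execution of an elementary instruction. Each takes one unit of time; running a circuit takes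
in addition one unit of time for each of its gates and queries. -/
noncomputable def Op.exec (O : Oracle) (σ : Config) : Op → PMF Config
  | .const d k =>
      PMF.pure { σ with mem := Function.update σ.mem d k, time := σ.time + 1 }
  | .add d a e =>
      PMF.pure { σ with
        mem := Function.update σ.mem d (σ.mem a + σ.mem e), time := σ.time + 1 }
  | .sub d a e =>
      PMF.pure { σ with
        mem := Function.update σ.mem d (σ.mem a - σ.mem e), time := σ.time + 1 }
  | .half d a =>
      PMF.pure { σ with mem := Function.update σ.mem d (σ.mem a / 2), time := σ.time + 1 }
  | .load d a =>
      PMF.pure { σ with mem := Function.update σ.mem d (σ.mem (σ.mem a)), time := σ.time + 1 }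
  | .store d a =>
      PMF.pure { σ with mem := Function.update σ.mem (σ.mem d) (σ.mem a), time := σ.time + 1 }
  | .had a =>
      PMF.pure { σ with circuit := .had (σ.mem a) :: σ.circuit, time := σ.time + 1 }
  | .tgate a =>
      PMF.pure { σ with circuit := .tgate (σ.mem a) :: σ.circuit, time := σ.time + 1 }
  | .cnot a e =>
      PMF.pure { σ with
        circuit := .cnot (σ.mem a) (σ.mem e) :: σ.circuit, time := σ.time + 1 }
  | .crot s a e =>
      PMF.pure { σ with
        circuit := .crot (σ.mem s) (σ.mem a) (σ.mem e) :: σ.circuit, time := σ.time + 1 }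
  | .query =>
      PMF.pure { σ with circuit := .query :: σ.circuit, time := σ.time + 1 }
  | .run =>
      (measureCircuit O σ.circuit).map fun x =>
        { σ with circuit := [], outcome := x, time := σ.time + 1 + σ.circuit.length }
  | .readBit d a =>
      PMF.pure { σ with
        mem := Function.update σ.mem d (if σ.outcome.testBit (σ.mem a) then 1 else 0),
        time := σ.time + 1 }

/-- One step of the machine. A machine that has halted stays as it is. -/
noncomputable def step (O : Oracle) (σ : Config) : PMF Config :=
  match σ.todo with
  | [] => PMF.pure σ
  | .skip :: K => PMF.pure { σ with todo := K, time := σ.time + 1 }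
  | .op o :: K => o.exec O { σ with todo := K }
  | .seq P Q :: K => PMF.pure { σ with todo := P :: Q :: K, time := σ.time + 1 }
  | .ifElse r P Q :: K =>
      PMF.pure { σ with todo := (if σ.mem r ≠ 0 then P else Q) :: K, time := σ.time + 1 }
  | .whileDo r P :: K =>
      PMF.pure { σ with
        todo := if σ.mem r ≠ 0 then P :: .whileDo r P :: K else K, time := σ.time + 1 }

/-- The distribution of the configuration after `N` steps. -/
noncomputable def steps (O : Oracle) : ℕ → Config → PMF Config
  | 0, σ => PMF.pure σ
  | N + 1, σ => (step O σ).bind (steps O N)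

/-- The start of a program with the given numbers in the first registers, and `0` in all others. -/
def start (P : Prog) (input : List ℕ) : Config where
  todo := [P]
  mem := fun i => input.getD i 0
  circuit := []
  outcome := 0
  time := 0

/-! ### The problem -/

/-- The oracle `U_v` for a vector `v` with nonnegative entries in `(0, b)` fixed-point format.
Entries are numbered from `0`, the index register has `⌈log₂ n⌉` qubits, the value register has
`b` qubits, and `U_v` acts as the identity on index values outside of the vector. -/
noncomputable def vecOracle {n : ℕ} (b : ℕ) (v : Fin n → ℝ) : Oracle where
  idx := Nat.clog 2 n
  val := fun i => if h : i < n then ⌊v ⟨i, h⟩ * 2 ^ b⌋₊ else 0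

/-- The input `(n, b, δ, η)`; a positive rational is given by its numerator and denominator. -/
def sumInput (n b : ℕ) (δ η : ℚ) : List ℕ :=
  [n, b, δ.num.toNat, δ.den, η.num.toNat, η.den]

/-- The number with `b` trailing bits that register `0` encodes. -/
noncomputable def sumOutput (b : ℕ) (σ : Config) : ℝ := (σ.mem 0 : ℝ) / 2 ^ b

end QC

/-! Write `S` for the sum of the entries and `L` for `⌈log₂ n⌉`. Attach to each index `j` a position
`y < 2^(b+6)`, and call `(j, y)` good if `1 ≤ y < 2^b` and the bit of `v_j 2^b` with number `⌊log₂
y⌋` is set. There are `2^i` positions with logarithm `i`, so exactly `v_j 2^b` positions are good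
for `j` (`card_good`). In the uniform superposition of all pairs, goodness therefore has probability
`t² = S / 2^(L+6)`. It can be decided without any arithmetic comparison: a chain of Toffoli gates
finds the leading one of `y` (`computeF_flag`). After `r` rounds of amplitude amplification the flag
is measured with probability `sin²((2r+1) arcsin t)` (`iterL_ket`, `tsum_measure_circuitL`).

It remains to estimate `t` from such samples, without a quantum Fourier transform. The search gains
one bit of precision per stage. In stage `k`, where `t` is known up to `2^-k`, each of the 2049
points of a grid of mesh `2^-(k+11)` is tested: for `k+1` numbers of rounds of order `2^k`, the
observed frequency is compared with the probability that the grid point predicts. One number of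
rounds is not enough, because `sin²(mx) = sin²(my)` also has solutions with `m(x+y)` a multiple of
`π`. The multipliers `m` that are used differ by powers of two, and some power of two times `x+y`
stays away from the zeros of the sine; hence a point that passes all tests is at distance at most
`2^-k / 4` from `t` (`close_of_prob`), whereas the nearest grid point passes (`prob_close`). The
predictions are rational numbers, which the machine computes exactly by a three-term recurrence
(`evalIter_eq`); unit-cost registers of unbounded size make this cheap. A Chernoff bound (`binE_le`)
controls each test, and a union bound all of them (`err_le`).

Since `S ≥ 1/4`, `t` is at least of order `1/√n`, and `⌈L/2⌉ + log(1/δ) + O(1)` stages determine `t`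
up to `δt/8`, hence `S` up to a factor `1 ± δ` after rounding (`result_accurate`). The last stage
uses `O(√n/δ)` rounds, which dominates the time (`sumTime_le`).

Programs are verified with a calculus of expectations: `Bd` bounds the expectation of a function of
the final state, and the value `⊤` encodes what must never happen. `Sure` and `Likely` distinguish
what holds on every run (halting, time, output format) from what may fail with small probability;
`Spec.steps` translates them into the distribution after sufficiently many steps. -/

namespace QC

open scoped ENNReal

/-! ### A quantitative program logic -/

/-- A machine state without the program that remains to be executed. -/
structure St where
  mem : ℕ → ℕ
  circuit : List Gate
  outcome : ℕ
  time : ℕ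

namespace St

/-- The configuration with state `s` and remaining program `K`. -/
def cfg (s : St) (K : List Prog) : Config := ⟨K, s.mem, s.circuit, s.outcome, s.time⟩

/-- One unit of time passes. -/
def tick (s : St) : St := { s with time := s.time + 1 }

@[simp] lemma tick_mem (s : St) : s.tick.mem = s.mem := rfl
@[simp] lemma tick_circuit (s : St) : s.tick.circuit = s.circuit := rfl
@[simp] lemma tick_outcome (s : St) : s.tick.outcome = s.outcome := rfl
@[simp] lemma tick_time (s : St) : s.tick.time = s.time + 1 := rfl

end St

/-- `Bd O Φ K σ v`: the expectation of `Φ` when the program is reduced to `K`, starting from `σ`, is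
at most `v`. -/
inductive Bd (O : Oracle) (Φ : St → ℝ≥0∞) (K : List Prog) : Config → ℝ≥0∞ → Prop
  | done (s : St) (v : ℝ≥0∞) (h : Φ s ≤ v) : Bd O Φ K (s.cfg K) v
  | top (σ : Config) : Bd O Φ K σ ⊤
  | step (σ : Config) (v : ℝ≥0∞) (g : Config → ℝ≥0∞)
      (h : ∀ τ, step O σ τ ≠ 0 → Bd O Φ K τ (g τ)) (hv : ∑' τ, step O σ τ * g τ ≤ v) :
      Bd O Φ K σ v

variable {O : Oracle}

lemma Bd.mono {Φ : St → ℝ≥0∞} {K : List Prog} {σ : Config} {v v' : ℝ≥0∞} (h : Bd O Φ K σ v)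
    (hv : v ≤ v') : Bd O Φ K σ v' := by
  cases h with
  | done s _ h => exact .done s _ (h.trans hv)
  | top => rw [top_le_iff.1 hv]; exact .top _
  | step _ _ g h hg => exact .step _ _ g h (hg.trans hv)

/-- Sequential composition of expectation bounds: the function that is bounded at the end of the
first phase is itself a bound for the second phase. -/
lemma Bd.trans {Φ Ψ : St → ℝ≥0∞} {K K' : List Prog} {σ : Config} {v : ℝ≥0∞}
    (h : Bd O Φ K σ v) (h' : ∀ s, Bd O Ψ K' (s.cfg K) (Φ s)) : Bd O Ψ K' σ v := by
  induction h with
  | done s v h => exact (h' s).mono h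
  | top => exact .top _
  | step σ v g _ hg ih => exact .step σ v g ih hg

lemma tsum_pure_mul {α : Type*} (a : α) (g : α → ℝ≥0∞) : ∑' x, PMF.pure a x * g x = g a := by
  classical
  rw [tsum_eq_single a]
  · simp
  · intro x hx
    simp [PMF.pure_apply, hx]

lemma tsum_bind_mul {α β : Type*} (p : PMF α) (f : α → PMF β) (g : β → ℝ≥0∞) :
    ∑' y, p.bind f y * g y = ∑' x, p x * ∑' y, f x y * g y := by
  simp_rw [PMF.bind_apply, ← ENNReal.tsum_mul_right, ← ENNReal.tsum_mul_left]
  rw [ENNReal.tsum_comm]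
  simp_rw [mul_assoc]

lemma tsum_map_mul {α β : Type*} (p : PMF α) (f : α → β) (g : β → ℝ≥0∞) :
    ∑' y, p.map f y * g y = ∑' x, p x * g (f x) := by
  rw [← PMF.bind_pure_comp, tsum_bind_mul]
  simp_rw [Function.comp_apply, tsum_pure_mul]

lemma Bd.of_pure {Φ : St → ℝ≥0∞} {K : List Prog} {σ τ : Config} {v : ℝ≥0∞}
    (hs : QC.step O σ = PMF.pure τ) (h : Bd O Φ K τ v) : Bd O Φ K σ v := by
  refine .step σ v (fun _ => v) (fun τ' hτ' => ?_) ?_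
  · rw [hs] at hτ'
    have : τ' = τ := by
      by_contra hne
      exact hτ' (by simp [PMF.pure_apply, hne])
    rwa [this]
  · rw [hs, tsum_pure_mul]

/-- Running the circuit. -/
lemma Bd.of_run {Φ : St → ℝ≥0∞} {K : List Prog} (s : St) (v : ℝ≥0∞)
    (h : ∑' x, measureCircuit O s.circuit x *
      Φ ⟨s.mem, [], x, s.time + 1 + s.circuit.length⟩ ≤ v) :
    Bd O Φ K (s.cfg (.op .run :: K)) v := by
  refine .step _ v (fun τ => Φ ⟨τ.mem, τ.circuit, τ.outcome, τ.time⟩) (fun τ hτ => ?_) ?_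
  · have hτ' : τ ∈ (QC.step O (s.cfg (.op .run :: K))).support := hτ
    simp only [QC.step, St.cfg, Op.exec, PMF.support_map, Set.mem_image] at hτ'
    obtain ⟨x, _, rfl⟩ := hτ'
    exact .done ⟨s.mem, [], x, s.time + 1 + s.circuit.length⟩ _ le_rfl
  · simp only [QC.step, St.cfg, Op.exec]
    rw [tsum_map_mul]
    exact h

/-- Time is the termination measure: as no step of a running machine is free, a bound on the time
also bounds the number of steps. -/
lemma step_time_le {σ τ : Config} (h : QC.step O σ τ ≠ 0) (hσ : σ.todo ≠ []) :
    σ.time + 1 ≤ τ.time := by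
  have hp : ∀ ρ : Config, PMF.pure ρ τ ≠ 0 → τ = ρ := by
    intro ρ hρ
    by_contra hne
    exact hρ (by simp [PMF.pure_apply, hne])
  obtain ⟨todo, mem, circuit, outcome, time⟩ := σ
  cases todo with
  | nil => exact absurd rfl hσ
  | cons P K =>
    cases P with
    | op o =>
      cases o with
      | run =>
        have hτ' : τ ∈ (QC.step O ⟨.op .run :: K, mem, circuit, outcome, time⟩).support := h
        simp only [QC.step, Op.exec, PMF.support_map, Set.mem_image] at hτ'
        obtain ⟨x, _, rfl⟩ := hτ'
        simp
      | _ => simp only [QC.step, Op.exec] at h; rw [hp _ h]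
    | _ => simp only [QC.step] at h; rw [hp _ h]

lemma tsum_support_mul_le {α : Type*} (p : PMF α) {f g : α → ℝ≥0∞}
    (h : ∀ x, p x ≠ 0 → f x ≤ g x) : ∑' x, p x * f x ≤ ∑' x, p x * g x := by
  refine ENNReal.tsum_le_tsum fun x => ?_
  by_cases hx : p x = 0
  · simp [hx]
  · exact mul_le_mul_right (h x hx) _

lemma ne_top_of_tsum {α : Type*} {p : PMF α} {g : α → ℝ≥0∞} {v : ℝ≥0∞}
    (h : ∑' x, p x * g x ≤ v) (hv : v ≠ ⊤) {x : α} (hx : p x ≠ 0) : g x ≠ ⊤ := by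
  intro hg
  refine hv (top_le_iff.1 (le_trans ?_ h))
  refine le_trans ?_ (ENNReal.le_tsum x)
  rw [hg, ENNReal.mul_top hx]

/-- A finite bound excludes final states with `Φ = ⊤`, so the time limit at the end also limits
every earlier time. -/
lemma Bd.time_le {Φ : St → ℝ≥0∞} {T : ℕ} (hT : ∀ s, Φ s ≠ ⊤ → s.time ≤ T) {σ : Config}
    {v : ℝ≥0∞} (h : Bd O Φ [] σ v) (hv : v ≠ ⊤) : σ.time ≤ T := by
  induction h with
  | done s v h => exact hT s (ne_top_of_le_ne_top hv h)
  | top => exact absurd rfl hv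
  | step σ v g _ hg ih =>
    obtain ⟨τ, hτ⟩ := (QC.step O σ).support_nonempty
    have h1 := ih τ hτ (ne_top_of_tsum hg hv hτ)
    by_cases hσ : σ.todo = []
    · have : QC.step O σ = PMF.pure σ := by
        unfold QC.step; rw [hσ]
      rw [this] at hτ
      simp only [PMF.support_pure, Set.mem_singleton_iff] at hτ
      rwa [hτ] at h1
    · have := step_time_le hτ hσ
      omega

lemma steps_of_halted {σ : Config} (hσ : σ.todo = []) (N : ℕ) : steps O N σ = PMF.pure σ := by
  induction N with
  | zero => rfl
  | succ N ih =>
    have : QC.step O σ = PMF.pure σ := by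
      unfold QC.step; rw [hσ]
    rw [steps, this, PMF.pure_bind, ih]

/-- From a bound on expectations to the distribution after sufficiently many steps. -/
lemma Bd.steps {Φ : St → ℝ≥0∞} {T : ℕ} (hT : ∀ s, Φ s ≠ ⊤ → s.time ≤ T) {σ : Config}
    {v : ℝ≥0∞} (h : Bd O Φ [] σ v) (N : ℕ) (hN : T ≤ σ.time + N) :
    ∑' τ, steps O N σ τ *
      (if τ.todo = [] then Φ ⟨τ.mem, τ.circuit, τ.outcome, τ.time⟩ else ⊤) ≤ v := by
  induction h generalizing N with
  | done s v h =>
    rw [steps_of_halted (by rfl), tsum_pure_mul]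
    simpa [St.cfg] using h
  | top => exact le_top
  | step σ v g hstep hg ih =>
    by_cases hv : v = ⊤
    · rw [hv]; exact le_top
    by_cases hσ : σ.todo = []
    · have hs : QC.step O σ = PMF.pure σ := by
        unfold QC.step; rw [hσ]
      have h1 := ih σ (by rw [hs]; simp) N hN
      refine h1.trans (le_trans ?_ hg)
      rw [hs, tsum_pure_mul]
    · cases N with
      | zero =>
        exfalso
        obtain ⟨τ, hτ⟩ := (QC.step O σ).support_nonempty
        have h1 := (hstep τ hτ).time_le hT (ne_top_of_tsum hg hv hτ)
        have := step_time_le hτ hσ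
        omega
      | succ N =>
        rw [QC.steps, tsum_bind_mul]
        refine le_trans (tsum_support_mul_le _ fun τ hτ => ?_) hg
        refine ih τ hτ N ?_
        have := step_time_le hτ hσ
        omega

/-! ### Deterministic execution -/

/-- The program `P` takes the state `s` to the state `s'`. -/
def Det (O : Oracle) (P : Prog) (s s' : St) : Prop :=
  ∀ (K : List Prog) (Φ : St → ℝ≥0∞), Bd O Φ K (s.cfg (P :: K)) (Φ s')

/-- Instantiating `Det` with the function that is `v` at `s'` and `⊤` elsewhere forces the
intermediate state to be `s'`. -/
lemma Bd.det_trans {Φ : St → ℝ≥0∞} {K K' : List Prog} {P : Prog} {s s' : St} {v : ℝ≥0∞}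
    (h : Det O P s s') (h' : Bd O Φ K' (s'.cfg K) v) : Bd O Φ K' (s.cfg (P :: K)) v := by
  classical
  have h1 := h K (fun x => if x = s' then v else ⊤)
  simp only [if_true] at h1
  refine h1.trans fun x => ?_
  by_cases hx : x = s'
  · simpa [hx] using h'
  · simpa [hx] using Bd.top _

/-- The effect of an instruction other than `run`. -/
def Op.act (s : St) : Op → St
  | .const d k => ⟨Function.update s.mem d k, s.circuit, s.outcome, s.time + 1⟩
  | .add d a e => ⟨Function.update s.mem d (s.mem a + s.mem e), s.circuit, s.outcome, s.time + 1⟩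
  | .sub d a e => ⟨Function.update s.mem d (s.mem a - s.mem e), s.circuit, s.outcome, s.time + 1⟩
  | .half d a => ⟨Function.update s.mem d (s.mem a / 2), s.circuit, s.outcome, s.time + 1⟩
  | .load d a => ⟨Function.update s.mem d (s.mem (s.mem a)), s.circuit, s.outcome, s.time + 1⟩
  | .store d a => ⟨Function.update s.mem (s.mem d) (s.mem a), s.circuit, s.outcome, s.time + 1⟩
  | .had a => ⟨s.mem, .had (s.mem a) :: s.circuit, s.outcome, s.time + 1⟩
  | .tgate a => ⟨s.mem, .tgate (s.mem a) :: s.circuit, s.outcome, s.time + 1⟩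
  | .cnot a e => ⟨s.mem, .cnot (s.mem a) (s.mem e) :: s.circuit, s.outcome, s.time + 1⟩
  | .crot r a e =>
      ⟨s.mem, .crot (s.mem r) (s.mem a) (s.mem e) :: s.circuit, s.outcome, s.time + 1⟩
  | .query => ⟨s.mem, .query :: s.circuit, s.outcome, s.time + 1⟩
  | .run => s
  | .readBit d a =>
      ⟨Function.update s.mem d (if s.outcome.testBit (s.mem a) then 1 else 0), s.circuit,
        s.outcome, s.time + 1⟩

/-- Straight-line programs. -/
def block : List Op → Prog
  | [] => .skip
  | o :: l => .seq (.op o) (block l)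

/-- The effect of a straight-line program. -/
def acts : List Op → St → St
  | [], s => s.tick
  | o :: l, s => acts l (o.act s.tick)

lemma det_op (o : Op) (h : o ≠ .run) (s : St) : Det O (.op o) s (o.act s) := by
  intro K Φ
  cases o with
  | run => exact absurd rfl h
  | _ => exact Bd.of_pure (τ := (Op.act s _).cfg K) rfl (.done _ _ le_rfl)

lemma det_skip (s : St) : Det O .skip s s.tick := fun _ _ => Bd.of_pure rfl (.done s.tick _ le_rfl)

lemma Det.seq {P Q : Prog} {s s' s'' : St} (h : Det O P s.tick s') (h' : Det O Q s' s'') :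
    Det O (.seq P Q) s s'' := fun _ Φ => Bd.of_pure rfl (Bd.det_trans h (h' _ Φ))

lemma Det.ite_pos {P Q : Prog} {r : ℕ} {s s' : St} (hr : s.mem r ≠ 0) (h : Det O P s.tick s') :
    Det O (.ifElse r P Q) s s' := fun K Φ => by
  refine Bd.of_pure (τ := s.tick.cfg (P :: K)) ?_ (h _ Φ)
  simp [step, St.cfg, hr, St.tick]

lemma Det.ite_neg {P Q : Prog} {r : ℕ} {s s' : St} (hr : s.mem r = 0) (h : Det O Q s.tick s') :
    Det O (.ifElse r P Q) s s' := fun K Φ => by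
  refine Bd.of_pure (τ := s.tick.cfg (Q :: K)) ?_ (h _ Φ)
  simp [step, St.cfg, hr, St.tick]

lemma Det.while_zero {P : Prog} {r : ℕ} {s : St} (hr : s.mem r = 0) :
    Det O (.whileDo r P) s s.tick := fun K Φ => by
  refine Bd.of_pure (τ := s.tick.cfg K) ?_ (.done s.tick _ le_rfl)
  simp [step, St.cfg, hr, St.tick]

lemma Det.while_succ {P : Prog} {r : ℕ} {s s' s'' : St} (hr : s.mem r ≠ 0)
    (h : Det O P s.tick s') (h' : Det O (.whileDo r P) s' s'') :
    Det O (.whileDo r P) s s'' := fun K Φ => by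
  refine Bd.of_pure (τ := s.tick.cfg (P :: .whileDo r P :: K)) ?_ (Bd.det_trans h (h' _ Φ))
  simp [step, St.cfg, hr, St.tick]

lemma det_block (l : List Op) (h : Op.run ∉ l) (s : St) : Det O (block l) s (acts l s) := by
  induction l generalizing s with
  | nil => exact det_skip s
  | cons o l ih =>
    refine Det.seq (det_op o (fun ho => h (by simp [ho])) _) (ih (fun hl => h (by simp [hl])) _)

/-- Deterministic loops with `N` rounds of at most `c` units of time each. -/
lemma Det.while_inv {P : Prog} {r N c : ℕ} (I : ℕ → St → Prop)
    (hstep : ∀ i < N, ∀ s, I i s → s.mem r ≠ 0 ∧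
      ∃ s', Det O P s.tick s' ∧ I (i + 1) s' ∧ s'.time ≤ s.time + c)
    (hend : ∀ s, I N s → s.mem r = 0 ∧ I N s.tick) {s : St} (h0 : I 0 s) :
    ∃ s', Det O (.whileDo r P) s s' ∧ I N s' ∧ s'.time ≤ s.time + N * c + 1 := by
  suffices h : ∀ j i, i + j = N → ∀ s, I i s →
      ∃ s', Det O (.whileDo r P) s s' ∧ I N s' ∧ s'.time ≤ s.time + j * c + 1 from
    h N 0 (by simp) s h0
  intro j
  induction j with
  | zero =>
    intro i hi s hs
    obtain rfl : i = N := by simpa using hi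
    exact ⟨s.tick, Det.while_zero (hend s hs).1, (hend s hs).2, by simp⟩
  | succ j ih =>
    intro i hi s hs
    obtain ⟨hr, s', hd, hI, ht⟩ := hstep i (by omega) s hs
    obtain ⟨s'', hd', hI', ht'⟩ := ih (i + 1) (by omega) s' hI
    exact ⟨s'', Det.while_succ hr hd hd', hI', by rw [Nat.succ_mul]; omega⟩

/-! ### Probabilistic execution -/

/-- From `s` the program `P` always ends in a state that satisfies `S`. -/
def Sure (O : Oracle) (P : Prog) (s : St) (S : St → Prop) : Prop :=
  ∀ (K : List Prog) (Φ : St → ℝ≥0∞) (B : ℝ≥0∞), (∀ s', S s' → Φ s' ≤ B) →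
    Bd O Φ K (s.cfg (P :: K)) B

/-- From `s` the program `P` always ends in a state that satisfies `S`, and with probability at
least `1 - ε` it ends in one that also satisfies `G`. -/
def Likely (O : Oracle) (P : Prog) (s : St) (S G : St → Prop) (ε : ℝ≥0∞) : Prop :=
  ∀ (K : List Prog) (Φ : St → ℝ≥0∞) (A B : ℝ≥0∞), A ≤ B → (∀ s', S s' → Φ s' ≤ B) →
    (∀ s', S s' → G s' → Φ s' ≤ A) → Bd O Φ K (s.cfg (P :: K)) (A + ε * B)

/-- A triple: `I` and `I'` are the sure, and `G` and `G'` the likely assertions. -/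
def Trip (O : Oracle) (P : Prog) (I G I' G' : St → Prop) (ε : ℝ≥0∞) : Prop :=
  ∀ s, I s → Sure O P s I' ∧ (G s → Likely O P s I' G' ε)

lemma Sure.of_det {P : Prog} {s s' : St} {S : St → Prop} (h : Det O P s s') (hs : S s') :
    Sure O P s S := fun K Φ _ hB => (h K Φ).mono (hB s' hs)

lemma Likely.of_det {P : Prog} {s s' : St} {S G : St → Prop} (h : Det O P s s') (hs : S s')
    (hg : G s') : Likely O P s S G 0 := fun K Φ A B _ _ hA => (h K Φ).mono (by simpa using hA s' hs hg)

lemma Trip.of_det {P : Prog} {I G I' G' : St → Prop}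
    (h : ∀ s, I s → ∃ s', Det O P s s' ∧ I' s' ∧ (G s → G' s')) : Trip O P I G I' G' 0 := by
  intro s hs
  obtain ⟨s', hd, hI, hG⟩ := h s hs
  exact ⟨.of_det hd hI, fun hg => .of_det hd hI (hG hg)⟩

lemma Sure.trans {P : Prog} {K : List Prog} {s : St} {S : St → Prop}
    {Φ : St → ℝ≥0∞} {K' : List Prog} {B : ℝ≥0∞} (h : Sure O P s S)
    (h' : ∀ s', S s' → Bd O Φ K' (s'.cfg K) B) : Bd O Φ K' (s.cfg (P :: K)) B := by
  classical
  refine (h K (fun x => if S x then B else ⊤) B fun s' hs' => by simp [hs']).trans fun x => ?_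
  by_cases hx : S x
  · simpa [hx] using h' x hx
  · simpa [hx] using Bd.top _

lemma Likely.trans {P : Prog} {K : List Prog} {s : St} {S G : St → Prop} {ε : ℝ≥0∞}
    {Φ : St → ℝ≥0∞} {K' : List Prog} {A B : ℝ≥0∞} (h : Likely O P s S G ε)
    (hB : ∀ s', S s' → Bd O Φ K' (s'.cfg K) B)
    (hA : ∀ s', S s' → G s' → Bd O Φ K' (s'.cfg K) A) :
    Bd O Φ K' (s.cfg (P :: K)) (A + ε * B) := by
  classical
  -- `Likely` is only available for `A ≤ B`, hence the minimum.
  refine ((h K (fun x => if S x then (if G x then min A B else B) else ⊤) (min A B) B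
    (min_le_right _ _) (fun s' hs' => ?_) (fun s' hs' hg => by simp [hs', hg])).trans
    fun x => ?_).mono (add_le_add_left (min_le_left A B) _)
  · by_cases hg : G s' <;> simp [hs', hg]
  · by_cases hx : S x
    · by_cases hg : G x
      · simp only [hx, hg, if_true]
        rcases le_total A B with hAB | hAB
        · rw [min_eq_left hAB]; exact hA x hx hg
        · rw [min_eq_right hAB]; exact hB x hx
      · simpa [hx, hg] using hB x hx
    · simpa [hx] using Bd.top _

/-- Loops with exactly `N` rounds. -/
lemma Trip.while {P : Prog} {r N : ℕ} {I G : ℕ → St → Prop} {ε : ℝ≥0∞}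
    (hr : ∀ i < N, ∀ s, I i s → s.mem r ≠ 0)
    (hstep : ∀ i < N, ∀ s, I i s →
      Sure O P s.tick (I (i + 1)) ∧ (G i s → Likely O P s.tick (I (i + 1)) (G (i + 1)) ε))
    (hend : ∀ s, I N s → s.mem r = 0) :
    Trip O (.whileDo r P) (I 0) (G 0) (fun s => ∃ s₀, I N s₀ ∧ s = s₀.tick)
      (fun s => ∃ s₀, I N s₀ ∧ G N s₀ ∧ s = s₀.tick) (N * ε) := by
  suffices h : ∀ j i, i + j = N → Trip O (.whileDo r P) (I i) (G i)
      (fun s => ∃ s₀, I N s₀ ∧ s = s₀.tick)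
      (fun s => ∃ s₀, I N s₀ ∧ G N s₀ ∧ s = s₀.tick) (j * ε) from h N 0 (by simp)
  intro j
  induction j with
  | zero =>
    intro i hi
    obtain rfl : i = N := by simpa using hi
    simp only [Nat.cast_zero, zero_mul]
    refine Trip.of_det fun s hs => ⟨s.tick, Det.while_zero (hend s hs), ⟨s, hs, rfl⟩,
      fun hg => ⟨s, hs, hg, rfl⟩⟩
  | succ j ih =>
    intro i hi s hs
    have hτ : ∀ K, QC.step O (s.cfg (.whileDo r P :: K))
        = PMF.pure (s.tick.cfg (P :: .whileDo r P :: K)) := by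
      intro K
      simp [step, St.cfg, hr i (by omega) s hs, St.tick]
    have hst := hstep i (by omega) s hs
    have hih := ih (i + 1) (by omega)
    refine ⟨fun K Φ B hB => Bd.of_pure (hτ K) ?_, fun hg K Φ A B hAB hB hA =>
      Bd.of_pure (hτ K) ?_⟩
    · exact Sure.trans hst.1 fun s' hs' => (hih s' hs').1 K Φ B hB
    · have : A + ((j + 1 : ℕ) : ℝ≥0∞) * ε * B = A + j * ε * B + ε * B := by
        push_cast; ring
      rw [this]
      exact (hst.2 hg).trans (fun s' hs' => (hih s' hs').1 K Φ B hB)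
        fun s' hs' hg' => (hih s' hs').2 hg' K Φ A B hAB hB hA

/-! ### Circuits as linear maps -/

/-- The action of a list of gates, of which the head is applied last. -/
noncomputable def applyL (O : Oracle) : List Gate → (StateVec →ₗ[ℂ] StateVec)
  | [] => LinearMap.id
  | g :: gs => g.apply O ∘ₗ applyL O gs

/-- Basis states. -/
noncomputable abbrev ket (x : ℕ) : StateVec := Finsupp.single x (1 : ℂ)

lemma finalState_append (gs hs : List Gate) :
    finalState O (gs ++ hs) = applyL O gs (finalState O hs) := by
  induction gs with
  | nil => rfl
  | cons g gs ih => simp [finalState, applyL, ih]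

lemma applyL_append (gs hs : List Gate) (ψ : StateVec) :
    applyL O (gs ++ hs) ψ = applyL O gs (applyL O hs ψ) := by
  induction gs with
  | nil => rfl
  | cons g gs ih => simp [applyL, ih]

lemma applyL_cons (g : Gate) (gs : List Gate) (ψ : StateVec) :
    applyL O (g :: gs) ψ = g.apply O (applyL O gs ψ) := rfl

lemma applyL_nil (ψ : StateVec) : applyL O [] ψ = ψ := rfl

lemma ip_applyL (gs : List Gate) (ψ φ : StateVec) :
    ip (applyL O gs ψ) (applyL O gs φ) = ip ψ φ := by
  induction gs with
  | nil => rfl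
  | cons g gs ih => rw [applyL_cons, applyL_cons, ip_apply, ih]

lemma apply_ket (g : Gate) (x : ℕ) : g.apply O (ket x) = g.onBasis O x := by
  simp [Gate.apply]

lemma single_eq_smul_ket (x : ℕ) (a : ℂ) : Finsupp.single x a = a • ket x := by simp

/-- `1 / √2`. -/
noncomputable def rt : ℂ := 1 / (Real.sqrt 2 : ℂ)

lemma rt_mul_rt : rt * rt = 1 / 2 := by
  have hs : (Real.sqrt 2 : ℂ) * (Real.sqrt 2 : ℂ) = 2 := by
    rw [← Complex.ofReal_mul, Real.mul_self_sqrt (by norm_num)]; norm_num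
  unfold rt
  rw [div_mul_div_comm, hs, one_mul]

/-! ### Single gates, negation and Toffoli on basis states -/

lemma had_ket (q x : ℕ) : (Gate.had q).apply O (ket x)
    = ((if x.testBit q then -1 else 1) * rt) • ket x + rt • ket (x ^^^ 2 ^ q) := by
  rw [apply_ket]
  simp only [Gate.onBasis, rt]
  rw [single_eq_smul_ket, single_eq_smul_ket (x ^^^ 2 ^ q)]
  congr 2
  split_ifs <;> ring

lemma cnot_ket {c t : ℕ} (h : c ≠ t) (x : ℕ) : (Gate.cnot c t).apply O (ket x)
    = ket (if x.testBit c then x ^^^ 2 ^ t else x) := by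
  rw [apply_ket]
  simp [Gate.onBasis, h]

lemma crot_two_ket (c t x : ℕ) : (Gate.crot 2 c t).apply O (ket x)
    = (if x.testBit c ∧ x.testBit t then Complex.I else 1) • ket x := by
  rw [apply_ket]
  simp only [Gate.onBasis]
  rw [single_eq_smul_ket]
  congr 2
  have : (2 * Real.pi / 2 ^ 2 * Complex.I : ℂ) = Real.pi / 2 * Complex.I := by ring
  rw [this, Complex.exp_pi_div_two_mul_I]

lemma crot_one_ket (c t x : ℕ) : (Gate.crot 1 c t).apply O (ket x)
    = (if x.testBit c ∧ x.testBit t then -1 else 1 : ℂ) • ket x := by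
  rw [apply_ket]
  simp only [Gate.onBasis]
  rw [single_eq_smul_ket]
  congr 2
  have : (2 * Real.pi / 2 ^ 1 * Complex.I : ℂ) = Real.pi * Complex.I := by ring
  rw [this, Complex.exp_pi_mul_I]

lemma had_had_ket (q x : ℕ) :
    (Gate.had q).apply O ((Gate.had q).apply O (ket x)) = ket x := by
  rw [had_ket, map_add, map_smul, map_smul, had_ket, had_ket, testBit_flip_self, Nat.xor_assoc,
    Nat.xor_self, Nat.xor_zero]
  simp only [smul_add, smul_smul, mul_assoc, mul_left_comm rt, rt_mul_rt]
  cases x.testBit q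
  · simp only [Bool.false_eq_true, if_false, Bool.not_false, if_true]
    module
  · simp only [Bool.not_true, Bool.false_eq_true, if_false, if_true]
    module

/-- Conjugating a sign on qubit `q` with Hadamard gates flips the qubit. -/
lemma had_sign_had_ket (q x : ℕ) :
    (Gate.had q).apply O ((((if x.testBit q then -1 else 1) * rt) *
      (if x.testBit q then -1 else 1)) • ket x +
      (rt * (if (x ^^^ 2 ^ q).testBit q then -1 else 1)) • ket (x ^^^ 2 ^ q))
      = ket (x ^^^ 2 ^ q) := by
  rw [map_add, map_smul, map_smul, had_ket, had_ket, testBit_flip_self, Nat.xor_assoc,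
    Nat.xor_self, Nat.xor_zero]
  simp only [smul_add, smul_smul, mul_assoc, mul_left_comm rt, rt_mul_rt]
  cases x.testBit q
  · simp only [Bool.false_eq_true, if_false, Bool.not_false, if_true]
    module
  · simp only [Bool.not_true, Bool.false_eq_true, if_false, if_true]
    module

/-- The negation of a qubit. -/
def notL (q : ℕ) : List Gate := [.had q, .crot 1 q q, .had q]

/-- A controlled rotation over `π` whose control and target coincide is a `Z` gate, and `HZH` is the
negation. -/
lemma notL_ket (q x : ℕ) : applyL O (notL q) (ket x) = ket (x ^^^ 2 ^ q) := by
  simp only [notL, applyL_cons, applyL_nil]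
  rw [had_ket, map_add, map_smul, map_smul, crot_one_ket, crot_one_ket, smul_smul, smul_smul]
  simp only [and_self]
  exact had_sign_had_ket q x

/-- The Toffoli gate. -/
def ccxL (a b c : ℕ) : List Gate :=
  [.had c, .crot 2 a c, .cnot a b, .crot 2 b c, .crot 2 b c, .crot 2 b c, .cnot a b,
    .crot 2 b c, .had c]

/-- The permutation of the basis states under a Toffoli gate. -/
def ccxF (a b c x : ℕ) : ℕ := if x.testBit a && x.testBit b then x ^^^ 2 ^ c else x

/-- For bits, `a + b - (a ⊕ b) = 2ab`. The gates contribute the phases `i^(bc)`, `i^(3(a ⊕ b)c)` and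
`i^(ac)`, and `i³ = i⁻¹`, so the product is `i^(2abc)`. -/
lemma ccz_ket {a b c : ℕ} (hab : a ≠ b) (hbc : b ≠ c) (x : ℕ) :
    applyL O [.crot 2 a c, .cnot a b, .crot 2 b c, .crot 2 b c, .crot 2 b c, .cnot a b,
      .crot 2 b c] (ket x)
      = (if x.testBit a ∧ x.testBit b ∧ x.testBit c then -1 else 1 : ℂ) • ket x := by
  have h1 : (x ^^^ 2 ^ b).testBit a = x.testBit a := testBit_flip_ne x hab
  have h2 : (x ^^^ 2 ^ b).testBit c = x.testBit c := testBit_flip_ne x hbc.symm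
  have h3 : (x ^^^ 2 ^ b).testBit b = !x.testBit b := testBit_flip_self x b
  simp only [applyL_cons, applyL_nil, crot_two_ket, map_smul]
  rw [cnot_ket hab]
  cases ha : x.testBit a
  · simp only [Bool.false_eq_true, if_false, false_and, map_smul, crot_two_ket, smul_smul]
    rw [cnot_ket hab]
    simp only [ha, Bool.false_eq_true, if_false, false_and, crot_two_ket, smul_smul]
    congr 1
    split_ifs <;> simp
  · simp only [if_true, true_and, map_smul, crot_two_ket, smul_smul, h2, h3]
    rw [cnot_ket hab]
    simp only [h1, ha, if_true, crot_two_ket, smul_smul, Nat.xor_assoc, Nat.xor_self,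
      Nat.xor_zero, true_and]
    congr 1
    cases x.testBit b <;> cases x.testBit c <;> simp

lemma ccxL_ket {a b c : ℕ} (hab : a ≠ b) (hac : a ≠ c) (hbc : b ≠ c) (x : ℕ) :
    applyL O (ccxL a b c) (ket x) = ket (ccxF a b c x) := by
  have hl : ccxL a b c = [.had c] ++ ([.crot 2 a c, .cnot a b, .crot 2 b c, .crot 2 b c,
      .crot 2 b c, .cnot a b, .crot 2 b c] ++ [.had c]) := rfl
  have h1 : (x ^^^ 2 ^ c).testBit a = x.testBit a := testBit_flip_ne x hac
  have h2 : (x ^^^ 2 ^ c).testBit b = x.testBit b := testBit_flip_ne x hbc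
  rw [hl, applyL_append, applyL_append]
  rw [applyL_cons _ _ (ket x), applyL_nil, had_ket, map_add, map_smul, map_smul, ccz_ket hab hbc,
    ccz_ket hab hbc, smul_smul, smul_smul, h1, h2, applyL_cons, applyL_nil]
  unfold ccxF
  by_cases h : x.testBit a && x.testBit b
  · simp only [h, if_true]
    simp only [Bool.and_eq_true] at h
    simp only [h, true_and]
    exact had_sign_had_ket c x
  · simp only [h]
    have h' : ∀ p : Prop, ¬ (x.testBit a = true ∧ x.testBit b = true ∧ p) := by
      rintro p ⟨ha, hb, _⟩
      exact h (by simp [ha, hb])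
    simp only [h', if_false, mul_one]
    rw [← had_ket, had_had_ket]
    rfl

/-- Maps that flip the qubit `f` under a condition that does not depend on that qubit. -/
def CtlFlip (f : ℕ) (F : ℕ → ℕ) : Prop :=
  ∃ c : ℕ → Bool, (∀ x, c (x ^^^ 2 ^ f) = c x) ∧ ∀ x, F x = if c x then x ^^^ 2 ^ f else x

lemma CtlFlip.id (f : ℕ) : CtlFlip f (fun x => x) := ⟨fun _ => false, by simp, by simp⟩

lemma CtlFlip.comp {f : ℕ} {F G : ℕ → ℕ} (hF : CtlFlip f F) (hG : CtlFlip f G) :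
    CtlFlip f (fun x => F (G x)) := by
  obtain ⟨c, hc, hF⟩ := hF
  obtain ⟨d, hd, hG⟩ := hG
  refine ⟨fun x => c x ^^ d x, fun x => by simp only [hc, hd], fun x => ?_⟩
  simp only [hF, hG]
  by_cases h : d x <;> by_cases h' : c x <;> simp [h, h', hc]

/-- The condition does not see the flipped qubit, so it has the same value both times. -/
lemma CtlFlip.involutive {f : ℕ} {F : ℕ → ℕ} (hF : CtlFlip f F) (x : ℕ) : F (F x) = x := by
  obtain ⟨c, hc, hF⟩ := hF
  rw [hF (F x), hF x]
  cases h : c x <;> simp [h, hc]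

lemma CtlFlip.testBit_of_ne {f : ℕ} {F : ℕ → ℕ} (hF : CtlFlip f F) (x : ℕ) {q : ℕ}
    (h : q ≠ f) : (F x).testBit q = x.testBit q := by
  obtain ⟨c, _, hF⟩ := hF
  rw [hF x]
  split_ifs
  · exact testBit_flip_ne x h
  · rfl

lemma ctlFlip_ccxF {a b c : ℕ} (hac : a ≠ c) (hbc : b ≠ c) : CtlFlip c (ccxF a b c) :=
  ⟨fun x => x.testBit a && x.testBit b,
    fun x => by simp only [testBit_flip_ne x hac, testBit_flip_ne x hbc], fun _ => rfl⟩

/-- The permutation of the basis states under a controlled-NOT. -/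
def cnotF (a c x : ℕ) : ℕ := if x.testBit a then x ^^^ 2 ^ c else x

lemma ctlFlip_cnotF {a c : ℕ} (hac : a ≠ c) : CtlFlip c (cnotF a c) :=
  ⟨fun x => x.testBit a, fun x => by simp only [testBit_flip_ne x hac], fun _ => rfl⟩

/-! ### Zero prefixes -/

/-- The step of the computation of zero prefixes that treats the `k`-th qubit from above of a
register of `w` qubits. -/
def chainStep (w k : ℕ) : List Gate :=
  ccxL (w + k) (w - 1 - k) (w + k + 1) ++ [.cnot (w + k) (w + k + 1)]

def chainStepF (w k x : ℕ) : ℕ :=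
  ccxF (w + k) (w - 1 - k) (w + k + 1) (cnotF (w + k) (w + k + 1) x)

/-- The circuit that writes into the qubit `w + k`, for `k ≤ n`, whether the `k` upper qubits of
the register of `w` qubits are all zero. -/
def chainL (w : ℕ) : ℕ → List Gate
  | 0 => []
  | n + 1 => chainStep w n ++ chainL w n

def chainF (w : ℕ) : ℕ → ℕ → ℕ
  | 0, x => x
  | n + 1, x => chainStepF w n (chainF w n x)

/-- The inverse of `chainL`. -/
def unchainL (w : ℕ) : ℕ → List Gate
  | 0 => []
  | n + 1 => unchainL w n ++ chainStep w n

def unchainF (w : ℕ) : ℕ → ℕ → ℕ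
  | 0, x => x
  | n + 1, x => unchainF w n (chainStepF w n x)

lemma chainStep_ket {w k : ℕ} (hk : k < w) (x : ℕ) :
    applyL O (chainStep w k) (ket x) = ket (chainStepF w k x) := by
  rw [chainStep, applyL_append, applyL_cons, applyL_nil, cnot_ket (by omega),
    ccxL_ket (by omega) (by omega) (by omega)]
  rfl

lemma ctlFlip_chainStepF {w k : ℕ} (hk : k < w) : CtlFlip (w + k + 1) (chainStepF w k) :=
  (ctlFlip_ccxF (by omega) (by omega)).comp (ctlFlip_cnotF (by omega))

lemma chainL_ket {w n : ℕ} (hn : n ≤ w) (x : ℕ) :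
    applyL O (chainL w n) (ket x) = ket (chainF w n x) := by
  induction n with
  | zero => rfl
  | succ n ih => rw [chainL, applyL_append, ih (by omega), chainStep_ket (by omega)]; rfl

lemma unchainL_ket {w n : ℕ} (hn : n ≤ w) (x : ℕ) :
    applyL O (unchainL w n) (ket x) = ket (unchainF w n x) := by
  induction n generalizing x with
  | zero => rfl
  | succ n ih => rw [unchainL, applyL_append, chainStep_ket (by omega), ih (by omega)]; rfl

/-- Each step is its own inverse, so the same steps in reverse order undo the chain. -/
lemma unchainF_chainF {w n : ℕ} (hn : n ≤ w) (x : ℕ) : unchainF w n (chainF w n x) = x := by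
  induction n with
  | zero => rfl
  | succ n ih =>
    rw [chainF, unchainF, (ctlFlip_chainStepF (by omega)).involutive, ih (by omega)]

/-- A prefix of zeros grows by one qubit exactly if the next qubit is zero: this is what one step of
the chain computes. -/
lemma mod_two_pow_lt_iff (x m : ℕ) :
    x < 2 ^ m ↔ x < 2 ^ (m + 1) ∧ x.testBit m = false := by
  constructor
  · intro h
    exact ⟨h.trans (Nat.pow_lt_pow_right (by norm_num) (by omega)), Nat.testBit_lt_two_pow h⟩
  · rintro ⟨h, hb⟩
    refine Nat.lt_pow_two_of_testBit _ fun i hi => ?_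
    rcases hi.eq_or_lt with rfl | hi
    · exact hb
    · exact Nat.testBit_lt_two_pow (h.trans_le (Nat.pow_le_pow_right (by norm_num) hi))

/-- The qubit `w`, required to be set, stands for the empty prefix. A step copies the qubit of the
current prefix and then, by a Toffoli gate, erases the copy if the next qubit of the register is
set. -/
lemma chainF_testBit {w n x : ℕ} (hn : n ≤ w) (hx : x.testBit w = true)
    (hx' : ∀ q, w < q → q ≤ w + n → x.testBit q = false) (q : ℕ) :
    (chainF w n x).testBit q =
      if w < q ∧ q ≤ w + n then decide (x % 2 ^ w < 2 ^ (w - (q - w))) else x.testBit q := by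
  induction n generalizing q with
  | zero => rw [if_neg (by omega)]; rfl
  | succ n ih =>
    have ih := ih (by omega) (fun q h1 h2 => hx' q h1 (by omega))
    rw [chainF]
    by_cases hq : q = w + n + 1
    · subst hq
      rw [if_pos (by omega)]
      have h1 : (chainF w n x).testBit (w + n) = decide (x % 2 ^ w < 2 ^ (w - n)) := by
        rw [ih]
        rcases Nat.eq_zero_or_pos n with rfl | hn0
        · rw [if_neg (by omega)]
          simpa [hx] using Nat.mod_lt x (Nat.two_pow_pos w)
        · rw [if_pos (by omega), Nat.add_sub_cancel_left]
      have h2 : (chainF w n x).testBit (w + n + 1) = false := by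
        rw [ih, if_neg (by omega), hx' _ (by omega) (by omega)]
      have h3 : (chainF w n x).testBit (w - 1 - n) = (x % 2 ^ w).testBit (w - 1 - n) := by
        rw [ih, if_neg (by omega), Nat.testBit_mod_two_pow]
        simp [show w - 1 - n < w by omega]
      have h4 : decide (x % 2 ^ w < 2 ^ (w - (w + n + 1 - w)))
          = (decide (x % 2 ^ w < 2 ^ (w - n)) && !(x % 2 ^ w).testBit (w - 1 - n)) := by
        have e1 : w - (w + n + 1 - w) = w - 1 - n := by omega
        have e2 : w - n = w - 1 - n + 1 := by omega
        rw [e1, e2, Bool.eq_iff_iff, Bool.and_eq_true, decide_eq_true_iff, decide_eq_true_iff,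
          Bool.not_eq_true', mod_two_pow_lt_iff]
      rw [h4]
      unfold chainStepF
      set y := chainF w n x
      have hne : w + n ≠ w + n + 1 := by omega
      have hne' : w - 1 - n ≠ w + n + 1 := by omega
      cases hA : decide (x % 2 ^ w < 2 ^ (w - n)) <;> cases hB : (x % 2 ^ w).testBit (w - 1 - n) <;>
        rw [hA] at h1 <;> rw [hB] at h3 <;>
        simp [ccxF, cnotF, h1, h2, h3, testBit_flip_ne y hne, testBit_flip_ne y hne']
    · rw [(ctlFlip_chainStepF (by omega)).testBit_of_ne _ hq, ih]
      by_cases h : w < q ∧ q ≤ w + n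
      · rw [if_pos h, if_pos (by omega)]
      · rw [if_neg h, if_neg (by omega)]

/-! ### The flag -/

/-- The number of qubits for the index, the value and the position. -/
def width (L b : ℕ) : ℕ := L + 2 * b + 6

/-- The qubit for the flag. -/
def flagBit (L b : ℕ) : ℕ := 2 * width L b + 1

/-- Flip the flag if, for some `i < n`, the first nonzero qubit of the position register is the
one that belongs to the `i`-th qubit from above of the value, and the latter is nonzero. -/
def flagL (L b : ℕ) : ℕ → List Gate
  | 0 => []
  | n + 1 => ccxL (width L b + 7 + n) (L + b - 1 - n) (flagBit L b) ++
      (ccxL (width L b + 6 + n) (L + b - 1 - n) (flagBit L b) ++ flagL L b n)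

def flagF (L b : ℕ) : ℕ → ℕ → ℕ
  | 0, x => x
  | n + 1, x => ccxF (width L b + 7 + n) (L + b - 1 - n) (flagBit L b)
      (ccxF (width L b + 6 + n) (L + b - 1 - n) (flagBit L b) (flagF L b n x))

lemma flagL_ket {L b n : ℕ} (hn : n ≤ b) (x : ℕ) :
    applyL O (flagL L b n) (ket x) = ket (flagF L b n x) := by
  induction n with
  | zero => rfl
  | succ n ih =>
    rw [flagL, applyL_append, applyL_append, ih (by omega), ccxL_ket, ccxL_ket]
    · rfl
    all_goals (simp only [flagBit, width]; omega)

lemma ctlFlip_flagF {L b n : ℕ} (hn : n ≤ b) : CtlFlip (flagBit L b) (flagF L b n) := by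
  induction n with
  | zero => exact CtlFlip.id _
  | succ n ih =>
    refine (ctlFlip_ccxF ?_ ?_).comp ((ctlFlip_ccxF ?_ ?_).comp (ih (by omega)))
    all_goals (simp only [flagBit, width]; omega)

lemma ccxF_testBit_self {a b c : ℕ} (x : ℕ) :
    (ccxF a b c x).testBit c = (x.testBit c ^^ (x.testBit a && x.testBit b)) := by
  unfold ccxF
  split_ifs with h
  · rw [testBit_flip_self, h, Bool.xor_true]
  · rw [Bool.not_eq_true] at h
    rw [h, Bool.xor_false]

/-- The two Toffoli gates of round `i` flip the flag for `y < 2^(b-i)` and for `y < 2^(b-i-1)`. Both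
flips cancel, unless `y` lies between these powers, that is, unless `⌊log₂ y⌋ = b-1-i`; the control
on the value qubit selects that bit of `z`. At most one round has an effect. -/
lemma flagF_testBit {L b n x z y : ℕ} (hn : n ≤ b)
    (hA : ∀ i ≤ b, x.testBit (width L b + 6 + i) = decide (y < 2 ^ (b - i)))
    (hZ : ∀ i < b, x.testBit (L + i) = z.testBit i) :
    (flagF L b n x).testBit (flagBit L b) = (x.testBit (flagBit L b) ^^
      decide (2 ^ (b - n) ≤ y ∧ y < 2 ^ b ∧ z.testBit (Nat.log 2 y) = true)) := by
  induction n with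
  | zero =>
    have : ¬ (2 ^ (b - 0) ≤ y ∧ y < 2 ^ b ∧ z.testBit (Nat.log 2 y) = true) := by
      rintro ⟨h1, h2, _⟩
      rw [Nat.sub_zero] at h1
      omega
    simp only [this, decide_false, Bool.xor_false]
    rfl
  | succ n ih =>
    have ih := ih (by omega)
    have e1 : width L b + 6 + n ≠ flagBit L b := by unfold flagBit width; omega
    have e2 : width L b + 7 + n ≠ flagBit L b := by unfold flagBit width; omega
    have e3 : L + b - 1 - n ≠ flagBit L b := by unfold flagBit width; omega
    have hF := ctlFlip_flagF (L := L) (b := b) (n := n) (by omega)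
    rw [flagF, ccxF_testBit_self, ccxF_testBit_self, (ctlFlip_ccxF e1 e3).testBit_of_ne _ e2,
      (ctlFlip_ccxF e1 e3).testBit_of_ne _ e3, hF.testBit_of_ne _ e1, hF.testBit_of_ne _ e2,
      hF.testBit_of_ne _ e3, ih, hA n (by omega),
      show width L b + 7 + n = width L b + 6 + (n + 1) by omega, hA (n + 1) (by omega),
      show L + b - 1 - n = L + (b - 1 - n) by omega, hZ _ (by omega)]
    obtain ⟨m, rfl⟩ : ∃ m, b = n + 1 + m := ⟨b - (n + 1), by omega⟩
    rw [show n + 1 + m - n = m + 1 by omega, show n + 1 + m - (n + 1) = m by omega,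
      show n + 1 + m - 1 - n = m by omega]
    have hlt : 2 ^ m < 2 ^ (m + 1) := Nat.pow_lt_pow_right (by norm_num) (by omega)
    have hle : 2 ^ (m + 1) ≤ 2 ^ (n + 1 + m) := Nat.pow_le_pow_right (by norm_num) (by omega)
    rcases lt_or_ge y (2 ^ m) with h1 | h1
    · have h2 : ¬ 2 ^ m ≤ y := by omega
      have h3 : ¬ 2 ^ (m + 1) ≤ y := by omega
      simp [h1, h1.trans hlt, h2, h3]
    · rcases lt_or_ge y (2 ^ (m + 1)) with h2 | h2
      · have h3 : ¬ y < 2 ^ m := by omega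
        have h4 : ¬ 2 ^ (m + 1) ≤ y := by omega
        have h5 : Nat.log 2 y = m := Nat.log_eq_of_pow_le_of_lt_pow h1 h2
        simp [h1, h2, h3, h4, h5, h2.trans_le hle]
      · have h3 : ¬ y < 2 ^ m := by omega
        have h4 : ¬ y < 2 ^ (m + 1) := by omega
        simp [h1, h2, h3, h4]

/-! ### Labels of basis states -/

/-- The basis state with index `j`, value `z` and position `y`, in which the qubit above these
registers is set. -/
def lab (L b j z y : ℕ) : ℕ := 2 ^ L * (2 ^ b * (2 ^ (b + 6) * 1 + y) + z) + j

section lab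

variable {L b j z y : ℕ}

lemma lab_testBit (hj : j < 2 ^ L) (hz : z < 2 ^ b) (hy : y < 2 ^ (b + 6)) (q : ℕ) :
    (lab L b j z y).testBit q = if q < L then j.testBit q else if q < L + b then z.testBit (q - L)
      else if q < width L b then y.testBit (q - (L + b)) else decide (q = width L b) := by
  have h1 : ∀ i, Nat.testBit 1 i = decide (0 = i) := fun i => by
    simpa using Nat.testBit_two_pow (n := 0) (m := i)
  unfold lab width
  rw [Nat.testBit_two_pow_mul_add _ hj, Nat.testBit_two_pow_mul_add _ hz,
    Nat.testBit_two_pow_mul_add _ hy, h1]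
  split_ifs <;> first | rfl | omega | skip
  · congr 1; omega
  · rw [Nat.sub_sub, Nat.sub_sub, Bool.eq_iff_iff]
    simp only [decide_eq_true_iff]
    omega

lemma lab_mod (hj : j < 2 ^ L) (hz : z < 2 ^ b) (hy : y < 2 ^ (b + 6)) :
    lab L b j z y % 2 ^ width L b = 2 ^ L * (2 ^ b * y + z) + j := by
  have h1 : lab L b j z y = 2 ^ width L b * 1 + (2 ^ L * (2 ^ b * y + z) + j) := by
    unfold lab width
    rw [show L + 2 * b + 6 = L + (b + (b + 6)) by ring, pow_add 2 L, pow_add 2 b]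
    ring
  rw [h1, Nat.mul_add_mod, Nat.mod_eq_of_lt]
  have h2 : 2 ^ b * y + z + 1 ≤ 2 ^ b * 2 ^ (b + 6) := by nlinarith
  calc 2 ^ L * (2 ^ b * y + z) + j < 2 ^ L * (2 ^ b * y + z + 1) := by nlinarith
    _ ≤ 2 ^ L * (2 ^ b * 2 ^ (b + 6)) := Nat.mul_le_mul_left _ h2
    _ = 2 ^ width L b := by unfold width; rw [← pow_add, ← pow_add]; congr 1; ring

lemma lab_mod_index (hj : j < 2 ^ L) : lab L b j z y % 2 ^ L = j := by
  unfold lab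
  rw [Nat.mul_add_mod, Nat.mod_eq_of_lt hj]

lemma lab_injective {j' y' : ℕ} (hj : j < 2 ^ L) (hj' : j' < 2 ^ L)
    (h : lab L b j z y = lab L b j' z y') : j = j' ∧ y = y' := by
  have h1 : j = j' := by rw [← lab_mod_index hj (b := b) (z := z) (y := y), h, lab_mod_index hj']
  subst h1
  refine ⟨rfl, ?_⟩
  unfold lab at h
  have h2 := Nat.eq_of_mul_eq_mul_left (Nat.two_pow_pos L) (Nat.add_right_cancel h)
  have h3 := Nat.eq_of_mul_eq_mul_left (Nat.two_pow_pos b) (Nat.add_right_cancel h2)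
  omega

/-- The position occupies the upper qubits of the register, so zero prefixes of the whole register,
which the reflection about `0` also needs, are as well the comparisons of the position with powers
of two. -/
lemma prefix_lt_iff (hj : j < 2 ^ L) (hz : z < 2 ^ b) {i : ℕ} :
    2 ^ L * (2 ^ b * y + z) + j < 2 ^ (L + b + i) ↔ y < 2 ^ i := by
  rw [show L + b + i = L + (b + i) by ring, pow_add 2 L, pow_add 2 b]
  constructor
  · intro h
    by_contra hy
    have h1 : 2 ^ b * 2 ^ i ≤ 2 ^ b * y := Nat.mul_le_mul_left _ (by omega)
    have h2 : 2 ^ L * (2 ^ b * 2 ^ i) ≤ 2 ^ L * (2 ^ b * y + z) := Nat.mul_le_mul_left _ (by omega)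
    omega
  · intro h
    have h1 : 2 ^ b * (y + 1) ≤ 2 ^ b * 2 ^ i := Nat.mul_le_mul_left _ h
    have h2 : 2 ^ L * (2 ^ b * y + z + 1) ≤ 2 ^ L * (2 ^ b * 2 ^ i) :=
      Nat.mul_le_mul_left _ (by rw [mul_add] at h1; omega)
    rw [mul_add (2 ^ L) (_ + z)] at h2
    omega

lemma lab_flip_index {q : ℕ} (hj : j < 2 ^ L) (hz : z < 2 ^ b) (hy : y < 2 ^ (b + 6))
    (hq : q < L) : lab L b j z y ^^^ 2 ^ q = lab L b (j ^^^ 2 ^ q) z y := by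
  have hj' : j ^^^ 2 ^ q < 2 ^ L :=
    Nat.xor_lt_two_pow hj (Nat.pow_lt_pow_right (by norm_num) hq)
  refine Nat.eq_of_testBit_eq fun i => ?_
  rw [Nat.testBit_xor, lab_testBit hj hz hy, lab_testBit hj' hz hy, Nat.testBit_two_pow,
    Nat.testBit_xor, Nat.testBit_two_pow]
  have : q < L := hq
  split_ifs with h1 h2 h3
  · rfl
  · rw [decide_eq_false (by omega), Bool.xor_false]
  · rw [decide_eq_false (by omega), Bool.xor_false]
  · rw [decide_eq_false (p := q = i) (by omega), Bool.xor_false]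

lemma lab_flip_position {q : ℕ} (hj : j < 2 ^ L) (hz : z < 2 ^ b) (hy : y < 2 ^ (b + 6))
    (hq : q < b + 6) : lab L b j z y ^^^ 2 ^ (L + b + q) = lab L b j z (y ^^^ 2 ^ q) := by
  have hy' : y ^^^ 2 ^ q < 2 ^ (b + 6) :=
    Nat.xor_lt_two_pow hy (Nat.pow_lt_pow_right (by norm_num) hq)
  refine Nat.eq_of_testBit_eq fun i => ?_
  rw [Nat.testBit_xor, lab_testBit hj hz hy, lab_testBit hj hz hy', Nat.testBit_two_pow,
    Nat.testBit_xor, Nat.testBit_two_pow]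
  have : width L b = L + b + (b + 6) := by unfold width; ring
  split_ifs with h1 h2 h3
  · rw [decide_eq_false (by omega), Bool.xor_false]
  · rw [decide_eq_false (by omega), Bool.xor_false]
  · congr 2
    rw [eq_iff_iff]; omega
  · rw [decide_eq_false (p := L + b + q = i) (by omega), Bool.xor_false]

lemma lab_xor_value {z' : ℕ} (hj : j < 2 ^ L) (hz : z < 2 ^ b) (hz' : z' < 2 ^ b)
    (hy : y < 2 ^ (b + 6)) : lab L b j z y ^^^ (z' <<< L) = lab L b j (z ^^^ z') y := by
  have hzz : z ^^^ z' < 2 ^ b := Nat.xor_lt_two_pow hz hz'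
  refine Nat.eq_of_testBit_eq fun i => ?_
  rw [Nat.testBit_xor, lab_testBit hj hz hy, lab_testBit hj hzz hy, Nat.testBit_shiftLeft,
    Nat.testBit_xor]
  split_ifs with h1 h2 h3
  · rw [decide_eq_false (by omega), Bool.false_and, Bool.xor_false]
  · rw [decide_eq_true (by omega), Bool.true_and]
  all_goals
    rw [Nat.testBit_lt_two_pow (x := z') (i := i - L)
      (hz'.trans_le (Nat.pow_le_pow_right (by norm_num) (by omega))), Bool.and_false,
      Bool.xor_false]

end lab

/-! ### The computation of the flag -/

/-- Whether the position `y` selects a nonzero bit of the value `z`. -/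
def good (b z y : ℕ) : Bool := decide (1 ≤ y ∧ y < 2 ^ b ∧ z.testBit (Nat.log 2 y) = true)

/-- The circuit that computes the flag. -/
def computeL (L b : ℕ) : List Gate :=
  flagL L b b ++ (chainL (width L b) (width L b) ++ [.query])

/-- The inverse of `computeL`. -/
def uncomputeL (L b : ℕ) : List Gate :=
  .query :: (unchainL (width L b) (width L b) ++ flagL L b b)

def queryF (O : Oracle) (x : ℕ) : ℕ := x ^^^ (O.val (x % 2 ^ O.idx) <<< O.idx)

lemma query_ket (x : ℕ) : Gate.query.apply O (ket x) = ket (queryF O x) := apply_ket _ _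

lemma queryF_queryF (x : ℕ) : queryF O (queryF O x) = x := by
  have h : queryF O x % 2 ^ O.idx = x % 2 ^ O.idx := by
    unfold queryF
    apply Nat.eq_of_testBit_eq
    intro i
    by_cases hi : i < O.idx
    · simp [Nat.testBit_mod_two_pow, Nat.testBit_xor, Nat.testBit_shiftLeft, hi, Nat.not_le.2 hi]
    · simp [Nat.testBit_mod_two_pow, hi]
  rw [queryF, h, queryF]
  simp

def computeF (O : Oracle) (b x : ℕ) : ℕ :=
  flagF O.idx b b (chainF (width O.idx b) (width O.idx b) (queryF O x))

lemma computeL_ket (b x : ℕ) : applyL O (computeL O.idx b) (ket x) = ket (computeF O b x) := by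
  rw [computeL, applyL_append, applyL_append, applyL_cons, applyL_nil, query_ket,
    chainL_ket le_rfl, flagL_ket le_rfl]
  rfl

lemma uncomputeL_ket (b x : ℕ) :
    applyL O (uncomputeL O.idx b) (ket (computeF O b x)) = ket x := by
  rw [uncomputeL, applyL_cons, applyL_append, flagL_ket le_rfl, computeF,
    (ctlFlip_flagF le_rfl).involutive, unchainL_ket le_rfl, unchainF_chainF le_rfl, query_ket,
    queryF_queryF]

/-- The circuit has a left inverse. Injectivity ensures that different pairs do not interfere when
all qubits are measured. -/
lemma computeF_injective (b : ℕ) : Function.Injective (computeF O b) := by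
  intro x x' h
  have h1 := uncomputeL_ket (O := O) b x
  rw [h, uncomputeL_ket] at h1
  exact (Finsupp.single_left_injective one_ne_zero h1).symm

lemma computeF_flag {b j y : ℕ} (hO : ∀ i, O.val i < 2 ^ b) (hj : j < 2 ^ O.idx)
    (hy : y < 2 ^ (b + 6)) :
    (computeF O b (lab O.idx b j 0 y)).testBit (flagBit O.idx b) = good b (O.val j) y := by
  set L := O.idx with hL
  have hq : queryF O (lab L b j 0 y) = lab L b j (O.val j) y := by
    rw [queryF, ← hL, lab_mod_index hj, lab_xor_value hj (Nat.two_pow_pos b) (hO j) hy,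
      Nat.zero_xor]
  have hc : ∀ q, (chainF (width L b) (width L b) (lab L b j (O.val j) y)).testBit q =
      if width L b < q ∧ q ≤ width L b + width L b then
        decide (lab L b j (O.val j) y % 2 ^ width L b < 2 ^ (width L b - (q - width L b)))
      else (lab L b j (O.val j) y).testBit q := by
    have hw : L + b ≤ width L b := by unfold width; omega
    refine chainF_testBit le_rfl ?_ fun q h1 _ => ?_
    · rw [lab_testBit hj (hO j) hy, if_neg (by omega), if_neg (by omega), if_neg (by omega)]
      simp
    · rw [lab_testBit hj (hO j) hy, if_neg (by omega), if_neg (by omega), if_neg (by omega)]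
      simp; omega
  have hw : width L b = L + b + (b + 6) := by unfold width; ring
  rw [computeF, hq, ← hL, flagF_testBit (z := O.val j) (y := y) le_rfl, hc, if_neg, lab_testBit hj (hO j) hy,
    if_neg, if_neg, if_neg, decide_eq_false, Bool.false_xor, good, Nat.sub_self, pow_zero]
  · unfold flagBit; omega
  · unfold flagBit; omega
  · unfold flagBit; omega
  · unfold flagBit; omega
  · unfold flagBit; omega
  · intro i hi
    rw [hc, if_pos (by omega), lab_mod hj (hO j) hy, Bool.eq_iff_iff, decide_eq_true_iff,
      decide_eq_true_iff, ← prefix_lt_iff hj (hO j) (i := b - i)]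
    rw [show width L b - (width L b + 6 + i - width L b) = L + b + (b - i) by omega]
  · intro i hi
    rw [hc, if_neg (by omega), lab_testBit hj (hO j) hy, if_neg (by omega), if_pos (by omega),
      Nat.add_sub_cancel_left]

/-- The number of positions that select a nonzero bit. -/
lemma card_good {b z : ℕ} (hz : z < 2 ^ b) (c : ℕ) :
    ((Finset.range (2 ^ (b + c))).filter fun y => good b z y = true).card = z := by
  have h1 : (Finset.range (2 ^ (b + c))).filter (fun y => good b z y = true)
      = (Finset.range (2 ^ b)).filter fun y => 1 ≤ y ∧ z.testBit (Nat.log 2 y) = true := by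
    ext y
    have : 2 ^ b ≤ 2 ^ (b + c) := Nat.pow_le_pow_right (by norm_num) (by omega)
    simp only [good, Finset.mem_filter, Finset.mem_range, decide_eq_true_iff]
    constructor
    · rintro ⟨_, h1, h2, h3⟩; exact ⟨h2, h1, h3⟩
    · rintro ⟨h2, h1, h3⟩; exact ⟨by omega, h1, h2, h3⟩
  rw [h1]
  clear h1
  induction b generalizing z with
  | zero =>
    obtain rfl : z = 0 := by simpa using hz
    simp
  | succ b ih =>
    have h2 := ih (Nat.mod_lt z (Nat.two_pow_pos b))
    -- The positions with logarithm `b` are the `2^b` numbers from `2^b` to `2^(b+1) - 1`; they are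
    -- all good or all bad, according to the top bit of `z`, and thus contribute exactly its weight.
    have hsplit : (Finset.range (2 ^ (b + 1))).filter
          (fun y => 1 ≤ y ∧ z.testBit (Nat.log 2 y) = true)
        = (Finset.range (2 ^ b)).filter
            (fun y => 1 ≤ y ∧ (z % 2 ^ b).testBit (Nat.log 2 y) = true)
          ∪ (Finset.Ico (2 ^ b) (2 ^ (b + 1))).filter (fun _ => z.testBit b = true) := by
      ext y
      simp only [Finset.mem_filter, Finset.mem_range, Finset.mem_union, Finset.mem_Ico]
      have hp := Nat.two_pow_pos b
      rcases lt_or_ge y (2 ^ b) with h | h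
      · have h' : y < 2 ^ (b + 1) := h.trans (Nat.pow_lt_pow_right (by norm_num) (by omega))
        rcases Nat.eq_zero_or_pos y with rfl | hy
        · simp
        · have hl : Nat.log 2 y < b := Nat.log_lt_of_lt_pow (by omega) h
          simp [h, h', Nat.testBit_mod_two_pow, hl]
      · constructor
        · rintro ⟨h1, h2, h3⟩
          rw [Nat.log_eq_of_pow_le_of_lt_pow h h1] at h3
          exact Or.inr ⟨⟨h, h1⟩, h3⟩
        · rintro (⟨h1, _⟩ | ⟨⟨_, h1⟩, h3⟩)
          · omega
          · rw [Nat.log_eq_of_pow_le_of_lt_pow h h1]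
            exact ⟨h1, by omega, h3⟩
    rw [hsplit, Finset.card_union_of_disjoint, h2]
    · cases hb : z.testBit b
      · rw [Finset.filter_false_of_mem (by simp)]
        have := (mod_two_pow_lt_iff z b).2 ⟨hz, hb⟩
        simp [Nat.mod_eq_of_lt this]
      · rw [Finset.filter_true_of_mem (by simp), Nat.card_Ico]
        have h3 : 2 ^ b ≤ z := Nat.ge_two_pow_of_testBit hb
        rw [pow_succ] at hz ⊢
        rw [Nat.mod_eq_sub_mod h3, Nat.mod_eq_of_lt (by omega)]
        omega
    · rw [Finset.disjoint_left]
      intro y h h'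
      simp only [Finset.mem_filter, Finset.mem_range, Finset.mem_Ico] at h h'
      omega

/-! ### Layers of Hadamard gates -/

/-- Hadamard gates on the qubits `p, …, p + n - 1`. -/
def hL (p : ℕ) : ℕ → List Gate
  | 0 => []
  | n + 1 => .had (p + n) :: hL p n

lemma linearMap_ext_ket {F G : StateVec →ₗ[ℂ] StateVec} (h : ∀ x, F (ket x) = G (ket x)) :
    F = G := Finsupp.lhom_ext' fun x => LinearMap.ext_ring (h x)

lemma had_had (q : ℕ) (ψ : StateVec) :
    (Gate.had q).apply O ((Gate.had q).apply O ψ) = ψ :=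
  LinearMap.congr_fun (linearMap_ext_ket (F := (Gate.had q).apply O ∘ₗ (Gate.had q).apply O)
    (G := LinearMap.id) (had_had_ket q)) ψ

lemma had_comm (p q : ℕ) (ψ : StateVec) : (Gate.had p).apply O ((Gate.had q).apply O ψ)
    = (Gate.had q).apply O ((Gate.had p).apply O ψ) := by
  rcases eq_or_ne p q with rfl | hpq
  · rfl
  refine LinearMap.congr_fun (linearMap_ext_ket (F := (Gate.had p).apply O ∘ₗ (Gate.had q).apply O)
    (G := (Gate.had q).apply O ∘ₗ (Gate.had p).apply O) fun x => ?_) ψ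
  have h1 : x ^^^ 2 ^ q ^^^ 2 ^ p = x ^^^ 2 ^ p ^^^ 2 ^ q := Nat.xor_right_comm x _ _
  simp only [LinearMap.comp_apply, had_ket, map_add, map_smul, testBit_flip_ne x hpq,
    testBit_flip_ne x hpq.symm, h1, smul_add, smul_smul]
  cases x.testBit p <;> cases x.testBit q <;> simp only [Bool.false_eq_true, if_false, if_true] <;>
    module

lemma had_applyL_map (q : ℕ) (l : List ℕ) (ψ : StateVec) :
    (Gate.had q).apply O (applyL O (l.map .had) ψ) = applyL O (l.map .had) ((Gate.had q).apply O ψ) := by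
  induction l with
  | nil => rfl
  | cons p l ih => rw [List.map_cons, applyL_cons, applyL_cons, had_comm, ih]

lemma applyL_map_had_twice (l : List ℕ) (ψ : StateVec) :
    applyL O (l.map .had) (applyL O (l.map .had) ψ) = ψ := by
  induction l with
  | nil => rfl
  | cons p l ih =>
    rw [List.map_cons, applyL_cons, applyL_cons, ← had_applyL_map, had_had, ih]

lemma hL_eq_map (p n : ℕ) : ∃ l : List ℕ, hL p n = l.map .had := by
  induction n with
  | zero => exact ⟨[], rfl⟩
  | succ n ih =>
    obtain ⟨l, hl⟩ := ih
    exact ⟨(p + n) :: l, by rw [hL, hl, List.map_cons]⟩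

/-- The labelling `g` turns the flips of the qubits `p, p+1, …` into addition of powers of two, so
that the gate on qubit `p + n` doubles the range of the summation. -/
lemma hL_uniform {p n : ℕ} {g : ℕ → ℕ} (hg : ∀ m < n, ∀ t < 2 ^ m,
    g t ^^^ 2 ^ (p + m) = g (t + 2 ^ m) ∧ (g t).testBit (p + m) = false) :
    applyL O (hL p n) (ket (g 0)) = ∑ t ∈ Finset.range (2 ^ n), rt ^ n • ket (g t) := by
  induction n with
  | zero => simp [hL, applyL_nil]
  | succ n ih =>
    rw [hL, applyL_cons, ih fun m hm => hg m (by omega), map_sum, pow_succ, mul_two,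
      Finset.sum_range_add, ← Finset.sum_add_distrib]
    refine Finset.sum_congr rfl fun t ht => ?_
    obtain ⟨h1, h2⟩ := hg n (by omega) t (Finset.mem_range.1 ht)
    rw [map_smul, had_ket, h1, h2, add_comm (2 ^ n) t, smul_add, smul_smul, smul_smul, pow_succ]
    simp

/-- Hadamard gates on the index and the position. -/
def layerL (L b : ℕ) : List Gate := hL (L + b) (b + 6) ++ hL 0 L

lemma layerL_twice (L b : ℕ) (ψ : StateVec) :
    applyL O (layerL L b) (applyL O (layerL L b) ψ) = ψ := by
  obtain ⟨l, hl⟩ := hL_eq_map (L + b) (b + 6)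
  obtain ⟨l', hl'⟩ := hL_eq_map 0 L
  rw [layerL, hl, hl', ← List.map_append, applyL_map_had_twice]

/-- The pairs of an index and a position. -/
def pairs (L b : ℕ) : Finset (ℕ × ℕ) := Finset.range (2 ^ L) ×ˢ Finset.range (2 ^ (b + 6))

/-- The basis state of a pair. -/
def pairLab (L b : ℕ) (u : ℕ × ℕ) : ℕ := lab L b u.1 0 u.2

/-- The state with given amplitudes at the pairs. -/
noncomputable def vec (L b : ℕ) (φ : ℕ × ℕ → ℂ) : StateVec :=
  ∑ u ∈ pairs L b, φ u • ket (pairLab L b u)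

lemma mem_pairs {L b : ℕ} {u : ℕ × ℕ} :
    u ∈ pairs L b ↔ u.1 < 2 ^ L ∧ u.2 < 2 ^ (b + 6) := by simp [pairs]

lemma pairLab_inj {L b : ℕ} {u u' : ℕ × ℕ} (hu : u ∈ pairs L b) (hu' : u' ∈ pairs L b)
    (h : pairLab L b u = pairLab L b u') : u = u' :=
  Prod.ext_iff.2 (lab_injective (mem_pairs.1 hu).1 (mem_pairs.1 hu').1 h)

lemma layerL_zero (L b : ℕ) : applyL O (layerL L b) (ket (pairLab L b (0, 0)))
    = vec L b fun _ => rt ^ (L + b + 6) := by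
  have hp := Nat.two_pow_pos
  have h1 : applyL O (hL 0 L) (ket (pairLab L b (0, 0)))
      = ∑ t ∈ Finset.range (2 ^ L), rt ^ L • ket (lab L b t 0 0) := by
    refine hL_uniform (g := fun t => lab L b t 0 0) fun m hm t ht => ?_
    have ht' : t < 2 ^ L := ht.trans (Nat.pow_lt_pow_right (by norm_num) hm)
    simp only [zero_add]
    rw [lab_flip_index ht' (hp _) (hp _) hm, lab_testBit ht' (hp _) (hp _), if_pos hm]
    refine ⟨?_, Nat.testBit_lt_two_pow ht⟩
    congr 1
    refine Nat.eq_of_testBit_eq fun i => ?_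
    have := Nat.testBit_two_pow_mul_add 1 ht i
    rw [mul_one, add_comm] at this
    rw [this, Nat.testBit_xor, Nat.testBit_two_pow]
    split_ifs with h
    · rw [decide_eq_false (by omega), Bool.xor_false]
    · rw [Nat.testBit_lt_two_pow (ht.trans_le (Nat.pow_le_pow_right (by norm_num) (by omega))),
        Bool.false_xor]
      have := Nat.testBit_two_pow (n := 0) (m := i - m)
      rw [pow_zero] at this
      rw [this, Bool.eq_iff_iff, decide_eq_true_iff, decide_eq_true_iff]
      omega
  have h2 : ∀ j < 2 ^ L, applyL O (hL (L + b) (b + 6)) (ket (lab L b j 0 0))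
      = ∑ t ∈ Finset.range (2 ^ (b + 6)), rt ^ (b + 6) • ket (lab L b j 0 t) := by
    intro j hj
    refine hL_uniform (g := fun t => lab L b j 0 t) fun m hm t ht => ?_
    have ht' : t < 2 ^ (b + 6) := ht.trans (Nat.pow_lt_pow_right (by norm_num) hm)
    rw [lab_flip_position hj (hp _) ht' hm, lab_testBit hj (hp _) ht', if_neg (by omega),
      if_neg (by omega), if_pos (by unfold width; omega), Nat.add_sub_cancel_left]
    refine ⟨?_, Nat.testBit_lt_two_pow ht⟩
    congr 1
    refine Nat.eq_of_testBit_eq fun i => ?_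
    have := Nat.testBit_two_pow_mul_add 1 ht i
    rw [mul_one, add_comm] at this
    rw [this, Nat.testBit_xor, Nat.testBit_two_pow]
    split_ifs with h
    · rw [decide_eq_false (by omega), Bool.xor_false]
    · rw [Nat.testBit_lt_two_pow (ht.trans_le (Nat.pow_le_pow_right (by norm_num) (by omega))),
        Bool.false_xor]
      have := Nat.testBit_two_pow (n := 0) (m := i - m)
      rw [pow_zero] at this
      rw [this, Bool.eq_iff_iff, decide_eq_true_iff, decide_eq_true_iff]
      omega
  rw [layerL, applyL_append, h1, map_sum, vec, pairs, Finset.sum_product]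
  refine Finset.sum_congr rfl fun j hj => ?_
  rw [map_smul, h2 j (Finset.mem_range.1 hj), Finset.smul_sum]
  refine Finset.sum_congr rfl fun t _ => ?_
  rw [smul_smul, ← pow_add, add_assoc]
  rfl

/-! ### Reflections -/

/-- The span of the basis states of the pairs. -/
noncomputable def pairSpan (L b : ℕ) : Submodule ℂ StateVec :=
  Submodule.span ℂ ((fun u => ket (pairLab L b u)) '' (pairs L b : Set (ℕ × ℕ)))

lemma ket_mem_pairSpan {L b : ℕ} {u : ℕ × ℕ} (hu : u ∈ pairs L b) :
    ket (pairLab L b u) ∈ pairSpan L b := Submodule.subset_span ⟨u, hu, rfl⟩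

lemma vec_mem_pairSpan (L b : ℕ) (φ : ℕ × ℕ → ℂ) : vec L b φ ∈ pairSpan L b :=
  Submodule.sum_mem _ fun _ hu => Submodule.smul_mem _ _ (ket_mem_pairSpan hu)

lemma had_mem_pairSpan {L b q : ℕ} (h : ∀ u ∈ pairs L b, ∃ u' ∈ pairs L b,
    pairLab L b u ^^^ 2 ^ q = pairLab L b u') {ψ : StateVec} (hψ : ψ ∈ pairSpan L b) :
    (Gate.had q).apply O ψ ∈ pairSpan L b := by
  refine (Submodule.span_le (p := (pairSpan L b).comap ((Gate.had q).apply O))).2 ?_ hψ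
  rintro _ ⟨u, hu, rfl⟩
  obtain ⟨u', hu', he⟩ := h u hu
  rw [SetLike.mem_coe, Submodule.mem_comap, had_ket, he]
  exact Submodule.add_mem _ (Submodule.smul_mem _ _ (ket_mem_pairSpan hu))
    (Submodule.smul_mem _ _ (ket_mem_pairSpan hu'))

/-- `zeroL` is only a reflection on states whose value and ancilla qubits are clean; this lemma
makes it applicable between two Hadamard layers. -/
lemma layerL_mem_pairSpan {L b : ℕ} {ψ : StateVec} (hψ : ψ ∈ pairSpan L b) :
    applyL O (layerL L b) ψ ∈ pairSpan L b := by
  have hp := Nat.two_pow_pos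
  have h1 : ∀ n ≤ L, applyL O (hL 0 n) ψ ∈ pairSpan L b := by
    intro n
    induction n with
    | zero => exact fun _ => hψ
    | succ n ih =>
      intro hn
      refine had_mem_pairSpan (fun u hu => ?_) (ih (by omega))
      obtain ⟨hj, hy⟩ := mem_pairs.1 hu
      refine ⟨(u.1 ^^^ 2 ^ n, u.2), mem_pairs.2 ⟨Nat.xor_lt_two_pow hj
        (Nat.pow_lt_pow_right (by norm_num) hn), hy⟩, ?_⟩
      rw [zero_add]
      exact lab_flip_index hj (hp _) hy hn
  have h2 : ∀ n ≤ b + 6, applyL O (hL (L + b) n) (applyL O (hL 0 L) ψ) ∈ pairSpan L b := by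
    intro n
    induction n with
    | zero => exact fun _ => h1 L le_rfl
    | succ n ih =>
      intro hn
      refine had_mem_pairSpan (fun u hu => ?_) (ih (by omega))
      obtain ⟨hj, hy⟩ := mem_pairs.1 hu
      exact ⟨(u.1, u.2 ^^^ 2 ^ n), mem_pairs.2 ⟨hj, Nat.xor_lt_two_pow hy
        (Nat.pow_lt_pow_right (by norm_num) hn)⟩, lab_flip_position hj (hp _) hy hn⟩
  rw [layerL, applyL_append]
  exact h2 _ le_rfl

/-- The reflection that changes the sign of the basis state of the pair `(0, 0)`. -/
def zeroL (L b : ℕ) : List Gate :=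
  unchainL (width L b) (width L b) ++
    (.crot 1 (2 * width L b) (2 * width L b) :: chainL (width L b) (width L b))

/-- The last qubit of the chain says that the whole register is zero; a `Z` gate on it gives the
sign, and the chain is undone. -/
lemma zeroL_ket {L b : ℕ} {u : ℕ × ℕ} (hu : u ∈ pairs L b) :
    applyL O (zeroL L b) (ket (pairLab L b u))
      = (if u = (0, 0) then -1 else 1 : ℂ) • ket (pairLab L b u) := by
  obtain ⟨hj, hy⟩ := mem_pairs.1 hu
  have hz : 0 < 2 ^ b := Nat.two_pow_pos b
  have hw : width L b = L + b + (b + 6) := by unfold width; ring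
  have hbit : (chainF (width L b) (width L b) (pairLab L b u)).testBit (2 * width L b)
      = decide (u = (0, 0)) := by
    unfold pairLab
    rw [chainF_testBit le_rfl, if_pos (by omega), lab_mod hj hz hy, Bool.eq_iff_iff,
      decide_eq_true_iff, decide_eq_true_iff,
      show width L b - (2 * width L b - width L b) = 0 by omega, pow_zero, Nat.lt_one_iff,
      Prod.ext_iff]
    · have h1 := Nat.two_pow_pos L
      constructor
      · intro h
        have h2 : 2 ^ L * (2 ^ b * u.2 + 0) = 0 := by omega
        refine ⟨by simp; omega, ?_⟩
        simpa using h2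
      · rintro ⟨h2, h3⟩
        simp only at h2 h3
        rw [h2, h3]; simp
    · rw [lab_testBit hj hz hy, if_neg (by omega), if_neg (by omega), if_neg (by omega)]
      simp
    · intro q h1 _
      rw [lab_testBit hj hz hy, if_neg (by omega), if_neg (by omega), if_neg (by omega)]
      simp; omega
  rw [zeroL, applyL_append, applyL_cons, chainL_ket le_rfl, crot_one_ket, map_smul,
    unchainL_ket le_rfl, unchainF_chainF le_rfl, hbit]
  simp

lemma zeroL_apply {L b : ℕ} {ψ : StateVec} (hψ : ψ ∈ pairSpan L b) :
    applyL O (zeroL L b) ψ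
      = ψ - (2 * ψ (pairLab L b (0, 0))) • ket (pairLab L b (0, 0)) := by
  have h0 : (0, 0) ∈ pairs L b := mem_pairs.2 ⟨Nat.two_pow_pos _, Nat.two_pow_pos _⟩
  let D : StateVec →ₗ[ℂ] StateVec := LinearMap.id - (LinearMap.toSpanSingleton ℂ _
    (ket (pairLab L b (0, 0)))) ∘ₗ ((2 : ℂ) • Finsupp.lapply (pairLab L b (0, 0)))
  have hD : ∀ ψ, D ψ = ψ - (2 * ψ (pairLab L b (0, 0))) • ket (pairLab L b (0, 0)) := by
    intro ψ
    simp only [D, LinearMap.sub_apply, LinearMap.id_apply, LinearMap.comp_apply,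
      LinearMap.smul_apply, Finsupp.lapply_apply, LinearMap.toSpanSingleton_apply, smul_eq_mul]
  rw [← hD]
  refine LinearMap.eqOn_span (f := applyL O (zeroL L b)) (g := D) ?_ hψ
  rintro _ ⟨u, hu, rfl⟩
  simp only
  rw [hD, zeroL_ket hu]
  by_cases h : u = (0, 0)
  · subst h
    simp only [if_true, Finsupp.single_eq_same, mul_one]
    module
  · have hne : pairLab L b u ≠ pairLab L b (0, 0) := fun he => h (pairLab_inj hu h0 he)
    rw [if_neg h, one_smul, Finsupp.single_eq_of_ne hne.symm]
    simp

lemma ip_ket_right (ψ : StateVec) (x : ℕ) : ip ψ (ket x) = star (ψ x) := by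
  induction ψ using Finsupp.induction_linear with
  | zero => simp [ip]
  | add ψ ψ' h h' => rw [ip_add_left, h, h', Finsupp.add_apply, star_add]
  | single y a =>
    rw [ip_single_single, Finsupp.single_apply]
    split_ifs <;> simp

lemma ip_ket_left (ψ : StateVec) (x : ℕ) : ip (ket x) ψ = ψ x := by
  induction ψ using Finsupp.induction_linear with
  | zero => simp [ip]
  | add ψ ψ' h h' => rw [ip_add_right, h, h', Finsupp.add_apply]
  | single y a =>
    rw [ip_single_single, Finsupp.single_apply]
    simp only [eq_comm (a := x)]
    split_ifs <;> simp

lemma ip_sum_right {ι : Type*} (s : Finset ι) (ψ : StateVec) (f : ι → StateVec) :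
    ip ψ (∑ i ∈ s, f i) = ∑ i ∈ s, ip ψ (f i) := by
  classical
  induction s using Finset.induction_on with
  | empty => simp [ip]
  | insert i s hi ih => rw [Finset.sum_insert hi, Finset.sum_insert hi, ip_add_right, ih]

lemma vec_apply {L b : ℕ} (φ : ℕ × ℕ → ℂ) {u : ℕ × ℕ} (hu : u ∈ pairs L b) :
    vec L b φ (pairLab L b u) = φ u := by
  rw [vec, Finsupp.finsetSum_apply, Finset.sum_eq_single u]
  · simp
  · intro u' hu' hne
    rw [Finsupp.smul_apply, Finsupp.single_eq_of_ne fun h => hne (pairLab_inj hu' hu h.symm)]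
    simp
  · exact fun h => absurd hu h

lemma star_rt_pow (n : ℕ) : star (rt ^ n) = rt ^ n := by
  have : star rt = rt := by
    unfold rt
    simp
  rw [star_pow, this]

/-- The reflection about the uniform superposition. -/
lemma diffusion_vec (L b : ℕ) (φ : ℕ × ℕ → ℂ) :
    applyL O (layerL L b) (applyL O (zeroL L b) (applyL O (layerL L b) (vec L b φ)))
      = vec L b fun u => φ u - 2 * (1 / 2) ^ (L + b + 6) * ∑ u' ∈ pairs L b, φ u' := by
  -- As the layer is an isometric involution, the amplitude at `(0, 0)` after it is the inner
  -- product with the image of that basis state, the uniform superposition.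
  have h1 : applyL O (layerL L b) (vec L b φ) (pairLab L b (0, 0))
      = rt ^ (L + b + 6) * ∑ u ∈ pairs L b, φ u := by
    rw [← ip_ket_left, ← ip_applyL (layerL L b), layerL_twice, layerL_zero]
    conv_lhs => rw [vec, vec, ip_sum_right]
    rw [Finset.mul_sum]
    refine Finset.sum_congr rfl fun u hu => ?_
    rw [ip_smul_right, ip_ket_right]
    have := vec_apply (L := L) (b := b) (fun _ => rt ^ (L + b + 6)) hu
    rw [vec] at this
    rw [this, star_rt_pow, mul_comm]
  rw [zeroL_apply (layerL_mem_pairSpan (vec_mem_pairSpan L b φ)), map_sub, map_smul, layerL_twice,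
    layerL_zero, h1]
  unfold vec
  rw [Finset.smul_sum, ← Finset.sum_sub_distrib]
  refine Finset.sum_congr rfl fun u _ => ?_
  rw [smul_smul, ← sub_smul]
  congr 2
  rw [← rt_mul_rt, mul_pow]
  ring

/-- The circuit that changes the sign if the flag would be set. -/
def signL (L b : ℕ) : List Gate :=
  uncomputeL L b ++ (.crot 1 (flagBit L b) (flagBit L b) :: computeL L b)

/-- Compute the flag, apply a `Z` gate to it, and uncompute: only the sign remains. -/
lemma signL_vec {b : ℕ} (hO : ∀ i, O.val i < 2 ^ b) (φ : ℕ × ℕ → ℂ) :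
    applyL O (signL O.idx b) (vec O.idx b φ)
      = vec O.idx b fun u => (if good b (O.val u.1) u.2 then -1 else 1) * φ u := by
  unfold vec
  rw [map_sum]
  refine Finset.sum_congr rfl fun u hu => ?_
  obtain ⟨hj, hy⟩ := mem_pairs.1 hu
  rw [map_smul, signL, applyL_append, applyL_cons, computeL_ket, crot_one_ket, map_smul,
    uncomputeL_ket, pairLab, computeF_flag hO hj hy, smul_smul, mul_comm]
  simp

/-- One round of amplitude amplification. -/
def groverL (L b : ℕ) : List Gate := layerL L b ++ (zeroL L b ++ (layerL L b ++ signL L b))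

/-- The state preparation and `r` rounds of amplitude amplification. -/
def iterL (L b : ℕ) : ℕ → List Gate
  | 0 => layerL L b ++ notL (width L b)
  | r + 1 => groverL L b ++ iterL L b r

/-- The whole circuit. -/
def circuitL (L b r : ℕ) : List Gate := computeL L b ++ iterL L b r

/-! ### Amplitude amplification -/

/-- The state with amplitude `x` at the good pairs and `y` at the others. -/
noncomputable def amp (O : Oracle) (b : ℕ) (x y : ℝ) (u : ℕ × ℕ) : ℂ :=
  if good b (O.val u.1) u.2 then (x : ℂ) else (y : ℂ)

lemma card_pairs (L b : ℕ) : (pairs L b).card = 2 ^ (L + b + 6) := by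
  simp [pairs, ← pow_add, add_assoc]

lemma card_good_pairs {b : ℕ} (hO : ∀ i, O.val i < 2 ^ b) :
    ((pairs O.idx b).filter fun u => good b (O.val u.1) u.2 = true).card
      = ∑ j ∈ Finset.range (2 ^ O.idx), O.val j := by
  rw [pairs, Finset.card_filter, Finset.sum_product]
  refine Finset.sum_congr rfl fun j _ => ?_
  rw [← Finset.card_filter]
  exact card_good (hO j) 6

lemma sum_pairs_ite {M : Type*} [AddCommMonoid M] {b : ℕ} (hO : ∀ i, O.val i < 2 ^ b) {S : ℕ}
    (hS : ∑ j ∈ Finset.range (2 ^ O.idx), O.val j = S) (x y : M) :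
    ∑ u ∈ pairs O.idx b, (if good b (O.val u.1) u.2 then x else y)
      = S • x + (2 ^ (O.idx + b + 6) - S) • y := by
  rw [Finset.sum_ite, Finset.sum_const, Finset.sum_const, card_good_pairs hO, hS,
    Finset.filter_not, Finset.card_sdiff_of_subset (Finset.filter_subset _ _), card_pairs,
    card_good_pairs hO, hS]

lemma sum_val_le {b : ℕ} (hO : ∀ i, O.val i < 2 ^ b) :
    ∑ j ∈ Finset.range (2 ^ O.idx), O.val j ≤ 2 ^ (O.idx + b + 6) := by
  rw [← card_good_pairs hO, ← card_pairs]
  exact Finset.card_filter_le _ _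

/-- Grover's rotation: with `sin² θ` the fraction of good pairs, each round advances the angle by
`2θ`. The implemented reflection about the uniform state has the opposite of the usual sign, hence
the factor `(-1)^r`. Amplitudes are taken relative to the uniform one, which leads to the quotients
by `sin θ` and `cos θ`. -/
lemma iterL_ket {b : ℕ} (hO : ∀ i, O.val i < 2 ^ b) {θ : ℝ}
    (hθ : Real.sin θ ^ 2 * 2 ^ (O.idx + b + 6)
      = ((∑ j ∈ Finset.range (2 ^ O.idx), O.val j : ℕ) : ℝ))
    (hs : Real.sin θ ≠ 0) (hc : Real.cos θ ≠ 0) (r : ℕ) :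
    applyL O (iterL O.idx b r) (ket 0) = rt ^ (O.idx + b + 6) • vec O.idx b
      (amp O b ((-1) ^ r * (Real.sin ((2 * r + 1) * θ) / Real.sin θ))
        ((-1) ^ r * (Real.cos ((2 * r + 1) * θ) / Real.cos θ))) := by
  set L := O.idx with hL
  set S := ∑ j ∈ Finset.range (2 ^ L), O.val j with hS
  have hcos : Real.cos θ ^ 2 = 1 - Real.sin θ ^ 2 := by rw [← Real.sin_sq_add_cos_sq θ]; ring
  induction r with
  | zero =>
    -- The initial negation sets the qubit that represents the empty prefix in the chain.
    have h0 : (0 : ℕ) ^^^ 2 ^ width L b = pairLab L b (0, 0) := by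
      rw [Nat.zero_xor, pairLab, lab, width, show L + 2 * b + 6 = L + (b + (b + 6)) by ring,
        pow_add 2 L, pow_add 2 b]
      simp
    rw [iterL, applyL_append, notL_ket, h0, layerL_zero]
    have h1 : ∀ u, amp O b ((-1) ^ 0 * (Real.sin ((2 * (0 : ℕ) + 1) * θ) / Real.sin θ))
        ((-1) ^ 0 * (Real.cos ((2 * (0 : ℕ) + 1) * θ) / Real.cos θ)) u = 1 := by
      intro u
      simp [amp, div_self hs, div_self hc]
    simp only [vec, h1, Finset.smul_sum, one_smul]
  | succ r ih =>
    rw [iterL, applyL_append, ih, map_smul, groverL, applyL_append, applyL_append, applyL_append,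
      hL, signL_vec hO, ← hL, diffusion_vec]
    congr 2
    funext u
    have hS' : S ≤ 2 ^ (L + b + 6) := sum_val_le hO
    have hφ : ∀ u, (if good b (O.val u.1) u.2 = true then (-1 : ℂ) else 1) *
        amp O b ((-1) ^ r * (Real.sin ((2 * r + 1) * θ) / Real.sin θ))
          ((-1) ^ r * (Real.cos ((2 * r + 1) * θ) / Real.cos θ)) u
        = if good b (O.val u.1) u.2 = true then
          ((-((-1) ^ r * (Real.sin ((2 * r + 1) * θ) / Real.sin θ)) : ℝ) : ℂ)
          else (((-1) ^ r * (Real.cos ((2 * r + 1) * θ) / Real.cos θ) : ℝ) : ℂ) := by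
      intro u
      unfold amp
      split_ifs
      · push_cast; ring
      · push_cast; ring
    simp only [hφ]
    rw [sum_pairs_ite hO hS.symm, nsmul_eq_mul, nsmul_eq_mul, Nat.cast_sub hS']
    have h2 : ((2 ^ (L + b + 6) : ℕ) : ℂ) = ((2 ^ (L + b + 6) : ℝ) : ℂ) := by push_cast; rfl
    have h3 : ((S : ℕ) : ℂ) = ((Real.sin θ ^ 2 * 2 ^ (L + b + 6) : ℝ) : ℂ) := by
      rw [hθ]; push_cast; rfl
    have h4 : ((1 / 2 : ℂ)) ^ (L + b + 6) = (((1 / 2 : ℝ) ^ (L + b + 6) : ℝ) : ℂ) := by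
      push_cast; rfl
    have h5 : ((1 / 2 : ℝ)) ^ (L + b + 6) * 2 ^ (L + b + 6) = 1 := by
      rw [← mul_pow]; norm_num
    rw [h2, h3, h4]
    have e1 : (2 * ((r + 1 : ℕ) : ℝ) + 1) * θ = (2 * r + 1) * θ + 2 * θ := by push_cast; ring
    -- Twice the mean of the amplitudes after the sign change, which by the addition theorem is a
    -- multiple of `cos((2r+1)θ + θ)`.
    have hmu : 2 * (1 / 2 : ℝ) ^ (L + b + 6) *
        (Real.sin θ ^ 2 * 2 ^ (L + b + 6) *
            (-((-1) ^ r * (Real.sin ((2 * r + 1) * θ) / Real.sin θ))) +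
          (2 ^ (L + b + 6) - Real.sin θ ^ 2 * 2 ^ (L + b + 6)) *
            ((-1) ^ r * (Real.cos ((2 * r + 1) * θ) / Real.cos θ)))
        = 2 * (-1) ^ r * (Real.cos ((2 * r + 1) * θ) * Real.cos θ
            - Real.sin ((2 * r + 1) * θ) * Real.sin θ) := by
      have : ∀ X Y : ℝ, 2 * (1 / 2 : ℝ) ^ (L + b + 6) *
          (Real.sin θ ^ 2 * 2 ^ (L + b + 6) * X +
            (2 ^ (L + b + 6) - Real.sin θ ^ 2 * 2 ^ (L + b + 6)) * Y)
          = 2 * (Real.sin θ ^ 2 * X + Real.cos θ ^ 2 * Y) := by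
        intro X Y
        rw [hcos]
        linear_combination (2 * (Real.sin θ ^ 2 * X + (1 - Real.sin θ ^ 2) * Y)) * h5
      rw [this]
      field_simp
      ring
    rw [amp]
    split_ifs
    · have : (-1) ^ (r + 1) * (Real.sin ((2 * ((r + 1 : ℕ) : ℝ) + 1) * θ) / Real.sin θ)
          = -((-1) ^ r * (Real.sin ((2 * r + 1) * θ) / Real.sin θ))
            - 2 * (-1) ^ r * (Real.cos ((2 * r + 1) * θ) * Real.cos θ
            - Real.sin ((2 * r + 1) * θ) * Real.sin θ) := by
        rw [e1, Real.sin_add, Real.cos_two_mul, Real.sin_two_mul, hcos]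
        field_simp
        ring
      rw [this, ← hmu]
      push_cast
      ring
    · have : (-1) ^ (r + 1) * (Real.cos ((2 * ((r + 1 : ℕ) : ℝ) + 1) * θ) / Real.cos θ)
          = ((-1) ^ r * (Real.cos ((2 * r + 1) * θ) / Real.cos θ))
            - 2 * (-1) ^ r * (Real.cos ((2 * r + 1) * θ) * Real.cos θ
            - Real.sin ((2 * r + 1) * θ) * Real.sin θ) := by
        rw [e1, Real.cos_add, Real.cos_two_mul, Real.sin_two_mul]
        field_simp
        ring
      rw [this, ← hmu]
      push_cast
      ring

lemma norm_rt_pow_sq (n : ℕ) : ‖rt ^ n‖ ^ 2 = (1 / 2) ^ n := by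
  have h : ‖rt‖ ^ 2 = 1 / 2 := by
    rw [← norm_pow, pow_two, rt_mul_rt]
    norm_num
  rw [norm_pow, ← pow_mul, mul_comm n, pow_mul, h]

/-- The measurement of the flag after amplitude amplification. -/
theorem tsum_measure_circuitL {b : ℕ} (hO : ∀ i, O.val i < 2 ^ b) {θ : ℝ}
    (hθ : Real.sin θ ^ 2 * 2 ^ (O.idx + b + 6)
      = ((∑ j ∈ Finset.range (2 ^ O.idx), O.val j : ℕ) : ℝ))
    (hs : Real.sin θ ≠ 0) (hc : Real.cos θ ≠ 0) (r : ℕ) {A B : ℝ≥0∞} {g : ℕ → ℝ≥0∞}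
    (hA : ∀ x, x.testBit (flagBit O.idx b) = true → g x ≤ A)
    (hB : ∀ x, x.testBit (flagBit O.idx b) = false → g x ≤ B) :
    ∑' x, measureCircuit O (circuitL O.idx b r) x * g x
      ≤ ENNReal.ofReal (Real.sin ((2 * r + 1) * θ) ^ 2) * A
        + ENNReal.ofReal (1 - Real.sin ((2 * r + 1) * θ) ^ 2) * B := by
  classical
  set L := O.idx with hL
  set S := ∑ j ∈ Finset.range (2 ^ L), O.val j with hS
  set x₁ : ℝ := (-1) ^ r * (Real.sin ((2 * r + 1) * θ) / Real.sin θ) with hx₁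
  set y₁ : ℝ := (-1) ^ r * (Real.cos ((2 * r + 1) * θ) / Real.cos θ) with hy₁
  have hS' : S ≤ 2 ^ (L + b + 6) := sum_val_le hO
  have hcos : Real.cos θ ^ 2 = 1 - Real.sin θ ^ 2 := by rw [← Real.sin_sq_add_cos_sq θ]; ring
  have hfin : finalState O (circuitL L b r) = ∑ u ∈ pairs L b,
      (rt ^ (L + b + 6) * amp O b x₁ y₁ u) • ket (computeF O b (pairLab L b u)) := by
    have h0 : finalState O (iterL L b r) = applyL O (iterL L b r) (ket 0) := by
      have := finalState_append (O := O) (iterL L b r) []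
      rwa [List.append_nil] at this
    rw [circuitL, finalState_append, h0, iterL_ket hO hθ hs hc, vec, Finset.smul_sum, map_sum]
    refine Finset.sum_congr rfl fun u _ => ?_
    rw [smul_smul, map_smul, computeL_ket]
  -- Each pair has its own measurement outcome, so the probability of the flag is a sum over pairs.
  have hinj : Set.InjOn (fun u => computeF O b (pairLab L b u)) (pairs L b) :=
    fun u hu u' hu' h => pairLab_inj hu hu' (computeF_injective b h)
  have hval : ∀ u ∈ pairs L b, finalState O (circuitL L b r) (computeF O b (pairLab L b u))
      = rt ^ (L + b + 6) * amp O b x₁ y₁ u := by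
    intro u hu
    rw [hfin, Finsupp.finsetSum_apply, Finset.sum_eq_single u]
    · simp
    · intro u' hu' hne
      rw [Finsupp.smul_apply, Finsupp.single_eq_of_ne fun h => hne (hinj hu' hu h.symm)]
      simp
    · exact fun h => absurd hu h
  have hzero : ∀ x ∉ (pairs L b).image (fun u => computeF O b (pairLab L b u)),
      finalState O (circuitL L b r) x = 0 := by
    intro x hx
    rw [hfin, Finsupp.finsetSum_apply]
    refine Finset.sum_eq_zero fun u hu => ?_
    rw [Finsupp.smul_apply, Finsupp.single_eq_of_ne, smul_zero]
    rintro rfl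
    exact hx (Finset.mem_image_of_mem _ hu)
  rw [tsum_eq_sum (s := (pairs L b).image fun u => computeF O b (pairLab L b u)),
    Finset.sum_image hinj]
  · have hterm : ∀ u ∈ pairs L b,
        measureCircuit O (circuitL L b r) (computeF O b (pairLab L b u)) *
          g (computeF O b (pairLab L b u)) ≤ if good b (O.val u.1) u.2 = true then
            ENNReal.ofReal ((1 / 2) ^ (L + b + 6) * x₁ ^ 2) * A
          else ENNReal.ofReal ((1 / 2) ^ (L + b + 6) * y₁ ^ 2) * B := by
      intro u hu
      obtain ⟨hj, hy⟩ := mem_pairs.1 hu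
      have hflag := computeF_flag hO hj hy
      rw [measureCircuit, PMF.ofFinset_apply, hval u hu, norm_mul, mul_pow, norm_rt_pow_sq, amp]
      split_ifs with h
      · rw [Complex.norm_real, Real.norm_eq_abs, sq_abs]
        exact mul_le_mul_right (hA _ (by rw [← hL] at hflag; exact hflag.trans h)) _
      · rw [Complex.norm_real, Real.norm_eq_abs, sq_abs]
        exact mul_le_mul_right (hB _ (by
          rw [← hL] at hflag; exact hflag.trans (Bool.not_eq_true _ ▸ h))) _
    refine (Finset.sum_le_sum hterm).trans ?_
    rw [sum_pairs_ite hO hS.symm, nsmul_eq_mul, nsmul_eq_mul, ← mul_assoc, ← mul_assoc,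
      ← ENNReal.ofReal_natCast, ← ENNReal.ofReal_natCast,
      ← ENNReal.ofReal_mul (by positivity), ← ENNReal.ofReal_mul (by positivity), Nat.cast_sub hS']
    have h5 : ((1 / 2 : ℝ)) ^ (L + b + 6) * 2 ^ (L + b + 6) = 1 := by
      rw [← mul_pow]; norm_num
    have hsign : ((-1 : ℝ) ^ r) ^ 2 = 1 := by rw [← pow_mul, mul_comm, pow_mul]; norm_num
    have hcancel : ∀ s c P X : ℝ, s ≠ 0 → c * P = 1 → s * P * (c * (1 * (X / s))) = X := by
      intro s c P X h0 h1
      field_simp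
      linear_combination X * h1
    have e1 : (S : ℝ) * ((1 / 2) ^ (L + b + 6) * x₁ ^ 2) = Real.sin ((2 * r + 1) * θ) ^ 2 := by
      rw [← hθ, hx₁, mul_pow, hsign, div_pow (Real.sin ((2 * r + 1) * θ))]
      exact hcancel _ _ _ _ (pow_ne_zero 2 hs) h5
    have e2 : (((2 ^ (L + b + 6) : ℕ) : ℝ) - S) * ((1 / 2) ^ (L + b + 6) * y₁ ^ 2)
        = 1 - Real.sin ((2 * r + 1) * θ) ^ 2 := by
      have h6 : (((2 ^ (L + b + 6) : ℕ) : ℝ) - S) = Real.cos θ ^ 2 * 2 ^ (L + b + 6) := by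
        rw [← hθ, hcos]; push_cast; ring
      rw [h6, hy₁, mul_pow, hsign, div_pow (Real.cos ((2 * r + 1) * θ)), Real.sin_sq, sub_sub_cancel]
      exact hcancel _ _ _ _ (pow_ne_zero 2 hc) h5
    rw [e1, e2]
  · intro x hx
    rw [measureCircuit, PMF.ofFinset_apply, hzero x hx]
    simp

/-! ### Identification of an angle -/

/-- Jordan's inequality `sin y ≥ 2y/π` on `[1/4, π/2]`, and the symmetry about `π/2` beyond; `27/10`
leaves a distance of more than `1/4` to `π`. -/
lemma sin_ge_of_mem {x : ℝ} (h1 : 1 / 4 ≤ x) (h2 : x ≤ 27 / 10) : 3 / 20 ≤ Real.sin x := by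
  have hpi := Real.pi_gt_d2
  have hpi' := Real.pi_lt_d2
  have key : ∀ y : ℝ, 1 / 4 ≤ y → y ≤ Real.pi / 2 → 3 / 20 ≤ Real.sin y := by
    intro y hy1 hy2
    refine le_trans ?_ (Real.mul_le_sin (by linarith) hy2)
    rw [div_mul_eq_mul_div, le_div_iff₀ Real.pi_pos]
    linarith
  rcases le_total x (Real.pi / 2) with h | h
  · exact key x h1 h
  · rw [← Real.sin_pi_sub]
    exact key _ (by linarith) (by linarith)

lemma sin_sq_sub_sin_sq (x y : ℝ) :
    Real.sin x ^ 2 - Real.sin y ^ 2 = Real.sin (x + y) * Real.sin (x - y) := by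
  rw [Real.sin_add, Real.sin_sub]
  have hx := Real.sin_sq_add_cos_sq x
  have hy := Real.sin_sq_add_cos_sq y
  linear_combination (-Real.sin x ^ 2) * hy + Real.sin y ^ 2 * hx

lemma abs_sin_sq_sub_le (x y : ℝ) : |Real.sin x ^ 2 - Real.sin y ^ 2| ≤ |x - y| := by
  rw [sin_sq_sub_sin_sq, abs_mul]
  calc |Real.sin (x + y)| * |Real.sin (x - y)| ≤ 1 * |x - y| :=
        mul_le_mul (Real.abs_sin_le_one _) Real.abs_sin_le_abs (abs_nonneg _) zero_le_one
    _ = _ := one_mul _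

/-- `sin x - sin y = 2 sin((x-y)/2) cos((x+y)/2)`, where the cosine is at least `7/8` and the sine
at least `63/64` of its argument. -/
lemma abs_sub_le_of_sin {x y : ℝ} (hx : 0 ≤ x) (hx' : x ≤ 1 / 2) (hy : 0 ≤ y) (hy' : y ≤ 1 / 2) :
    |x - y| ≤ 6 / 5 * |Real.sin x - Real.sin y| := by
  wlog h : y ≤ x generalizing x y
  · rw [abs_sub_comm x, abs_sub_comm (Real.sin x)]
    exact this hy hy' hx hx' (by linarith)
  rw [Real.sin_sub_sin, abs_of_nonneg (by linarith)]
  rcases h.eq_or_lt with rfl | h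
  · simp
  have h1 : 7 / 8 ≤ Real.cos ((x + y) / 2) := by
    have := Real.one_sub_sq_div_two_le_cos (x := (x + y) / 2)
    nlinarith
  have h2 : 63 / 64 * ((x - y) / 2) ≤ Real.sin ((x - y) / 2) := by
    have := Real.sin_gt_sub_cube (x := (x - y) / 2) (by linarith)
    have hd : ((x - y) / 2) ^ 2 ≤ 1 / 16 := by nlinarith
    have : ((x - y) / 2) ^ 3 = (x - y) / 2 * ((x - y) / 2) ^ 2 := by ring
    nlinarith
  have h3 : 63 / 64 * ((x - y) / 2) * (7 / 8) ≤ Real.sin ((x - y) / 2) * Real.cos ((x + y) / 2) :=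
    mul_le_mul h2 h1 (by norm_num) (le_trans (by linarith) h2)
  refine le_trans ?_ (mul_le_mul_of_nonneg_left (le_abs_self _) (by norm_num))
  nlinarith

lemma arcsin_le_half {t : ℝ} (h : t ≤ 3 / 8) : Real.arcsin t ≤ 1 / 2 := by
  have hpi := Real.pi_gt_three
  rw [Real.arcsin_le_iff_le_sin' ⟨by linarith, by linarith⟩]
  have := Real.sin_gt_sub_cube (x := 1 / 2) (by norm_num)
  linarith

/-- The probability of the flag after `r` rounds of amplitude amplification, if it is `t ^ 2` before. -/
noncomputable def prob (r : ℕ) (t : ℝ) : ℝ := Real.sin ((2 * r + 1) * Real.arcsin t) ^ 2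

lemma prob_nonneg (r : ℕ) (t : ℝ) : 0 ≤ prob r t := sq_nonneg _

lemma prob_le_one (r : ℕ) (t : ℝ) : prob r t ≤ 1 := Real.sin_sq_le_one _

/-- The numbers of rounds that are used in the stage `k`. -/
def rounds (k i : ℕ) : ℕ := 2 ^ (k - 1) + 2 ^ i / 2

/-- The multipliers `2r+1` of a stage are all of order `2^k`, and they exceed the first one, `2^k +
1`, by powers of two. These differences make the tests conclusive. -/
lemma two_mul_rounds_zero {k : ℕ} (hk : 1 ≤ k) : 2 * (rounds k 0 : ℝ) + 1 = 2 ^ k + 1 := by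
  obtain ⟨k, rfl⟩ : ∃ l, k = l + 1 := ⟨k - 1, by omega⟩
  simp [rounds, pow_succ]
  ring

lemma two_mul_rounds_succ {k : ℕ} (hk : 1 ≤ k) (i : ℕ) :
    2 * (rounds k (i + 1) : ℝ) + 1 = 2 ^ k + 1 + 2 ^ (i + 1) := by
  obtain ⟨k, rfl⟩ : ∃ l, k = l + 1 := ⟨k - 1, by omega⟩
  simp [rounds, pow_succ]
  ring

lemma two_mul_rounds_le {k i : ℕ} (hk : 2 ≤ k) (hi : i ≤ k) :
    2 * (rounds k i : ℝ) + 1 ≤ 9 / 4 * 2 ^ k := by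
  have h1 : (4 : ℝ) ≤ 2 ^ k := by
    calc (4 : ℝ) = 2 ^ 2 := by norm_num
      _ ≤ 2 ^ k := pow_le_pow_right₀ (by norm_num) hk
  cases i with
  | zero => rw [two_mul_rounds_zero (by omega)]; linarith
  | succ i =>
    rw [two_mul_rounds_succ (by omega)]
    have : (2 : ℝ) ^ (i + 1) ≤ 2 ^ k := pow_le_pow_right₀ (by norm_num) hi
    linarith

lemma two_pow_le_rounds {k i : ℕ} (hk : 1 ≤ k) : (2 : ℝ) ^ k ≤ 2 * (rounds k i : ℝ) + 1 := by
  cases i with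
  | zero => rw [two_mul_rounds_zero hk]; linarith
  | succ i =>
    rw [two_mul_rounds_succ hk]
    have : (0 : ℝ) < 2 ^ (i + 1) := by positivity
    linarith

/-- If `t` and `t'` are known to be close, and cannot be distinguished by the probabilities of a
stage, then they are closer. -/
lemma close_of_prob {k : ℕ} (hk : 2 ≤ k) {t t' : ℝ} (ht0 : 0 ≤ t) (ht : t ≤ 3 / 8)
    (ht0' : 0 ≤ t') (ht' : t' ≤ 3 / 8) (hclose : |t - t'| * 2 ^ k ≤ 1)
    (h : ∀ i ≤ k, |prob (rounds k i) t - prob (rounds k i) t'| ≤ 3 / 512) :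
    |t - t'| * 2 ^ k ≤ 1 / 4 := by
  by_contra! hfar
  set x := Real.arcsin t with hx
  set y := Real.arcsin t' with hy
  have hsx : Real.sin x = t := Real.sin_arcsin (by linarith) (by linarith)
  have hsy : Real.sin y = t' := Real.sin_arcsin (by linarith) (by linarith)
  have hx0 : 0 ≤ x := Real.arcsin_nonneg.2 ht0
  have hy0 : 0 ≤ y := Real.arcsin_nonneg.2 ht0'
  have hx1 : x ≤ 1 / 2 := arcsin_le_half ht
  have hy1 : y ≤ 1 / 2 := arcsin_le_half ht'
  have hk0 : (0 : ℝ) < 2 ^ k := by positivity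
  have hd1 : |x - y| ≤ 6 / 5 * |t - t'| := by
    rw [← hsx, ← hsy]; exact abs_sub_le_of_sin hx0 hx1 hy0 hy1
  have hd2 : |t - t'| ≤ |x - y| := by
    rw [← hsx, ← hsy]
    simpa [Real.dist_eq] using Real.abs_sin_sub_sin_le x y
  -- The difference of probabilities is `sin(m(x+y)) sin(m(x-y))`. Here `m|x-y|` lies between `1/4`
  -- and `9/4 · 6/5 = 27/10`, so that the second factor is at least `3/20` in absolute value, and
  -- `(3/512) / (3/20) = 5/128`.
  have hs : ∀ i ≤ k, |Real.sin ((2 * (rounds k i : ℝ) + 1) * (x + y))| ≤ 5 / 128 := by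
    intro i hi
    have h1 := h i hi
    unfold prob at h1
    rw [← hx, ← hy, sin_sq_sub_sin_sq, ← mul_add, ← mul_sub, abs_mul] at h1
    have hm1 := two_mul_rounds_le hk hi
    have hm2 := two_pow_le_rounds (i := i) (by omega : 1 ≤ k)
    set m := 2 * (rounds k i : ℝ) + 1
    have h2 : |Real.sin (m * (x - y))| = |Real.sin (m * |x - y|)| := by
      rcases abs_cases (x - y) with ⟨he, _⟩ | ⟨he, _⟩
      · rw [he]
      · rw [he, mul_neg, Real.sin_neg, abs_neg]
    have h3 : 3 / 20 ≤ |Real.sin (m * (x - y))| := by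
      rw [h2]
      refine le_trans (sin_ge_of_mem ?_ ?_) (le_abs_self _)
      · nlinarith [abs_nonneg (t - t')]
      · nlinarith [abs_nonneg (t - t'), abs_nonneg (x - y)]
    nlinarith [abs_nonneg (Real.sin (m * (x + y)))]
  -- By the addition theorem, the sine of a difference of two multiples of `x+y` is small if both
  -- sines are.
  have hs2 : ∀ i, i + 1 ≤ k → |Real.sin (2 ^ (i + 1) * (x + y))| ≤ 5 / 64 := by
    intro i hi
    have h1 := hs (i + 1) hi
    have h2 := hs 0 (by omega)
    rw [two_mul_rounds_succ (by omega)] at h1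
    rw [two_mul_rounds_zero (by omega)] at h2
    have e : (2 : ℝ) ^ (i + 1) * (x + y)
        = (2 ^ k + 1 + 2 ^ (i + 1)) * (x + y) - (2 ^ k + 1) * (x + y) := by ring
    rw [e, Real.sin_sub]
    refine (abs_sub _ _).trans ?_
    rw [abs_mul, abs_mul]
    have c1 := Real.abs_cos_le_one ((2 ^ k + 1) * (x + y))
    have c2 := Real.abs_cos_le_one ((2 ^ k + 1 + 2 ^ (i + 1)) * (x + y))
    nlinarith [abs_nonneg (Real.sin ((2 ^ k + 1) * (x + y))),
      abs_nonneg (Real.sin ((2 ^ k + 1 + 2 ^ (i + 1)) * (x + y)))]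
  have hxy : |x - y| ≤ x + y := by
    rw [abs_le]; constructor <;> linarith
  -- Since `x+y ≥ |x-y| > 2^-k / 4`, the exponent `k` is large enough.
  have hex : ∃ i, i + 1 ≤ k ∧ 1 / 4 ≤ 2 ^ (i + 1) * (x + y) := by
    refine ⟨k - 1, by omega, ?_⟩
    rw [Nat.sub_add_cancel (by omega)]
    nlinarith
  classical
  obtain ⟨h1, h2⟩ := Nat.find_spec hex
  set i := Nat.find hex with hi
  -- For the least exponent, either the previous multiple is below `1/4`, or the exponent is `1` and
  -- `x+y ≤ 1`. The sine is then at least `3/20`, more than the `5/64` of `hs2`.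
  have h3 : 2 ^ (i + 1) * (x + y) ≤ 2 := by
    rcases Nat.eq_zero_or_pos i with h0 | h0
    · rw [h0]; norm_num; linarith
    · have := Nat.find_min hex (m := i - 1) (by omega)
      rw [Nat.sub_add_cancel h0] at this
      have h4 : 2 ^ i * (x + y) < 1 / 4 := by
        by_contra! h5
        exact this ⟨by omega, h5⟩
      rw [pow_succ]
      linarith
  have h4 := sin_ge_of_mem h2 (by linarith)
  have h5 := (le_abs_self _).trans (hs2 i h1)
  linarith

/-- The probability has Lipschitz constant at most `9/4 · 2^k · 6/5` in `t`, and `2.7/2048 < 1/512`: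
this explains the mesh `2^-(k+11)`. -/
lemma prob_close {k i : ℕ} (hk : 2 ≤ k) (hi : i ≤ k) {t t' : ℝ} (ht0 : 0 ≤ t) (ht : t ≤ 3 / 8)
    (ht0' : 0 ≤ t') (ht' : t' ≤ 3 / 8) (hclose : |t - t'| * 2 ^ (k + 11) ≤ 1) :
    |prob (rounds k i) t - prob (rounds k i) t'| ≤ 1 / 512 := by
  refine (abs_sin_sq_sub_le _ _).trans ?_
  rw [← mul_sub, abs_mul]
  have h1 := two_mul_rounds_le hk hi
  have h0 : 0 ≤ 2 * (rounds k i : ℝ) + 1 := by positivity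
  rw [abs_of_nonneg h0]
  have h2 := abs_sub_le_of_sin (Real.arcsin_nonneg.2 ht0) (arcsin_le_half ht)
    (Real.arcsin_nonneg.2 ht0') (arcsin_le_half ht')
  rw [Real.sin_arcsin (by linarith) (by linarith), Real.sin_arcsin (by linarith) (by linarith)]
    at h2
  rw [pow_add] at hclose
  have hk0 : (0 : ℝ) < 2 ^ k := by positivity
  calc (2 * (rounds k i : ℝ) + 1) * |Real.arcsin t - Real.arcsin t'|
      ≤ (9 / 4 * 2 ^ k) * (6 / 5 * |t - t'|) := mul_le_mul h1 h2 (abs_nonneg _) (by positivity)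
    _ ≤ 1 / 512 := by norm_num at hclose ⊢; nlinarith

/-! ### Candidates -/

lemma abs_sub_div_mul {t : ℝ} {c q : ℕ} : |t - c / 2 ^ q| * 2 ^ q = |t * 2 ^ q - c| := by
  have h : (0 : ℝ) < 2 ^ q := by positivity
  rw [← abs_of_pos h, ← abs_mul, sub_mul, abs_of_pos h, div_mul_cancel₀ _ h.ne']

/-- All candidates of a stage are close to `t`. -/
lemma candidate_close {t : ℝ} {X k c : ℕ} (ht0 : 0 ≤ t)
    (hX : |t * 2 ^ (k + 10) - X| ≤ 512) (hc1 : 2 * X - 1024 ≤ c)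
    (hc2 : c ≤ 2 * X - 1024 + 2048) : |t * 2 ^ (k + 11) - c| ≤ 2048 := by
  have e : t * 2 ^ (k + 11) = 2 * (t * 2 ^ (k + 10)) := by ring
  rw [abs_le] at hX
  have h0 : 0 ≤ t * 2 ^ (k + 10) := by positivity
  have h1 : (2 * (X : ℝ) - 1024) ≤ ((2 * X - 1024 : ℕ) : ℝ) := by
    have : 2 * X ≤ 2 * X - 1024 + 1024 := by omega
    have : (2 * (X : ℝ)) ≤ ((2 * X - 1024 : ℕ) : ℝ) + 1024 := by exact_mod_cast this
    linarith
  have hc1' : ((2 * X - 1024 : ℕ) : ℝ) ≤ c := by exact_mod_cast hc1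
  have hc2' : (c : ℝ) ≤ ((2 * X - 1024 : ℕ) : ℝ) + 2048 := by exact_mod_cast hc2
  -- If the left end of the window is truncated to `0`, the inequality holds because `t ≥ 0`.
  have h2 : ((2 * X - 1024 : ℕ) : ℝ) ≤ t * 2 ^ (k + 11) := by
    rcases le_total (2 * X) 1024 with h | h
    · rw [Nat.sub_eq_zero_of_le h]; simpa [e] using h0
    · rw [Nat.cast_sub h, e]; push_cast; linarith
  rw [e] at h2 ⊢
  rw [abs_le]
  constructor <;> linarith

/-- Some candidate of a stage is next to `t`. -/
lemma exists_candidate {t : ℝ} {X k : ℕ} (ht0 : 0 ≤ t) (hX : |t * 2 ^ (k + 10) - X| ≤ 512) :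
    ∃ i ≤ 2048, |t * 2 ^ (k + 11) - ((2 * X - 1024 + i : ℕ) : ℝ)| ≤ 1 := by
  have e : t * 2 ^ (k + 11) = 2 * (t * 2 ^ (k + 10)) := by ring
  have h0 : 0 ≤ t * 2 ^ (k + 11) := by positivity
  rw [abs_le] at hX
  have h1 : 2 * X - 1024 ≤ ⌊t * 2 ^ (k + 11)⌋₊ := by
    rcases le_total (2 * X) 1024 with h | h
    · rw [Nat.sub_eq_zero_of_le h]; exact Nat.zero_le _
    · refine Nat.le_floor ?_
      rw [Nat.cast_sub h, e]; push_cast; linarith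
  have h2 : ⌊t * 2 ^ (k + 11)⌋₊ ≤ 2 * X + 1024 := by
    refine Nat.floor_le_of_le ?_
    rw [e]; push_cast; linarith
  refine ⟨⌊t * 2 ^ (k + 11)⌋₊ - (2 * X - 1024), by omega, ?_⟩
  rw [Nat.add_sub_cancel' h1]
  have h3 := Nat.floor_le h0
  have h4 := Nat.lt_floor_add_one (t * 2 ^ (k + 11))
  rw [abs_le]; constructor <;> linarith

/-! ### Evaluation of the probabilities -/

/-- A step of the recurrence for the probabilities at `X / 2 ^ q`, with `s = 4 ^ q`: the current
numerator, the scaled previous numerator, and the denominator. -/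
def evalStep (X q : ℕ) (v : ℕ × ℕ × ℕ) : ℕ × ℕ × ℕ :=
  (2 * ((4 ^ q - 2 * X ^ 2) * v.1) + 2 * (X ^ 2 * v.2.2) - 4 ^ q * v.2.1, 4 ^ q * v.1,
    4 ^ q * v.2.2)

/-- With `x = arcsin(X / 2^q)`, the triple after `j` steps represents `sin²((j+1)x)` and `sin²(jx)`
over the common denominator `(4^q)^(j+1)`. -/
def evalIter (X q : ℕ) : ℕ → ℕ × ℕ × ℕ
  | 0 => (X ^ 2, 0, 4 ^ q)
  | j + 1 => evalStep X q (evalIter X q j)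

/-- The three-term recurrence of Chebyshev type for `sin²(mx)`; its coefficients are polynomials in
`sin² x`, so rational starting values stay rational. -/
lemma sin_sq_recurrence (x m : ℝ) : Real.sin ((m + 1) * x) ^ 2
    = 2 * (1 - 2 * Real.sin x ^ 2) * Real.sin (m * x) ^ 2 + 2 * Real.sin x ^ 2
      - Real.sin ((m - 1) * x) ^ 2 := by
  rw [add_mul, sub_mul, one_mul, Real.sin_add, Real.sin_sub]
  have hx := Real.sin_sq_add_cos_sq x
  have hm := Real.sin_sq_add_cos_sq (m * x)
  linear_combination (2 * Real.sin (m * x) ^ 2) * hx + (2 * Real.sin x ^ 2) * hm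

/-- The hypothesis makes the coefficient `4^q - 2X²` nonnegative. The other truncated subtraction is
exact because its result is a positive multiple of a square. -/
lemma evalIter_eq {X q : ℕ} (hX : 2 * X ^ 2 ≤ 4 ^ q) (j : ℕ) :
    ((evalIter X q j).1 : ℝ)
        = (4 ^ q) ^ (j + 1) * Real.sin ((j + 1) * Real.arcsin (X / 2 ^ q)) ^ 2 ∧
      ((evalIter X q j).2.1 : ℝ)
        = (4 ^ q) ^ (j + 1) * Real.sin (j * Real.arcsin (X / 2 ^ q)) ^ 2 ∧
      (evalIter X q j).2.2 = (4 ^ q) ^ (j + 1) := by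
  have h4 : (4 : ℝ) ^ q = (2 ^ q) ^ 2 := by rw [← pow_mul, mul_comm, pow_mul]; norm_num
  have hpos : (0 : ℝ) < 2 ^ q := by positivity
  have hX' : 2 * (X : ℝ) ^ 2 ≤ 4 ^ q := by exact_mod_cast hX
  set x := Real.arcsin (X / 2 ^ q) with hx
  have h1 : (X : ℝ) / 2 ^ q ≤ 1 := by
    rw [div_le_one hpos]
    rw [h4] at hX'
    nlinarith [(Nat.cast_nonneg X : (0 : ℝ) ≤ X)]
  have h0 : 0 ≤ (X : ℝ) / 2 ^ q := by positivity
  have hsin : Real.sin x = X / 2 ^ q := Real.sin_arcsin (by linarith) h1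
  have hsq : (4 : ℝ) ^ q * Real.sin x ^ 2 = X ^ 2 := by
    rw [hsin, h4, div_pow]; field_simp
  induction j with
  | zero =>
    refine ⟨?_, by simp [evalIter], by simp [evalIter]⟩
    rw [evalIter]
    push_cast
    rw [zero_add, one_mul, pow_one, hsq]
  | succ j ih =>
    obtain ⟨i1, i2, i3⟩ := ih
    have hrec := sin_sq_recurrence x (j + 1)
    rw [show (j : ℝ) + 1 - 1 = j by ring] at hrec
    have hcast : (((4 ^ q - 2 * X ^ 2 : ℕ)) : ℝ) = 4 ^ q - 2 * X ^ 2 := by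
      rw [Nat.cast_sub hX]; push_cast; rfl
    have hmain : (2 * ((4 ^ q - 2 * (X : ℝ) ^ 2) * ((evalIter X q j).1 : ℝ))
        + 2 * ((X : ℝ) ^ 2 * ((evalIter X q j).2.2 : ℝ)) - 4 ^ q * ((evalIter X q j).2.1 : ℝ))
        = (4 ^ q) ^ (j + 1 + 1) * Real.sin ((((j + 1 : ℕ) : ℝ) + 1) * x) ^ 2 := by
      rw [i1, i2, i3]
      push_cast
      rw [hrec, ← hsq]
      ring
    refine ⟨?_, ?_, ?_⟩
    -- The difference is nonnegative because it equals the squared sine of the next step, rescaled.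
    · have hle : 4 ^ q * (evalIter X q j).2.1 ≤ 2 * ((4 ^ q - 2 * X ^ 2) * (evalIter X q j).1)
          + 2 * (X ^ 2 * (evalIter X q j).2.2) := by
        have : (0 : ℝ) ≤ (4 ^ q) ^ (j + 1 + 1) * Real.sin ((((j + 1 : ℕ) : ℝ) + 1) * x) ^ 2 := by
          positivity
        rw [← hmain] at this
        have h2 : ((4 ^ q * (evalIter X q j).2.1 : ℕ) : ℝ)
            ≤ ((2 * ((4 ^ q - 2 * X ^ 2) * (evalIter X q j).1)
              + 2 * (X ^ 2 * (evalIter X q j).2.2) : ℕ) : ℝ) := by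
          push_cast [hcast]
          linarith
        exact_mod_cast h2
      rw [evalIter, evalStep, Nat.cast_sub hle]
      push_cast [hcast]
      push_cast at hmain
      rw [hmain]
    · rw [evalIter, evalStep]
      push_cast
      rw [i1]
      ring
    · rw [evalIter, evalStep, i3]
      ring

/-- The acceptance of a candidate with the numerator `F` and the denominator `D` of the
probability after `h` of `n` samples had the flag set. -/
def Passes (n h F D : ℕ) : Prop :=
  256 * ((h * D - n * F) + (n * F - h * D)) ≤ n * D

lemma passes_iff {n h F D : ℕ} (hn : 0 < n) (hD : 0 < D) :
    Passes n h F D ↔ |(h : ℝ) / n - (F : ℝ) / D| ≤ 1 / 256 := by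
  have hn' : (0 : ℝ) < n := by exact_mod_cast hn
  have hD' : (0 : ℝ) < D := by exact_mod_cast hD
  have h1 : (((h * D - n * F) + (n * F - h * D) : ℕ) : ℝ) = |(h : ℝ) * D - n * F| := by
    rcases le_total (h * D) (n * F) with hle | hle
    · rw [Nat.sub_eq_zero_of_le hle, zero_add, Nat.cast_sub hle, abs_sub_comm, abs_of_nonneg]
      · push_cast; ring
      · have : ((h * D : ℕ) : ℝ) ≤ ((n * F : ℕ) : ℝ) := by exact_mod_cast hle
        push_cast at this; linarith
    · rw [Nat.sub_eq_zero_of_le hle, add_zero, Nat.cast_sub hle, abs_of_nonneg]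
      · push_cast; ring
      · have : ((n * F : ℕ) : ℝ) ≤ ((h * D : ℕ) : ℝ) := by exact_mod_cast hle
        push_cast at this; linarith
  have h2 : |(h : ℝ) / n - (F : ℝ) / D| = |(h : ℝ) * D - n * F| / (n * D) := by
    rw [div_sub_div _ _ hn'.ne' hD'.ne', abs_div, abs_of_pos (mul_pos hn' hD')]
  rw [h2, div_le_iff₀ (mul_pos hn' hD'), ← h1, Passes, ← Nat.cast_le (α := ℝ)]
  push_cast
  constructor <;> intro h <;> linarith

lemma evalIter_prob {X q : ℕ} (hX : 2 * X ^ 2 ≤ 4 ^ q) (r : ℕ) :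
    0 < (evalIter X q (2 * r)).2.2 ∧
      ((evalIter X q (2 * r)).1 : ℝ) / ((evalIter X q (2 * r)).2.2 : ℕ) = prob r (X / 2 ^ q) := by
  obtain ⟨h1, _, h3⟩ := evalIter_eq hX (2 * r)
  have hp : (0 : ℝ) < (4 ^ q) ^ (2 * r + 1) := by positivity
  refine ⟨by rw [h3]; positivity, ?_⟩
  rw [h1, h3, prob]
  push_cast
  rw [mul_div_cancel_left₀ _ hp.ne']

/-! ### Sampling -/

/-- The expectation of `V` at the number of successes in `n` independent trials. -/
noncomputable def binE (p q : ℝ≥0∞) : ℕ → (ℕ → ℝ≥0∞) → ℝ≥0∞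
  | 0, V => V 0
  | n + 1, V => p * binE p q n (fun h => V (h + 1)) + q * binE p q n V

lemma binE_mono {p q : ℝ≥0∞} (n : ℕ) {V W : ℕ → ℝ≥0∞} (h : ∀ i ≤ n, V i ≤ W i) :
    binE p q n V ≤ binE p q n W := by
  induction n generalizing V W with
  | zero => exact h 0 le_rfl
  | succ n ih =>
    unfold binE
    gcongr
    · exact ih fun i hi => h (i + 1) (by omega)
    · exact ih fun i hi => h i (by omega)

lemma binE_const {p q : ℝ≥0∞} (hpq : p + q = 1) (n : ℕ) (A : ℝ≥0∞) :
    binE p q n (fun _ => A) = A := by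
  induction n with
  | zero => rfl
  | succ n ih => rw [binE, ih, ← add_mul, hpq, one_mul]

lemma binE_add {p q : ℝ≥0∞} (n : ℕ) (V W : ℕ → ℝ≥0∞) :
    binE p q n (fun i => V i + W i) = binE p q n V + binE p q n W := by
  induction n generalizing V W with
  | zero => rfl
  | succ n ih => rw [binE, ih, ih, binE, binE]; ring

/-- The moment generating function of the binomial distribution; the summand `c` in the exponent
carries the induction. -/
lemma binE_exp {x : ℝ} (hx : 0 ≤ x) (hx' : x ≤ 1) (n : ℕ) (c μ : ℝ) (B : ℝ≥0∞) :
    binE (ENNReal.ofReal x) (ENNReal.ofReal (1 - x)) n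
        (fun i => ENNReal.ofReal (Real.exp (c + i * μ)) * B)
      = ENNReal.ofReal (Real.exp c * (x * Real.exp μ + (1 - x)) ^ n) * B := by
  induction n generalizing c with
  | zero => simp [binE]
  | succ n ih =>
    have h1 : ∀ i : ℕ, c + ((i + 1 : ℕ) : ℝ) * μ = (c + μ) + i * μ := by
      intro i; push_cast; ring
    have h2 : 0 ≤ x * Real.exp μ + (1 - x) := by
      have := mul_nonneg hx (Real.exp_pos μ).le
      linarith
    simp only [binE, h1]
    rw [ih, ih, ← mul_assoc, ← mul_assoc, ← ENNReal.ofReal_mul hx,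
      ← ENNReal.ofReal_mul (by linarith), ← add_mul, ← ENNReal.ofReal_add]
    · congr 2
      rw [Real.exp_add]; ring
    · positivity
    · exact mul_nonneg (by linarith) (by positivity)

/-- From `e^μ ≤ 1 + μ + μ²` for `|μ| ≤ 1`, and `1 + y ≤ e^y`. -/
lemma mgf_le {x μ : ℝ} (hx : 0 ≤ x) (hx' : x ≤ 1) (hμ : |μ| ≤ 1) :
    x * Real.exp μ + (1 - x) ≤ Real.exp (x * μ + μ ^ 2) := by
  have h1 := Real.abs_exp_sub_one_sub_id_le hμ
  have h2 : Real.exp μ ≤ 1 + μ + μ ^ 2 := by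
    have := (abs_le.1 h1).2
    linarith
  refine le_trans ?_ (Real.add_one_le_exp _)
  nlinarith [sq_nonneg μ]

/-- A Chernoff bound. -/
lemma binE_le {x ε : ℝ} (hx : 0 ≤ x) (hx' : x ≤ 1) (hε : 0 ≤ ε) (hε' : ε ≤ 1) (n : ℕ)
    {V : ℕ → ℝ≥0∞} {A B : ℝ≥0∞} (hA : ∀ i ≤ n, |(i : ℝ) - n * x| ≤ n * ε → V i ≤ A)
    (hB : ∀ i ≤ n, V i ≤ B) :
    binE (ENNReal.ofReal x) (ENNReal.ofReal (1 - x)) n V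
      ≤ A + ENNReal.ofReal (2 * Real.exp (-(ε ^ 2 / 4 * n))) * B := by
  have hpq : ENNReal.ofReal x + ENNReal.ofReal (1 - x) = 1 := by
    rw [← ENNReal.ofReal_add hx (by linarith)]; simp
  -- The constants are chosen such that outside of the window one of the exponents `±(ε/2)(i - nx) -
  -- nε²/2` is nonnegative, and the corresponding exponential dominates the indicator of the tail.
  set c₁ : ℝ := -(n * x * (ε / 2)) - n * ε * (ε / 2) with hc₁
  set c₂ : ℝ := n * x * (ε / 2) - n * ε * (ε / 2) with hc₂
  have h1 : ∀ i ≤ n, V i ≤ A + (ENNReal.ofReal (Real.exp (c₁ + i * (ε / 2))) * B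
      + ENNReal.ofReal (Real.exp (c₂ + i * (-(ε / 2)))) * B) := by
    intro i hi
    by_cases h : |(i : ℝ) - n * x| ≤ n * ε
    · exact (hA i hi h).trans le_self_add
    · refine (hB i hi).trans (le_trans ?_ le_add_self)
      rw [not_le, lt_abs] at h
      have key : ∀ y : ℝ, 0 ≤ y → B ≤ ENNReal.ofReal (Real.exp y) * B := by
        intro y hy
        have : 1 ≤ ENNReal.ofReal (Real.exp y) := by
          rw [ENNReal.one_le_ofReal]; exact Real.one_le_exp hy
        calc B = 1 * B := (one_mul B).symm
          _ ≤ _ := by gcongr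
      rcases h with h | h
      · refine (key _ ?_).trans le_self_add
        rw [hc₁]; nlinarith
      · refine (key _ ?_).trans le_add_self
        rw [hc₂]; nlinarith
  refine (binE_mono n h1).trans ?_
  rw [binE_add, binE_add, binE_const hpq, binE_exp hx hx', binE_exp hx hx', ← add_mul]
  gcongr
  rw [← ENNReal.ofReal_add]
  · refine ENNReal.ofReal_le_ofReal ?_
    -- With `μ = ±ε/2` the exponent becomes `nε²/4 - nε²/2 = -nε²/4`.
    have key : ∀ c μ : ℝ, |μ| ≤ 1 → c + n * (x * μ + μ ^ 2) = -(ε ^ 2 / 4 * n) →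
        Real.exp c * (x * Real.exp μ + (1 - x)) ^ n ≤ Real.exp (-(ε ^ 2 / 4 * n)) := by
      intro c μ hμ he
      have h0 : 0 ≤ x * Real.exp μ + (1 - x) := by
        have := mul_nonneg hx (Real.exp_pos μ).le
        linarith
      rw [← he, Real.exp_add, Real.exp_nat_mul]
      gcongr
      exact mgf_le hx hx' hμ
    have k1 := key c₁ (ε / 2) (by rw [abs_of_nonneg] <;> linarith) (by rw [hc₁]; ring)
    have k2 := key c₂ (-(ε / 2)) (by rw [abs_neg, abs_of_nonneg] <;> linarith) (by rw [hc₂]; ring)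
    linarith
  · have := mul_nonneg hx (Real.exp_pos (ε / 2)).le
    have : 0 ≤ x * Real.exp (ε / 2) + (1 - x) := by linarith
    positivity
  · have := mul_nonneg hx (Real.exp_pos (-(ε / 2))).le
    have : 0 ≤ x * Real.exp (-(ε / 2)) + (1 - x) := by linarith
    positivity

/-! ### Programs that write circuits

Registers `6`, `7`, `8` hold the constants `0`, `1`, `2`; registers `9` to `13` hold `L`, `width`,
the number of position qubits, the first position qubit and the flag; registers from `40` on are
used as scratch registers. -/

/-- The instructions for a Toffoli gate. -/
def ccxOps (a b c : ℕ) : List Op :=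
  [.had c, .crot 8 b c, .cnot a b, .crot 8 b c, .crot 8 b c, .crot 8 b c, .cnot a b,
    .crot 8 a c, .had c]

def hProg (a n : ℕ) : Prog :=
  .seq (block [.add 41 a 6, .add 42 n 6])
    (.whileDo 42 (block [.had 41, .add 41 41 7, .sub 42 42 7]))

def chainProg : Prog :=
  .seq (block [.sub 43 10 7, .add 44 10 6, .add 45 10 7, .add 46 10 6])
    (.whileDo 46 (block (.cnot 44 45 :: (ccxOps 44 43 45 ++
      [.sub 43 43 7, .add 44 45 6, .add 45 45 7, .sub 46 46 7]))))

def unchainProg : Prog :=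
  .seq (block [.add 43 6 6, .add 45 10 10, .sub 44 45 7, .add 46 10 6])
    (.whileDo 46 (block (.cnot 44 45 :: (ccxOps 44 43 45 ++
      [.add 43 43 7, .add 45 44 6, .sub 44 44 7, .sub 46 46 7]))))

def flagProg : Prog :=
  .seq (block [.const 50 6, .add 47 10 50, .add 49 47 7, .sub 48 12 7, .add 50 1 6])
    (.whileDo 50 (block (ccxOps 47 48 13 ++ (ccxOps 49 48 13 ++
      [.sub 48 48 7, .add 47 49 6, .add 49 49 7, .sub 50 50 7]))))

def computeProg : Prog := .seq (block [.query]) (.seq chainProg flagProg)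

def uncomputeProg : Prog := .seq flagProg (.seq unchainProg (block [.query]))

def signProg : Prog := .seq computeProg (.seq (block [.crot 7 13 13]) uncomputeProg)

def zeroProg : Prog :=
  .seq chainProg (.seq (block [.add 43 10 10, .crot 7 43 43]) unchainProg)

def layerProg : Prog := .seq (hProg 6 9) (hProg 12 11)

def groverProg : Prog := .seq signProg (.seq layerProg (.seq zeroProg layerProg))

/-- Write the circuit for the number of rounds in register `24`. -/
def circuitProg : Prog :=
  .seq (block [.had 10, .crot 7 10 10, .had 10, .add 40 24 6])
    (.seq layerProg (.seq (.whileDo 40 (.seq groverProg (block [.sub 40 40 7]))) computeProg))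

/-- In every state whose lower registers are as in `m`, the program `P` appends `gs` to the
circuit, within time `T`. -/
def Emits (O : Oracle) (P : Prog) (m : ℕ → ℕ) (gs : List Gate) (T : ℕ) : Prop :=
  ∀ s : St, (∀ r < 41, s.mem r = m r) → ∃ s', Det O P s s' ∧ s'.circuit = gs ++ s.circuit ∧
    (∀ r < 41, s'.mem r = m r) ∧ s'.time ≤ s.time + T

lemma Emits.seq {P Q : Prog} {m : ℕ → ℕ} {gs hs : List Gate} {T T' : ℕ}
    (h : Emits O P m gs T) (h' : Emits O Q m hs T') :
    Emits O (.seq P Q) m (hs ++ gs) (T + T' + 1) := by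
  intro s hs
  obtain ⟨s₁, d₁, c₁, m₁, t₁⟩ := h s.tick hs
  obtain ⟨s₂, d₂, c₂, m₂, t₂⟩ := h' s₁ m₁
  refine ⟨s₂, d₁.seq d₂, ?_, m₂, ?_⟩
  · rw [c₂, c₁, List.append_assoc, St.tick_circuit]
  · rw [St.tick_time] at t₁; omega

lemma Emits.mono {P : Prog} {m : ℕ → ℕ} {gs hs : List Gate} {T T' : ℕ}
    (h : Emits O P m gs T) (hgs : gs = hs) (hT : T ≤ T') : Emits O P m hs T' := by
  intro s hs
  obtain ⟨s₁, d₁, c₁, m₁, t₁⟩ := h s hs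
  exact ⟨s₁, d₁, by rw [c₁, hgs], m₁, by omega⟩

/-- The constants in the memory that the programs for circuits use. -/
structure CircEnv (m : ℕ → ℕ) (L b : ℕ) : Prop where
  zero : m 6 = 0
  one : m 7 = 1
  two : m 8 = 2
  bits : m 1 = b
  idx : m 9 = L
  wide : m 10 = width L b
  pos : m 11 = b + 6
  first : m 12 = L + b
  flag : m 13 = flagBit L b

lemma hProg_emits {m : ℕ → ℕ} {L b : ℕ} (hm : CircEnv m L b) {a n : ℕ} (ha : a < 41)
    (hn : n < 41) : Emits O (hProg a n) m (hL (m a) (m n)) (10 * m n + 10) := by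
  intro s hs
  have e6 := (hs 6 (by norm_num)).trans hm.zero
  have h0 := det_block (O := O) [.add 41 a 6, .add 42 n 6] (by simp) s.tick
  set s₀ := acts [.add 41 a 6, .add 42 n 6] s.tick with hs₀
  have m0 : ∀ r < 41, s₀.mem r = m r := by
    intro r hr
    simp [hs₀, acts, Op.act, show r ≠ 41 by omega, show r ≠ 42 by omega,
      hs r hr]
  have m41 : s₀.mem 41 = m a := by
    simp [hs₀, acts, Op.act, hs a ha, e6]
  have m42 : s₀.mem 42 = m n := by
    simp [hs₀, acts, Op.act, hs n hn, e6, show n ≠ 41 by omega]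
  have c0 : s₀.circuit = s.circuit := by simp [hs₀, acts, Op.act]
  have t0 : s₀.time = s.time + 6 := by simp [hs₀, acts, Op.act]
  obtain ⟨s', d, ⟨i1, i2, i3, i4⟩, t⟩ := Det.while_inv (O := O)
    (P := block [.had 41, .add 41 41 7, .sub 42 42 7]) (r := 42) (N := m n) (c := 8)
    (fun i s' => (∀ r < 41, s'.mem r = m r) ∧ s'.mem 41 = m a + i ∧ s'.mem 42 = m n - i ∧
      s'.circuit = hL (m a) i ++ s.circuit)
    (fun i hi s' ⟨i1, i2, i3, i4⟩ => by
      have e6 := (i1 6 (by norm_num)).trans hm.zero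
      have e7 := (i1 7 (by norm_num)).trans hm.one
      refine ⟨by omega, _, det_block _ (by simp) _, ⟨fun r hr => ?_, ?_, ?_, ?_⟩, ?_⟩
      · simp [acts, Op.act, show r ≠ 41 by omega, show r ≠ 42 by omega,
          i1 r hr]
      · simp [acts, Op.act, i2, e7]; omega
      · simp [acts, Op.act, i3, e7]; omega
      · simp [acts, Op.act, i4, i2, hL]
      · simp [acts, Op.act])
    (fun s' ⟨i1, i2, i3, i4⟩ => ⟨by omega, i1, i2, i3, i4⟩) (s := s₀)
    ⟨m0, by omega, by omega, by simp [c0, hL]⟩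
  exact ⟨s', h0.seq d, i4, i1, by omega⟩

lemma chainProg_emits {m : ℕ → ℕ} {L b : ℕ} (hm : CircEnv m L b) :
    Emits O chainProg m (chainL (width L b) (width L b)) (32 * width L b + 16) := by
  intro s hs
  set w := width L b with hw
  have e6 := (hs 6 (by norm_num)).trans hm.zero
  have e7 := (hs 7 (by norm_num)).trans hm.one
  have e10 : s.mem 10 = w := (hs 10 (by norm_num)).trans hm.wide
  have h0 := det_block (O := O) [.sub 43 10 7, .add 44 10 6, .add 45 10 7, .add 46 10 6]
    (by simp) s.tick
  set s₀ := acts [.sub 43 10 7, .add 44 10 6, .add 45 10 7, .add 46 10 6] s.tick with hs₀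
  obtain ⟨s', d, ⟨i1, i2, i3, i4, i5, i6⟩, t⟩ := Det.while_inv (O := O)
    (P := block (.cnot 44 45 :: (ccxOps 44 43 45 ++
      [.sub 43 43 7, .add 44 45 6, .add 45 45 7, .sub 46 46 7]))) (r := 46) (N := w) (c := 31)
    (fun i s' => (∀ r < 41, s'.mem r = m r) ∧ s'.mem 43 = w - 1 - i ∧ s'.mem 44 = w + i ∧
      s'.mem 45 = w + i + 1 ∧ s'.mem 46 = w - i ∧ s'.circuit = chainL w i ++ s.circuit)
    (fun i hi s' ⟨i1, i2, i3, i4, i5, i6⟩ => by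
      have e6 := (i1 6 (by norm_num)).trans hm.zero
      have e7 := (i1 7 (by norm_num)).trans hm.one
      have e8 := (i1 8 (by norm_num)).trans hm.two
      refine ⟨by omega, _, det_block _ (by simp [ccxOps]) _, ⟨fun r hr => ?_, ?_, ?_, ?_, ?_, ?_⟩, ?_⟩
      · simp [ccxOps, acts, Op.act, show r ≠ 43 by omega,
          show r ≠ 44 by omega, show r ≠ 45 by omega, show r ≠ 46 by omega, i1 r hr]
      · simp [ccxOps, acts, Op.act, i2, e7]; omega
      · simp [ccxOps, acts, Op.act, i4, e6]; omega
      · simp [ccxOps, acts, Op.act, i4, e7]; omega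
      · simp [ccxOps, acts, Op.act, i5, e7]; omega
      · simp [ccxOps, acts, Op.act, i2, i3, i4, i6, e8, chainL, chainStep,
          ccxL]
      · simp [ccxOps, acts, Op.act])
    (fun s' ⟨i1, i2, i3, i4, i5, i6⟩ => ⟨by omega, i1, i2, i3, i4, i5, i6⟩) (s := s₀)
    ⟨fun r hr => by
      simp [hs₀, acts, Op.act, show r ≠ 43 by omega,
          show r ≠ 44 by omega, show r ≠ 45 by omega, show r ≠ 46 by omega, hs r hr],
      by simp [hs₀, acts, Op.act, e10, e7],
      by simp [hs₀, acts, Op.act, e10, e6],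
      by simp [hs₀, acts, Op.act, e10, e7],
      by simp [hs₀, acts, Op.act, e10, e6],
      by simp [hs₀, acts, Op.act, chainL]⟩
  have t0 : s₀.time = s.time + 10 := by simp [hs₀, acts, Op.act]
  exact ⟨s', h0.seq d, i6, i1, by omega⟩

lemma unchainProg_emits {m : ℕ → ℕ} {L b : ℕ} (hm : CircEnv m L b) :
    Emits O unchainProg m (unchainL (width L b) (width L b)) (32 * width L b + 16) := by
  intro s hs
  set w := width L b with hw
  have e6 := (hs 6 (by norm_num)).trans hm.zero
  have e7 := (hs 7 (by norm_num)).trans hm.one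
  have e10 : s.mem 10 = w := (hs 10 (by norm_num)).trans hm.wide
  have h0 := det_block (O := O) [.add 43 6 6, .add 45 10 10, .sub 44 45 7, .add 46 10 6]
    (by simp) s.tick
  set s₀ := acts [.add 43 6 6, .add 45 10 10, .sub 44 45 7, .add 46 10 6] s.tick with hs₀
  obtain ⟨s', d, ⟨i1, i2, i3, i4, i5, i6⟩, t⟩ := Det.while_inv (O := O)
    (P := block (.cnot 44 45 :: (ccxOps 44 43 45 ++
      [.add 43 43 7, .add 45 44 6, .sub 44 44 7, .sub 46 46 7]))) (r := 46) (N := w) (c := 31)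
    -- The recursion of `unchainL` adds new gates at the end that is applied first, so the invariant
    -- says which gates remain to be written.
    (fun i s' => (∀ r < 41, s'.mem r = m r) ∧ s'.mem 43 = i ∧ s'.mem 44 = w + w - i - 1 ∧
      s'.mem 45 = w + w - i ∧ s'.mem 46 = w - i ∧
      unchainL w (w - i) ++ s'.circuit = unchainL w w ++ s.circuit)
    (fun i hi s' ⟨i1, i2, i3, i4, i5, i6⟩ => by
      have e6 := (i1 6 (by norm_num)).trans hm.zero
      have e7 := (i1 7 (by norm_num)).trans hm.one
      have e8 := (i1 8 (by norm_num)).trans hm.two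
      refine ⟨by omega, _, det_block _ (by simp [ccxOps]) _, ⟨fun r hr => ?_, ?_, ?_, ?_, ?_, ?_⟩, ?_⟩
      · simp [ccxOps, acts, Op.act, show r ≠ 43 by omega,
          show r ≠ 44 by omega, show r ≠ 45 by omega, show r ≠ 46 by omega, i1 r hr]
      · simp [ccxOps, acts, Op.act, i2, e7]
      · simp [ccxOps, acts, Op.act, i3, e7]; omega
      · simp [ccxOps, acts, Op.act, i3, e6]; omega
      · simp [ccxOps, acts, Op.act, i5, e7]; omega
      · rw [← i6]
        obtain ⟨k, hk⟩ : ∃ k, w = i + k + 1 := ⟨w - i - 1, by omega⟩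
        rw [show w - i = k + 1 by omega, show w - (i + 1) = k by omega, unchainL,
          List.append_assoc]
        simp [ccxOps, acts, Op.act, i2, i3, i4, e8, chainStep, ccxL]
        rw [show w - 1 - k = i by omega, show w + w - i - 1 = w + k by omega,
          show w + w - i = w + k + 1 by omega]
        simp
      · simp [ccxOps, acts, Op.act])
    (fun s' ⟨i1, i2, i3, i4, i5, i6⟩ => ⟨by omega, i1, i2, i3, i4, i5, i6⟩) (s := s₀)
    ⟨fun r hr => by
      simp [hs₀, acts, Op.act, show r ≠ 43 by omega,
          show r ≠ 44 by omega, show r ≠ 45 by omega, show r ≠ 46 by omega, hs r hr],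
      by simp [hs₀, acts, Op.act, e6],
      by simp [hs₀, acts, Op.act, e10, e7],
      by simp [hs₀, acts, Op.act, e10],
      by simp [hs₀, acts, Op.act, e10, e6],
      by simp [hs₀, acts, Op.act]⟩
  have t0 : s₀.time = s.time + 10 := by simp [hs₀, acts, Op.act]
  exact ⟨s', h0.seq d, by simpa [unchainL] using i6, i1, by omega⟩

lemma flagProg_emits {m : ℕ → ℕ} {L b : ℕ} (hm : CircEnv m L b) :
    Emits O flagProg m (flagL L b b) (48 * b + 16) := by
  intro s hs
  set w := width L b with hw
  have e1 := (hs 1 (by norm_num)).trans hm.bits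
  have e6 := (hs 6 (by norm_num)).trans hm.zero
  have e7 := (hs 7 (by norm_num)).trans hm.one
  have e10 : s.mem 10 = w := (hs 10 (by norm_num)).trans hm.wide
  have e12 := (hs 12 (by norm_num)).trans hm.first
  have h0 := det_block (O := O)
    [.const 50 6, .add 47 10 50, .add 49 47 7, .sub 48 12 7, .add 50 1 6] (by simp) s.tick
  set s₀ := acts [.const 50 6, .add 47 10 50, .add 49 47 7, .sub 48 12 7, .add 50 1 6] s.tick
    with hs₀
  obtain ⟨s', d, ⟨i1, i2, i3, i4, i5, i6⟩, t⟩ := Det.while_inv (O := O)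
    (P := block (ccxOps 47 48 13 ++ (ccxOps 49 48 13 ++
      [.sub 48 48 7, .add 47 49 6, .add 49 49 7, .sub 50 50 7]))) (r := 50) (N := b) (c := 46)
    (fun i s' => (∀ r < 41, s'.mem r = m r) ∧ s'.mem 47 = w + 6 + i ∧ s'.mem 49 = w + 7 + i ∧
      s'.mem 48 = L + b - 1 - i ∧ s'.mem 50 = b - i ∧
      s'.circuit = flagL L b i ++ s.circuit)
    (fun i hi s' ⟨i1, i2, i3, i4, i5, i6⟩ => by
      have e6 := (i1 6 (by norm_num)).trans hm.zero
      have e7 := (i1 7 (by norm_num)).trans hm.one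
      have e8 := (i1 8 (by norm_num)).trans hm.two
      have e13 := (i1 13 (by norm_num)).trans hm.flag
      refine ⟨by omega, _, det_block _ (by simp [ccxOps]) _, ⟨fun r hr => ?_, ?_, ?_, ?_, ?_, ?_⟩, ?_⟩
      · simp [ccxOps, acts, Op.act, show r ≠ 47 by omega,
          show r ≠ 48 by omega, show r ≠ 49 by omega, show r ≠ 50 by omega, i1 r hr]
      · simp [ccxOps, acts, Op.act, i3, e6]; omega
      · simp [ccxOps, acts, Op.act, i3, e7]; omega
      · simp [ccxOps, acts, Op.act, i4, e7]; omega
      · simp [ccxOps, acts, Op.act, i5, e7]; omega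
      · simp [ccxOps, acts, Op.act, i2, i3, i4, i6, e8, e13, flagL, ccxL, ← hw]
      · simp [ccxOps, acts, Op.act])
    (fun s' ⟨i1, i2, i3, i4, i5, i6⟩ => ⟨by omega, i1, i2, i3, i4, i5, i6⟩) (s := s₀)
    ⟨fun r hr => by
      simp [hs₀, acts, Op.act, show r ≠ 47 by omega,
          show r ≠ 48 by omega, show r ≠ 49 by omega, show r ≠ 50 by omega, hs r hr],
      by simp [hs₀, acts, Op.act, e10],
      by simp [hs₀, acts, Op.act, e10, e7],
      by simp [hs₀, acts, Op.act, e12, e7],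
      by simp [hs₀, acts, Op.act, e1, e6],
      by simp [hs₀, acts, Op.act, flagL]⟩
  have t0 : s₀.time = s.time + 12 := by simp [hs₀, acts, Op.act]
  exact ⟨s', h0.seq d, i6, i1, by omega⟩

lemma computeProg_emits {m : ℕ → ℕ} {L b : ℕ} (hm : CircEnv m L b) :
    Emits O computeProg m (computeL L b) (100 * width L b) := by
  have hq : Emits O (block [.query]) m [.query] 3 := fun s hs =>
    ⟨_, det_block _ (by simp) _, by simp [acts, Op.act], fun r hr => by simp [acts, Op.act, hs r hr],
      by simp [acts, Op.act]⟩
  refine (hq.seq ((chainProg_emits hm).seq (flagProg_emits hm))).mono (by simp [computeL]) ?_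
  unfold width; omega

lemma uncomputeProg_emits {m : ℕ → ℕ} {L b : ℕ} (hm : CircEnv m L b) :
    Emits O uncomputeProg m (uncomputeL L b) (100 * width L b) := by
  have hq : Emits O (block [.query]) m [.query] 3 := fun s hs =>
    ⟨_, det_block _ (by simp) _, by simp [acts, Op.act], fun r hr => by simp [acts, Op.act, hs r hr],
      by simp [acts, Op.act]⟩
  refine ((flagProg_emits hm).seq ((unchainProg_emits hm).seq hq)).mono (by simp [uncomputeL]) ?_
  unfold width; omega

lemma signProg_emits {m : ℕ → ℕ} {L b : ℕ} (hm : CircEnv m L b) :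
    Emits O signProg m (signL L b) (202 * width L b) := by
  have hq : Emits O (block [.crot 7 13 13]) m [.crot 1 (flagBit L b) (flagBit L b)] 3 :=
    fun s hs => ⟨_, det_block _ (by simp) _, by
      simp [acts, Op.act, hs 7 (by norm_num), hm.one, hs 13 (by norm_num), hm.flag],
      fun r hr => by simp [acts, Op.act, hs r hr], by simp [acts, Op.act]⟩
  refine ((computeProg_emits hm).seq (hq.seq (uncomputeProg_emits hm))).mono (by simp [signL]) ?_
  unfold width; omega

lemma zeroProg_emits {m : ℕ → ℕ} {L b : ℕ} (hm : CircEnv m L b) :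
    Emits O zeroProg m (zeroL L b) (72 * width L b) := by
  have hq : Emits O (block [.add 43 10 10, .crot 7 43 43]) m
      [.crot 1 (2 * width L b) (2 * width L b)] 5 :=
    fun s hs => ⟨_, det_block _ (by simp) _, by
      simp [acts, Op.act, hs 7 (by norm_num), hm.one, hs 10 (by norm_num),
        hm.wide, two_mul],
      fun r hr => by simp [acts, Op.act, hs r hr, show r ≠ 43 by omega],
      by simp [acts, Op.act]⟩
  refine ((chainProg_emits hm).seq (hq.seq (unchainProg_emits hm))).mono (by simp [zeroL]) ?_
  unfold width; omega

lemma layerProg_emits {m : ℕ → ℕ} {L b : ℕ} (hm : CircEnv m L b) :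
    Emits O layerProg m (layerL L b) (16 * width L b) := by
  have h1 := hProg_emits (O := O) hm (a := 6) (n := 9) (by norm_num) (by norm_num)
  have h2 := hProg_emits (O := O) hm (a := 12) (n := 11) (by norm_num) (by norm_num)
  rw [hm.zero, hm.idx] at h1
  rw [hm.first, hm.pos] at h2
  refine (h1.seq h2).mono rfl ?_
  unfold width; omega

lemma groverProg_emits {m : ℕ → ℕ} {L b : ℕ} (hm : CircEnv m L b) :
    Emits O groverProg m (groverL L b) (310 * width L b) := by
  refine ((signProg_emits hm).seq ((layerProg_emits hm).seq
    ((zeroProg_emits hm).seq (layerProg_emits hm)))).mono (by simp [groverL]) ?_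
  unfold width; omega

/-! ### Lengths of the circuits -/

lemma length_ccxL (a b c : ℕ) : (ccxL a b c).length = 9 := by simp [ccxL]

lemma length_chainL (w n : ℕ) : (chainL w n).length = 10 * n := by
  induction n with
  | zero => simp [chainL]
  | succ n ih => simp [chainL, chainStep, length_ccxL, ih]; omega

lemma length_unchainL (w n : ℕ) : (unchainL w n).length = 10 * n := by
  induction n with
  | zero => simp [unchainL]
  | succ n ih => simp [unchainL, chainStep, length_ccxL, ih]; omega

lemma length_flagL (L b n : ℕ) : (flagL L b n).length = 18 * n := by
  induction n with
  | zero => simp [flagL]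
  | succ n ih => simp [flagL, length_ccxL, ih]; omega

lemma length_hL (p n : ℕ) : (hL p n).length = n := by
  induction n with
  | zero => simp [hL]
  | succ n ih => simp [hL, ih]

lemma length_iterL (L b r : ℕ) :
    (iterL L b r).length ≤ 90 * width L b * r + (width L b + 3) := by
  induction r with
  | zero => simp [iterL, layerL, notL, length_hL]; unfold width; omega
  | succ n ih =>
    have h : (groverL L b).length ≤ 90 * width L b := by
      simp [groverL, signL, zeroL, layerL, computeL, uncomputeL, length_chainL,
        length_unchainL, length_flagL, length_hL]
      unfold width
      omega
    rw [iterL, List.length_append, mul_add]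
    omega

lemma length_circuitL (L b r : ℕ) :
    (circuitL L b r).length ≤ 90 * width L b * (r + 1) := by
  have h := length_iterL L b r
  have h' : (computeL L b).length ≤ 30 * width L b := by
    simp [computeL, length_chainL, length_flagL]
    unfold width
    omega
  have h6 : 6 ≤ width L b := by unfold width; omega
  rw [circuitL, List.length_append, mul_add]
  omega

lemma circuitProg_det {L b : ℕ} (s : St) (hm : CircEnv s.mem L b) :
    ∃ s', Det O circuitProg s s' ∧ s'.circuit = circuitL L b (s.mem 24) ++ s.circuit ∧
      (∀ r < 40, s'.mem r = s.mem r) ∧ s'.time ≤ s.time + 400 * width L b * (s.mem 24 + 1) := by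
  set m := s.mem with hmem
  have hw : 6 ≤ width L b := by unfold width; omega
  have henv : ∀ m' : ℕ → ℕ, (∀ r < 40, m' r = m r) → CircEnv m' L b := fun m' h =>
    ⟨by rw [h 6 (by norm_num), hm.zero], by rw [h 7 (by norm_num), hm.one],
      by rw [h 8 (by norm_num), hm.two], by rw [h 1 (by norm_num), hm.bits],
      by rw [h 9 (by norm_num), hm.idx], by rw [h 10 (by norm_num), hm.wide],
      by rw [h 11 (by norm_num), hm.pos], by rw [h 12 (by norm_num), hm.first],
      by rw [h 13 (by norm_num), hm.flag]⟩
  have h0 := det_block (O := O) [.had 10, .crot 7 10 10, .had 10, .add 40 24 6] (by simp) s.tick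
  set s₀ := acts [.had 10, .crot 7 10 10, .had 10, .add 40 24 6] s.tick with hs₀
  have m0 : ∀ r < 40, s₀.mem r = m r := fun r hr => by
    simp [hs₀, acts, Op.act, show r ≠ 40 by omega, hmem]
  have m40 : s₀.mem 40 = m 24 := by
    simp [hs₀, acts, Op.act, ← hmem, hm.zero]
  have c0 : s₀.circuit = notL (width L b) ++ s.circuit := by
    simp [hs₀, acts, Op.act, ← hmem, hm.one, hm.wide, notL]
  have t0 : s₀.time = s.time + 10 := by simp [hs₀, acts, Op.act]
  obtain ⟨s₁, d₁, c₁, m₁, t₁⟩ := layerProg_emits (O := O) (henv s₀.mem m0) s₀.tick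
    (fun _ _ => rfl)
  obtain ⟨s₂, d₂, ⟨i1, i2, i3⟩, t₂⟩ := Det.while_inv (O := O)
    (P := .seq groverProg (block [.sub 40 40 7])) (r := 40) (N := m 24)
    (c := 310 * width L b + 6)
    (fun i s' => (∀ r < 40, s'.mem r = m r) ∧ s'.mem 40 = m 24 - i ∧
      s'.circuit = iterL L b i ++ s.circuit)
    (fun i hi s' ⟨i1, i2, i3⟩ => by
      obtain ⟨s₃, d₃, c₃, m₃, t₃⟩ := groverProg_emits (O := O) (henv s'.mem i1) s'.tick.tick
        (fun _ _ => rfl)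
      refine ⟨by omega, _, d₃.seq (det_block _ (by simp) _), ⟨fun r hr => ?_, ?_, ?_⟩, ?_⟩
      · simp [acts, Op.act, show r ≠ 40 by omega, m₃ r (by omega), i1 r hr]
      · simp [acts, Op.act, m₃ 40 (by norm_num), m₃ 7 (by norm_num), i1 7 (by norm_num), hm.one,
          i2]; omega
      · simp [acts, Op.act, c₃, i3, iterL]
      · simp at t₃
        simp [acts, Op.act]; omega)
    (fun s' ⟨i1, i2, i3⟩ => ⟨by omega, i1, i2, i3⟩) (s := s₁.tick)
    ⟨fun r hr => by rw [St.tick_mem, m₁ r (by omega), m0 r hr],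
      by rw [St.tick_mem, m₁ 40 (by norm_num), m40]; rfl,
      by rw [St.tick_circuit, c₁, St.tick_circuit, c0]; simp [iterL]⟩
  obtain ⟨s₄, d₄, c₄, m₄, t₄⟩ := computeProg_emits (O := O) (henv s₂.mem i1) s₂ (fun _ _ => rfl)
  refine ⟨s₄, h0.seq (d₁.seq (d₂.seq d₄)), by rw [c₄, i3]; simp [circuitL],
    fun r hr => by rw [m₄ r (by omega), i1 r hr], ?_⟩
  simp at t₁ t₂
  have : m 24 * (310 * width L b + 6) ≤ m 24 * (400 * width L b) :=
    Nat.mul_le_mul_left _ (by omega)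
  nlinarith

/-! ### Arithmetic programs

Registers from `60` on are used as scratch registers. -/

/-- In every state whose registers below `60` are as in `m`, the program `P` changes them to `m'`,
within time `T`. -/
def Calc (O : Oracle) (P : Prog) (m m' : ℕ → ℕ) (T : ℕ) : Prop :=
  ∀ s : St, (∀ r < 60, s.mem r = m r) → ∃ s', Det O P s s' ∧ (∀ r < 60, s'.mem r = m' r) ∧
    s'.circuit = s.circuit ∧ s'.outcome = s.outcome ∧ s'.time ≤ s.time + T

lemma Calc.seq {P Q : Prog} {m m' m'' : ℕ → ℕ} {T T' : ℕ}
    (h : Calc O P m m' T) (h' : Calc O Q m' m'' T') : Calc O (.seq P Q) m m'' (T + T' + 1) := by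
  intro s hs
  obtain ⟨s₁, d₁, m₁, c₁, o₁, t₁⟩ := h s.tick hs
  obtain ⟨s₂, d₂, m₂, c₂, o₂, t₂⟩ := h' s₁ m₁
  refine ⟨s₂, d₁.seq d₂, m₂, c₂.trans c₁, o₂.trans o₁, ?_⟩
  rw [St.tick_time] at t₁
  omega

/-- The instructions that only calculate with registers below `60`. -/
def Op.plain : Op → Prop
  | .const _ _ => True
  | .add _ a e => a < 60 ∧ e < 60
  | .sub _ a e => a < 60 ∧ e < 60
  | .half _ a => a < 60
  | _ => False

/-- The effect of a plain instruction on the memory. -/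
def Op.memAct (m : ℕ → ℕ) : Op → ℕ → ℕ
  | .const d k => Function.update m d k
  | .add d a e => Function.update m d (m a + m e)
  | .sub d a e => Function.update m d (m a - m e)
  | .half d a => Function.update m d (m a / 2)
  | _ => m

lemma update_agree {m m' : ℕ → ℕ} (h : ∀ r < 60, m r = m' r) (d x : ℕ) :
    ∀ r < 60, Function.update m d x r = Function.update m' d x r := by
  intro r hr
  by_cases hd : r = d <;> simp [hd, h r hr]

lemma Calc.block {l : List Op} (hl : ∀ o ∈ l, o.plain) (m : ℕ → ℕ) :
    Calc O (block l) m (l.foldl Op.memAct m) (2 * l.length + 1) := by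
  intro s hs
  refine ⟨acts l s, det_block l (fun h => hl _ h) s, ?_⟩
  induction l generalizing s m with
  | nil => exact ⟨hs, rfl, rfl, by simp [acts]⟩
  | cons o l ih =>
    have ho := hl o (by simp)
    have h1 : (∀ r < 60, (o.act s.tick).mem r = o.memAct m r) ∧
        (o.act s.tick).circuit = s.circuit ∧ (o.act s.tick).outcome = s.outcome ∧
        (o.act s.tick).time = s.time + 2 := by
      cases o with
      | const d k => exact ⟨update_agree hs d k, rfl, rfl, rfl⟩
      | add d a e =>
        refine ⟨?_, rfl, rfl, rfl⟩
        have := update_agree hs d (m a + m e)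
        simpa [Op.act, Op.memAct, hs a ho.1, hs e ho.2] using this
      | sub d a e =>
        refine ⟨?_, rfl, rfl, rfl⟩
        have := update_agree hs d (m a - m e)
        simpa [Op.act, Op.memAct, hs a ho.1, hs e ho.2] using this
      | half d a =>
        refine ⟨?_, rfl, rfl, rfl⟩
        have := update_agree hs d (m a / 2)
        simpa [Op.act, Op.memAct, hs a ho] using this
      | _ => exact ho.elim
    obtain ⟨h1, h2, h3, h4⟩ := h1
    obtain ⟨i1, i2, i3, i4⟩ := ih (fun o ho => hl o (by simp [ho])) (o.memAct m) _ h1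
    refine ⟨i1, i2.trans h2, i3.trans h3, i4.trans ?_⟩
    rw [h4, List.length_cons]
    omega

/-- `R[d] := R[a] * R[c]` -/
def mulProg (d a c : ℕ) : Prog :=
  .seq (block [.add 60 a 6, .add 61 c 6, .const 63 0])
    (.seq (.whileDo 61 (.seq (block [.half 62 61, .add 64 62 62, .sub 64 61 64])
      (.seq (.ifElse 64 (block [.add 63 63 60]) .skip)
        (block [.add 60 60 60, .add 61 62 6]))))
      (block [.add d 63 6]))

/-- Binary multiplication: the factor in register `61` is halved and the one in `60` doubled, while
the contributions of odd remainders are collected in `63`. -/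
lemma mulLoop_det (N : ℕ) : ∀ s : St, s.mem 6 = 0 → s.mem 61 < 2 ^ N →
    ∃ s', Det O (.whileDo 61 (.seq (block [.half 62 61, .add 64 62 62, .sub 64 61 64])
      (.seq (.ifElse 64 (block [.add 63 63 60]) .skip)
        (block [.add 60 60 60, .add 61 62 6])))) s s' ∧
      (∀ r < 60, s'.mem r = s.mem r) ∧ s'.mem 63 = s.mem 63 + s.mem 60 * s.mem 61 ∧
      s'.circuit = s.circuit ∧ s'.outcome = s.outcome ∧ s'.time ≤ s.time + 20 * N + 1 := by
  induction N with
  | zero =>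
    intro s _ h
    have h0 : s.mem 61 = 0 := by simpa using h
    exact ⟨s.tick, Det.while_zero h0, fun _ _ => rfl, by simp [h0], rfl, rfl, by simp⟩
  | succ N ih =>
    intro s h6 h
    by_cases h0 : s.mem 61 = 0
    · exact ⟨s.tick, Det.while_zero h0, fun _ _ => rfl, by simp [h0], rfl, rfl, by simp⟩
    set x := s.mem 61 with hx
    have e : s.mem 60 * x = s.mem 60 * (2 * (x / 2) + x % 2) := by rw [Nat.div_add_mod]
    have h1 := det_block (O := O) [.half 62 61, .add 64 62 62, .sub 64 61 64] (by simp)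
      s.tick.tick
    set s₁ := acts [.half 62 61, .add 64 62 62, .sub 64 61 64] s.tick.tick with hs₁
    have e64 : s₁.mem 64 = x - (x / 2 + x / 2) := by simp [hs₁, acts, Op.act, hx]
    obtain ⟨s₂, d₂, m₂, c₂, o₂, t₂⟩ : ∃ s₂,
        Det O (.ifElse 64 (block [.add 63 63 60]) .skip) s₁.tick s₂ ∧
        s₂.mem = Function.update s₁.mem 63 (s₁.mem 63 + s₁.mem 60 * (x % 2)) ∧
        s₂.circuit = s₁.circuit ∧ s₂.outcome = s₁.outcome ∧ s₂.time ≤ s₁.time + 5 := by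
      by_cases hb : s₁.mem 64 = 0
      · refine ⟨_, Det.ite_neg hb (det_skip _), ?_, rfl, rfl, by simp⟩
        rw [show x % 2 = 0 by omega]
        simp
      · refine ⟨_, Det.ite_pos hb (det_block _ (by simp) _), ?_, rfl, rfl, by simp [acts, Op.act]⟩
        rw [show x % 2 = 1 by omega]
        simp [acts, Op.act]
    have h3 := det_block (O := O) [.add 60 60 60, .add 61 62 6] (by simp) s₂
    set s₃ := acts [.add 60 60 60, .add 61 62 6] s₂ with hs₃
    have m3 : ∀ r < 60, s₃.mem r = s.mem r := by
      intro r hr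
      simp [hs₃, hs₁, m₂, acts, Op.act, show r ≠ 60 by omega,
        show r ≠ 61 by omega, show r ≠ 62 by omega, show r ≠ 63 by omega, show r ≠ 64 by omega]
    have e61 : s₃.mem 61 = x / 2 := by simp [hs₃, hs₁, m₂, acts, Op.act, h6, hx]
    have e60 : s₃.mem 60 = s.mem 60 + s.mem 60 := by simp [hs₃, hs₁, m₂, acts, Op.act]
    have e63 : s₃.mem 63 = s.mem 63 + s.mem 60 * (x % 2) := by
      simp [hs₃, hs₁, m₂, acts, Op.act]
    have t1 : s₁.time = s.time + 9 := by simp [hs₁, acts, Op.act]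
    have t3 : s₃.time = s₂.time + 5 := by simp [hs₃, acts, Op.act]
    obtain ⟨s₄, d₄, m₄, e₄, c₄, o₄, t₄⟩ := ih s₃ (by rw [m3 6 (by norm_num), h6]) (by
      rw [e61]; rw [pow_succ] at h; omega)
    refine ⟨s₄, Det.while_succ h0 (h1.seq (d₂.seq h3)) d₄,
      fun r hr => (m₄ r hr).trans (m3 r hr), ?_, ?_, ?_, by omega⟩
    · rw [e₄, e63, e60, e61, e]
      ring
    · rw [c₄]; simp [hs₃, acts, Op.act, c₂, hs₁]
    · rw [o₄]; simp [hs₃, acts, Op.act, o₂, hs₁]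

/-- The time depends only on the length of the second factor; the first one may be astronomically
large. -/
lemma mulProg_calc {d a c N : ℕ} (ha : a < 60) (hc : c < 60) {m : ℕ → ℕ} (h6 : m 6 = 0)
    (hN : m c < 2 ^ N) :
    Calc O (mulProg d a c) m (Function.update m d (m a * m c)) (20 * N + 13) := by
  intro s hs
  have e6 := (hs 6 (by norm_num)).trans h6
  have h1 := det_block (O := O) [.add 60 a 6, .add 61 c 6, .const 63 0] (by simp) s.tick
  set s₁ := acts [.add 60 a 6, .add 61 c 6, .const 63 0] s.tick with hs₁
  have m1 : ∀ r < 60, s₁.mem r = s.mem r := by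
    intro r hr
    simp [hs₁, acts, Op.act, show r ≠ 60 by omega,
      show r ≠ 61 by omega, show r ≠ 63 by omega]
  have t1 : s₁.time = s.time + 8 := by simp [hs₁, acts, Op.act]
  have e61 : s₁.mem 61 = m c := by
    simp [hs₁, acts, Op.act, e6, hs c hc, show c ≠ 60 by omega]
  have e60 : s₁.mem 60 = m a := by simp [hs₁, acts, Op.act, e6, hs a ha]
  have e63 : s₁.mem 63 = 0 := by simp [hs₁, acts, Op.act]
  obtain ⟨s₂, d₂, m₂, e₂, c₂, o₂, t₂⟩ := mulLoop_det (O := O) N s₁.tick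
    (by rw [St.tick_mem, m1 6 (by norm_num), e6]) (by rw [St.tick_mem, e61]; exact hN)
  refine ⟨_, h1.seq (d₂.seq (det_block _ (by simp) s₂)), ?_, ?_, ?_, ?_⟩
  · intro r hr
    have h6' : s₂.mem 6 = 0 := by rw [m₂ 6 (by norm_num), St.tick_mem, m1 6 (by norm_num), e6]
    simp only [St.tick_mem] at m₂ e₂
    rw [e63, e60, e61, zero_add] at e₂
    simp only [acts, Op.act, St.tick_mem, h6', add_zero, e₂]
    by_cases hd : r = d
    · simp [hd]
    · simp [hd, m₂ r hr, m1 r hr, hs r hr]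
  · simp [acts, Op.act, c₂, hs₁]
  · simp [acts, Op.act, o₂, hs₁]
  · simp [acts, Op.act] at t₂ ⊢
    omega

/-! ### The exact value of the candidate's probability -/

/-- With `R[24] = r`, `R[18] = 4 ^ q`, `R[25] = X ^ 2` and `R[26] = 4 ^ q - 2 * X ^ 2`, compute the
numerator and denominator of `prob r (X / 2 ^ q)` in the registers `28` and `29`. -/
def evalProg : Prog :=
  .seq (block [.add 30 24 24, .add 28 25 6, .const 27 0, .add 29 18 6])
    (.whileDo 30 (.seq (mulProg 31 28 26) (.seq (mulProg 32 29 25) (.seq (mulProg 27 27 18)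
      (.seq (block [.add 31 31 31, .add 32 32 32, .add 31 31 32, .sub 31 31 27])
        (.seq (mulProg 27 28 18) (.seq (mulProg 29 29 18)
          (block [.add 28 31 6, .sub 30 30 7]))))))))

/-- In each product of the recurrence the second factor is at most `4^q`, so a step takes time
`O(q)` although the numerators and denominators have about `2qj` bits after `j` steps. -/
lemma evalProg_det {X q : ℕ} (hX : 2 * X ^ 2 ≤ 4 ^ q) (s : St) (h6 : s.mem 6 = 0)
    (h7 : s.mem 7 = 1) (h18 : s.mem 18 = 4 ^ q) (h25 : s.mem 25 = X ^ 2)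
    (h26 : s.mem 26 = 4 ^ q - 2 * X ^ 2) :
    ∃ s', Det O evalProg s s' ∧ (∀ r < 27, s'.mem r = s.mem r) ∧
      s'.mem 28 = (evalIter X q (2 * s.mem 24)).1 ∧
      s'.mem 29 = (evalIter X q (2 * s.mem 24)).2.2 ∧
      (∀ r, 33 ≤ r → r < 60 → s'.mem r = s.mem r) ∧
      s'.circuit = s.circuit ∧ s'.time ≤ s.time + 2 * s.mem 24 * (200 * q + 200) + 12 := by
  have h0 := Calc.block (O := O) (l := [.add 30 24 24, .add 28 25 6, .const 27 0, .add 29 18 6])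
    (by simp [Op.plain]) s.mem
  obtain ⟨s₁, d₁, m₁, c₁, -, t₁⟩ := h0 s.tick (fun _ _ => rfl)
  simp [Op.memAct] at m₁
  have hlt : 4 ^ q < 2 ^ (2 * q + 1) := by
    rw [pow_succ, pow_mul]; norm_num
  obtain ⟨s', d, ⟨i1, i2, i3, i4, i5, i6, i7⟩, t⟩ := Det.while_inv (O := O)
    (P := (.seq (mulProg 31 28 26) (.seq (mulProg 32 29 25) (.seq (mulProg 27 27 18)
      (.seq (block [.add 31 31 31, .add 32 32 32, .add 31 31 32, .sub 31 31 27])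
        (.seq (mulProg 27 28 18) (.seq (mulProg 29 29 18)
          (block [.add 28 31 6, .sub 30 30 7])))))))) (r := 30) (N := 2 * s.mem 24)
    (c := 200 * q + 200)
    (fun i s' => (∀ r < 27, s'.mem r = s.mem r) ∧ s'.mem 28 = (evalIter X q i).1 ∧
      s'.mem 27 = (evalIter X q i).2.1 ∧ s'.mem 29 = (evalIter X q i).2.2 ∧
      s'.mem 30 = 2 * s.mem 24 - i ∧ (∀ r, 33 ≤ r → r < 60 → s'.mem r = s.mem r) ∧
      s'.circuit = s.circuit)
    (fun i hi u ⟨i1, i2, i3, i4, i5, i6, i7⟩ => by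
      refine ⟨by omega, ?_⟩
      have e6 : u.mem 6 = 0 := by rw [i1 6 (by norm_num), h6]
      have e7 : u.mem 7 = 1 := by rw [i1 7 (by norm_num), h7]
      have e18 : u.mem 18 = 4 ^ q := by rw [i1 18 (by norm_num), h18]
      have e25 : u.mem 25 = X ^ 2 := by rw [i1 25 (by norm_num), h25]
      have e26 : u.mem 26 = 4 ^ q - 2 * X ^ 2 := by rw [i1 26 (by norm_num), h26]
      have a1 := mulProg_calc (O := O) (d := 31) (a := 28) (c := 26) (N := 2 * q + 1)
        (by norm_num) (by norm_num) e6 (by rw [e26]; omega)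
      have a2 := mulProg_calc (O := O) (d := 32) (a := 29) (c := 25) (N := 2 * q + 1)
        (by norm_num) (by norm_num) (m := Function.update u.mem 31 (u.mem 28 * u.mem 26))
        (by simp [e6]) (by simp [e25]; omega)
      have a3 := a1.seq (a2.seq ((mulProg_calc (O := O) (d := 27) (a := 27) (c := 18)
        (N := 2 * q + 1) (by norm_num) (by norm_num) (by simp [e6]) (by simpa [e18] using hlt)).seq
        ((Calc.block (l := [.add 31 31 31, .add 32 32 32, .add 31 31 32, .sub 31 31 27])
          (by simp [Op.plain]) _).seq
        ((mulProg_calc (O := O) (d := 27) (a := 28) (c := 18)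
        (N := 2 * q + 1) (by norm_num) (by norm_num) (by simp [Op.memAct, e6])
          (by simpa [Op.memAct, e18] using hlt)).seq
        ((mulProg_calc (O := O) (d := 29) (a := 29) (c := 18)
        (N := 2 * q + 1) (by norm_num) (by norm_num) (by simp [Op.memAct, e6])
          (by simpa [Op.memAct, e18] using hlt)).seq
        (Calc.block (l := [.add 28 31 6, .sub 30 30 7]) (by simp [Op.plain]) _))))))
      obtain ⟨u', d', m', c', -, t'⟩ := a3 u.tick (fun _ _ => rfl)
      simp [Op.memAct, e6, e7, e18, e25, e26] at m' t'
      refine ⟨u', d', ⟨fun r hr => ?_, ?_, ?_, ?_, ?_, fun r hr hr' => ?_, ?_⟩, by omega⟩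
      · rw [m' r (by omega), ← i1 r hr]
        simp [show r ≠ 27 by omega, show r ≠ 28 by omega,
          show r ≠ 29 by omega, show r ≠ 30 by omega, show r ≠ 31 by omega, show r ≠ 32 by omega]
      · rw [m' 28 (by norm_num)]
        simp [evalIter, evalStep, ← i2, ← i3, ← i4]
        ring_nf
      · rw [m' 27 (by norm_num)]
        simp [evalIter, evalStep, ← i2, mul_comm]
      · rw [m' 29 (by norm_num)]
        simp [evalIter, evalStep, ← i4, mul_comm]
      · rw [m' 30 (by norm_num)]
        simp [i5]
        omega
      · rw [m' r (by omega), ← i6 r hr hr']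
        simp [show r ≠ 27 by omega, show r ≠ 28 by omega,
          show r ≠ 29 by omega, show r ≠ 30 by omega, show r ≠ 31 by omega, show r ≠ 32 by omega]
      · rw [c', ← i7]; rfl)
    (fun s' ⟨i1, i2, i3, i4, i5, i6, i7⟩ => ⟨by omega, i1, i2, i3, i4, i5, i6, i7⟩) (s := s₁)
    ⟨fun r hr => by
      rw [m₁ r (by omega)]
      simp [show r ≠ 27 by omega, show r ≠ 28 by omega,
          show r ≠ 29 by omega, show r ≠ 30 by omega],
      by rw [m₁ 28 (by norm_num)]; simp [h25, h6, evalIter],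
      by rw [m₁ 27 (by norm_num)]; simp [evalIter],
      by rw [m₁ 29 (by norm_num)]; simp [h18, h6, evalIter],
      by rw [m₁ 30 (by norm_num)]; simp; omega,
      fun r hr hr' => by
        rw [m₁ r (by omega)]
        simp [show r ≠ 27 by omega, show r ≠ 28 by omega,
          show r ≠ 29 by omega, show r ≠ 30 by omega],
      by rw [c₁]; rfl⟩
  refine ⟨s', d₁.seq d, i1, i2, i4, i6, i7, ?_⟩
  simp at t₁
  omega

/-! ### Sampling -/

/-- The entries of the oracle have `b` bits, and `t ^ 2` is their sum, rescaled. -/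
structure Amplitude (O : Oracle) (b : ℕ) (t : ℝ) : Prop where
  val_lt : ∀ i, O.val i < 2 ^ b
  pos : 0 < t
  le : t ≤ 1 / 8
  sq : t ^ 2 * 2 ^ (O.idx + b + 6) = ((∑ j ∈ Finset.range (2 ^ O.idx), O.val j : ℕ) : ℝ)

lemma Amplitude.tsum_le {b : ℕ} {t : ℝ} (h : Amplitude O b t) (r : ℕ) (A B : ℝ≥0∞) :
    ∑' x, measureCircuit O (circuitL O.idx b r) x *
        (if x.testBit (flagBit O.idx b) then A else B)
      ≤ ENNReal.ofReal (prob r t) * A + ENNReal.ofReal (1 - prob r t) * B := by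
  have h0 := h.pos
  have h1 := h.le
  have hs : Real.sin (Real.arcsin t) = t := Real.sin_arcsin (by linarith) (by linarith)
  -- `t ≤ 1/8 < 1`, so there are bad pairs.
  have hc : Real.cos (Real.arcsin t) ≠ 0 := by
    rw [Real.cos_arcsin]
    exact (Real.sqrt_pos.2 (by nlinarith)).ne'
  exact tsum_measure_circuitL h.val_lt (by rw [hs]; exact h.sq) (by rw [hs]; exact h0.ne') hc r
    (fun x hx => by simp [hx]) (fun x hx => by simp [hx])

/-- The products of the number of hits with the denominator, and of the number of samples with
numerator and denominator, are accumulated by additions, so that the comparison needs no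
multiplication of large numbers. -/
def sampleProg : Prog :=
  .seq circuitProg (.seq (.op .run) (.seq (block [.readBit 36 13])
    (.seq (.ifElse 36 (block [.add 31 31 29]) .skip)
      (block [.add 32 32 28, .add 33 33 29, .sub 34 34 7]))))

/-- After `j` of `n` samples, of which `h` have the flag set. -/
structure Sampling (m : ℕ → ℕ) (n T c j h : ℕ) (s : St) : Prop where
  le : h ≤ j
  frame : ∀ r < 30, s.mem r = m r
  hits : s.mem 31 = h * m 29
  num : s.mem 32 = j * m 28
  den : s.mem 33 = j * m 29
  rest : s.mem 34 = n - j
  circuit : s.circuit = []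
  time : s.time ≤ T + j * c

lemma CircEnv.congr {m m' : ℕ → ℕ} {L b : ℕ} (hm : CircEnv m L b) (h : ∀ r < 14, m' r = m r) :
    CircEnv m' L b :=
  ⟨by rw [h 6 (by norm_num), hm.zero], by rw [h 7 (by norm_num), hm.one],
    by rw [h 8 (by norm_num), hm.two], by rw [h 1 (by norm_num), hm.bits],
    by rw [h 9 (by norm_num), hm.idx], by rw [h 10 (by norm_num), hm.wide],
    by rw [h 11 (by norm_num), hm.pos], by rw [h 12 (by norm_num), hm.first],
    by rw [h 13 (by norm_num), hm.flag]⟩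

lemma sampleProg_rest {m : ℕ → ℕ} {n T c j h b : ℕ} (hm : CircEnv m O.idx b)
    {s u : St} (hs : Sampling m n T c j h s) (hu : ∀ r < 40, u.mem r = s.mem r)
    (huc : u.circuit = []) (hut : u.time + 30 ≤ s.time + c) :
    ∃ s', Sampling m n T c (j + 1) (h + if u.outcome.testBit (flagBit O.idx b) then 1 else 0) s' ∧
      Det O (.seq (block [.readBit 36 13])
        (.seq (.ifElse 36 (block [.add 31 31 29]) .skip)
          (block [.add 32 32 28, .add 33 33 29, .sub 34 34 7]))) u s' := by
  have h1 := det_block (O := O) [.readBit 36 13] (by simp) u.tick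
  set s₁ := acts [.readBit 36 13] u.tick with hs₁
  have e13 : u.mem 13 = flagBit O.idx b := by
    rw [hu 13 (by norm_num), hs.frame 13 (by norm_num), hm.flag]
  have e29 : u.mem 29 = m 29 := by rw [hu 29 (by norm_num), hs.frame 29 (by norm_num)]
  have e28 : u.mem 28 = m 28 := by rw [hu 28 (by norm_num), hs.frame 28 (by norm_num)]
  have e7 : u.mem 7 = 1 := by rw [hu 7 (by norm_num), hs.frame 7 (by norm_num), hm.one]
  have e31 : u.mem 31 = h * m 29 := by rw [hu 31 (by norm_num), hs.hits]
  have e32 : u.mem 32 = j * m 28 := by rw [hu 32 (by norm_num), hs.num]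
  have e33 : u.mem 33 = j * m 29 := by rw [hu 33 (by norm_num), hs.den]
  have e34 : u.mem 34 = n - j := by rw [hu 34 (by norm_num), hs.rest]
  have t1 : s₁.time = u.time + 4 := by simp [hs₁, acts, Op.act]
  set β := if u.outcome.testBit (flagBit O.idx b) then 1 else 0 with hβ
  have hβ1 : β ≤ 1 := by rw [hβ]; split_ifs <;> simp
  have e36 : s₁.mem 36 = β := by simp [hs₁, acts, Op.act, e13, hβ]
  have e1 : ∀ r, r ≠ 36 → s₁.mem r = u.mem r := by
    intro r hr; simp [hs₁, acts, Op.act, hr]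
  obtain ⟨s₂, d₂, m₂, e₂, c₂, t₂⟩ : ∃ s₂,
      Det O (.ifElse 36 (block [.add 31 31 29]) .skip) s₁.tick s₂ ∧
      (∀ r, r ≠ 31 → s₂.mem r = s₁.mem r) ∧ s₂.mem 31 = (h + β) * m 29 ∧
      s₂.circuit = s₁.circuit ∧ s₂.time ≤ s₁.time + 5 := by
    by_cases hb : s₁.mem 36 = 0
    · refine ⟨_, Det.ite_neg hb (det_skip _), fun _ _ => rfl, ?_, rfl, by simp⟩
      rw [e36] at hb
      simp [e1 31, e31, hb]
    · refine ⟨_, Det.ite_pos hb (det_block _ (by simp) _), fun r hr => ?_, ?_, rfl,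
        by simp [acts, Op.act]⟩
      · simp [acts, Op.act, hr]
      · rw [show β = 1 by omega]
        simp [acts, Op.act, e1 31, e1 29, e31, e29, add_mul]
  have hle := hs.le
  refine ⟨_, ⟨by omega, fun r hr => ?_, ?_, ?_, ?_, ?_, ?_, ?_⟩,
    h1.seq (d₂.seq (det_block _ (by simp) _))⟩
  · simp [acts, Op.act, show r ≠ 32 by omega, show r ≠ 33 by omega, show r ≠ 34 by omega]
    rw [m₂ r (by omega), e1 r (by omega), hu r (by omega), hs.frame r hr]
  · simp [acts, Op.act, e₂]
  · simp [acts, Op.act, m₂, e1, e32, e28, add_mul]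
  · simp [acts, Op.act, m₂, e1, e33, e29, add_mul]
  · simp [acts, Op.act, m₂, e1, e34, e7]; omega
  · simp [acts, Op.act, c₂, hs₁, huc]
  · have := hs.time
    simp [acts, Op.act, add_mul]
    omega

/-- The recursion of `binE` conditions on the next sample, as does the loop. Each sample rebuilds
the circuit and is therefore independent of the earlier ones. -/
lemma sampleLoop {m : ℕ → ℕ} {n T b r : ℕ} {t : ℝ} (ht : Amplitude O b t)
    (hm : CircEnv m O.idx b) (hr : m 24 = r) (V : ℕ → ℝ≥0∞) (Φ : St → ℝ≥0∞)
    (K K' : List Prog) (hΦ : ∀ h s, Sampling m n T (500 * width O.idx b * (r + 1)) n h s →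
      Bd O Φ K' (s.tick.cfg K) (V h)) (i : ℕ) :
    ∀ j h s, i + j = n → Sampling m n T (500 * width O.idx b * (r + 1)) j h s →
      Bd O Φ K' (s.cfg (.whileDo 34 sampleProg :: K))
        (binE (ENNReal.ofReal (prob r t)) (ENNReal.ofReal (1 - prob r t)) i
          (fun x => V (h + x))) := by
  classical
  induction i with
  | zero =>
    intro j h s hij hs
    obtain rfl : j = n := by omega
    exact Bd.det_trans (Det.while_zero (by rw [hs.rest]; omega)) (hΦ h s hs)
  | succ i ih =>
    intro j h s hij hs
    have hw : 6 ≤ width O.idx b := by unfold width; omega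
    set c := 500 * width O.idx b * (r + 1) with hc
    refine Bd.of_pure (τ := s.tick.cfg (sampleProg :: .whileDo 34 sampleProg :: K)) ?_ ?_
    · simp [step, St.cfg, St.tick, hs.rest, show n - j ≠ 0 by omega]
    have e24 : s.mem 24 = r := by rw [hs.frame 24 (by norm_num), hr]
    obtain ⟨u, du, cu, mu, tu⟩ := circuitProg_det (O := O) s.tick.tick
      (hm.congr (L := O.idx) fun r hr => hs.frame r (by omega))
    simp only [St.tick_mem, St.tick_circuit, St.tick_time, e24, hs.circuit, List.append_nil]
      at cu mu tu
    refine Bd.of_pure (τ := s.tick.tick.cfg (circuitProg :: _)) rfl (Bd.det_trans du ?_)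
    refine Bd.of_pure (τ := u.tick.cfg (.op .run :: _)) rfl ?_
    set A := binE (ENNReal.ofReal (prob r t)) (ENNReal.ofReal (1 - prob r t)) i
      (fun x => V (h + (x + 1)))
    set B := binE (ENNReal.ofReal (prob r t)) (ENNReal.ofReal (1 - prob r t)) i
      (fun x => V (h + x))
    have h1 := Bd.of_run (O := O) (K := .seq (block [.readBit 36 13])
      (.seq (.ifElse 36 (block [.add 31 31 29]) .skip)
        (block [.add 32 32 28, .add 33 33 29, .sub 34 34 7])) :: .whileDo 34 sampleProg :: K)
      -- Only the outcome is random; the value `⊤` on all other states fixes the rest of the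
      -- configuration.
      (Φ := fun s' => if s' = ⟨u.mem, [], s'.outcome, u.time + 2 + u.circuit.length⟩ then
        (if s'.outcome.testBit (flagBit O.idx b) then A else B) else ⊤) u.tick
      (binE (ENNReal.ofReal (prob r t)) (ENNReal.ofReal (1 - prob r t)) (i + 1)
          (fun x => V (h + x))) (by
        simp only [St.tick_mem, St.tick_circuit, St.tick_time]
        rw [cu]
        refine le_trans (le_of_eq ?_) (ht.tsum_le r A B)
        simp)
    refine h1.trans fun s' => ?_
    by_cases hs' : s' = ⟨u.mem, [], s'.outcome, u.time + 2 + u.circuit.length⟩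
    · rw [if_pos hs']
      have hlen := length_circuitL O.idx b r
      rw [← cu] at hlen
      have hr1 : width O.idx b ≤ width O.idx b * (r + 1) := Nat.le_mul_of_pos_right _ (by omega)
      obtain ⟨s'', hs'', d⟩ := sampleProg_rest (O := O) hm hs (u := s')
        (fun r hr => by rw [hs']; exact mu r hr) (by rw [hs'])
        (by
          rw [hs']
          simp only [hc]
          nlinarith)
      refine Bd.det_trans d ?_
      have := ih (j + 1) _ s'' (by omega) hs''
      split_ifs with hf
      · refine this.mono (le_of_eq ?_)
        simp only [hf, if_true, A]
        congr 1
        funext x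
        congr 1
        omega
      · refine this.mono (le_of_eq ?_)
        simp [hf, B]
    · rw [if_neg hs']
      exact .top _

/-! ### Testing a candidate for one number of rounds -/

/-- The absolute difference is the sum of the two truncated differences; eight doublings multiply it
by `256`. The verdict in register `22` is only ever cleared. -/
def compareProg : Prog :=
  .seq (block [.sub 37 31 32, .sub 38 32 31, .add 37 37 38, .add 37 37 37, .add 37 37 37,
      .add 37 37 37, .add 37 37 37, .add 37 37 37, .add 37 37 37, .add 37 37 37, .add 37 37 37,
      .sub 37 37 33])
    (.ifElse 37 (block [.const 22 0]) .skip)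

def testProg : Prog :=
  .seq evalProg (.seq (block [.const 31 0, .const 32 0, .const 33 0, .add 34 14 6])
    (.seq (.whileDo 34 sampleProg) compareProg))

open Classical in
lemma compareProg_det {n h F D : ℕ} (s : St) (h1 : s.mem 31 = h * D) (h2 : s.mem 32 = n * F)
    (h3 : s.mem 33 = n * D) : ∃ s', Det O compareProg s s' ∧
      s'.mem 22 = (if Passes n h F D then s.mem 22 else 0) ∧
      (∀ r < 27, r ≠ 22 → s'.mem r = s.mem r) ∧ s'.circuit = s.circuit ∧
      s'.time ≤ s.time + 40 := by
  set l : List Op := [.sub 37 31 32, .sub 38 32 31, .add 37 37 38, .add 37 37 37, .add 37 37 37,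
      .add 37 37 37, .add 37 37 37, .add 37 37 37, .add 37 37 37, .add 37 37 37, .add 37 37 37,
      .sub 37 37 33] with hl
  obtain ⟨s₁, d₁, m₁, c₁, -, t₁⟩ := Calc.block (O := O) (l := l) (by simp [hl, Op.plain]) s.mem
    s.tick (fun _ _ => rfl)
  have e37 : s₁.mem 37 = 256 * ((h * D - n * F) + (n * F - h * D)) - n * D := by
    rw [m₁ 37 (by norm_num)]
    simp [hl, Op.memAct, h1, h2, h3]
    omega
  have e1 : ∀ r < 27, s₁.mem r = s.mem r := by
    intro r hr
    rw [m₁ r (by omega)]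
    simp [hl, Op.memAct, show r ≠ 37 by omega, show r ≠ 38 by omega]
  simp [hl] at t₁
  by_cases hp : Passes n h F D
  · refine ⟨_, d₁.seq (Det.ite_neg ?_ (det_skip _)), ?_, fun r hr _ => ?_, ?_, ?_⟩
    · rw [e37]; exact Nat.sub_eq_zero_of_le hp
    · simp [hp, e1 22]
    · simp [e1 r hr]
    · simp [c₁]
    · simp; omega
  · refine ⟨_, d₁.seq (Det.ite_pos ?_ (det_block _ (by simp) _)), ?_, fun r hr h22 => ?_, ?_, ?_⟩
    · rw [e37]
      unfold Passes at hp
      omega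
    · simp [hp, acts, Op.act]
    · simp [acts, Op.act, e1 r hr, h22]
    · simp [acts, Op.act, c₁]
    · simp [acts, Op.act]; omega

/-- The candidate `X / 2 ^ q` is to be tested with `n` samples. -/
structure Candidate (b n q X : ℕ) (m : ℕ → ℕ) (L : ℕ) : Prop where
  env : CircEnv m L b
  samples : m 14 = n
  scale : m 18 = 4 ^ q
  sq : m 25 = X ^ 2
  rest : m 26 = 4 ^ q - 2 * X ^ 2
  le : 2 * X ^ 2 ≤ 4 ^ q

/-- What a test changes in any case. -/
structure Tested (s : St) (T : ℕ) (s' : St) : Prop where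
  frame : ∀ r < 27, r ≠ 22 → s'.mem r = s.mem r
  circuit : s'.circuit = []
  time : s'.time ≤ s.time + T

/-- The time for a test with `r` rounds. -/
def testTime (w n q r : ℕ) : ℕ := 2 * r * (200 * q + 200) + n * (500 * w * (r + 1)) + 100

open Classical in
-- The prediction is computed before the sampling starts, so the verdict is a function of the number
-- of hits, which is binomially distributed.
lemma testProg_bd {b n q X : ℕ} {t : ℝ} (ht : Amplitude O b t) (s : St)
    (hs : Candidate b n q X s.mem O.idx) (hc : s.circuit = []) (V : ℕ → ℝ≥0∞) (Φ : St → ℝ≥0∞)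
    (K : List Prog)
    (hΦ : ∀ h ≤ n, ∀ s', Tested s (testTime (width O.idx b) n q (s.mem 24)) s' →
      s'.mem 22 = (if Passes n h (evalIter X q (2 * s.mem 24)).1 (evalIter X q (2 * s.mem 24)).2.2
        then s.mem 22 else 0) → Φ s' ≤ V h) :
    Bd O Φ K (s.cfg (testProg :: K)) (binE (ENNReal.ofReal (prob (s.mem 24) t))
      (ENNReal.ofReal (1 - prob (s.mem 24) t)) n V) := by
  obtain ⟨s₁, d₁, f₁, e₁, e₁', -, c₁, t₁⟩ := evalProg_det (O := O) hs.le s.tick hs.env.zero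
    hs.env.one hs.scale hs.sq hs.rest
  simp only [St.tick_mem, St.tick_circuit, St.tick_time] at f₁ e₁ e₁' c₁ t₁
  set F := (evalIter X q (2 * s.mem 24)).1
  set D := (evalIter X q (2 * s.mem 24)).2.2
  refine Bd.of_pure (τ := s.tick.cfg (evalProg :: _)) rfl (Bd.det_trans d₁ ?_)
  have d₂ := det_block (O := O) [.const 31 0, .const 32 0, .const 33 0, .add 34 14 6] (by simp)
    s₁.tick
  refine Bd.of_pure (τ := s₁.tick.cfg (block _ :: _)) rfl (Bd.det_trans d₂ ?_)
  set s₂ := acts [.const 31 0, .const 32 0, .const 33 0, .add 34 14 6] s₁.tick with hs₂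
  refine Bd.of_pure (τ := s₂.tick.cfg (.whileDo 34 sampleProg :: _)) rfl ?_
  have f₂ : ∀ r < 30, s₂.mem r = s₁.mem r := by
    intro r hr
    simp [hs₂, acts, Op.act, show r ≠ 31 by omega, show r ≠ 32 by omega, show r ≠ 33 by omega,
      show r ≠ 34 by omega]
  have t₂ : s₂.time = s₁.time + 10 := by simp [hs₂, acts, Op.act]
  have h0 : Sampling s₂.mem n (s₂.time + 1) (500 * width O.idx b * (s.mem 24 + 1)) 0 0 s₂.tick :=
    ⟨le_rfl, fun _ _ => rfl, by simp [hs₂, acts, Op.act], by simp [hs₂, acts, Op.act],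
      by simp [hs₂, acts, Op.act],
      by simp [hs₂, acts, Op.act, f₁, hs.samples, hs.env.zero],
      by simp [hs₂, acts, Op.act, c₁, hc], by simp⟩
  have henv : CircEnv s₂.mem O.idx b := hs.env.congr fun r hr => by
    rw [f₂ r (by omega), f₁ r (by omega)]
  have h24 : s₂.mem 24 = s.mem 24 := by rw [f₂ 24 (by norm_num), f₁ 24 (by norm_num)]
  refine (sampleLoop ht henv h24 V _ _ _ (fun h s' hs' => ?_) n 0 0 _ (by omega) h0).mono
    (le_of_eq (by simp))
  have e28 : s₂.mem 28 = F := by rw [f₂ 28 (by norm_num), e₁]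
  have e29 : s₂.mem 29 = D := by rw [f₂ 29 (by norm_num), e₁']
  obtain ⟨u, du, u22, fu, cu, tu⟩ := compareProg_det (O := O) (n := n) (h := h) (F := F) (D := D)
    s'.tick (by rw [St.tick_mem, hs'.hits, e29]) (by rw [St.tick_mem, hs'.num, e28])
    (by rw [St.tick_mem, hs'.den, e29])
  have f' : ∀ r < 27, s'.mem r = s.mem r := fun r hr => by
    rw [hs'.frame r (by omega), f₂ r (by omega), f₁ r hr]
  refine (du K Φ).mono (hΦ h hs'.le u ⟨fun r hr h22 => ?_, ?_, ?_⟩ ?_)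
  · rw [fu r hr h22, St.tick_mem, f' r hr]
  · rw [cu, St.tick_circuit, hs'.circuit]
  · have := hs'.time
    simp only [St.tick_time] at tu
    unfold testTime
    omega
  · rw [u22, St.tick_mem, f' 22 (by norm_num)]

/-- What a successful test says. -/
structure TestedWell (s : St) (d : ℝ) (s' : St) : Prop where
  passes : |d| ≤ 1 / 512 → s'.mem 22 = s.mem 22
  fails : s'.mem 22 ≠ 0 → s.mem 22 ≠ 0 ∧ |d| ≤ 3 / 512

/-- The probability that a test with `n` samples goes wrong. -/
noncomputable def testErr (n : ℕ) : ℝ≥0∞ := ENNReal.ofReal (2 * Real.exp (-((n : ℝ) / 2 ^ 20)))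

/-- A frequency within `1/512` of the true probability and the acceptance threshold `1/256` give, by
the triangle inequality, acceptance if `|d| ≤ 1/512` and rejection if `|d| > 3/512`. With `ε =
1/512` the Chernoff exponent is `n ε²/4 = n / 2^20`. -/
lemma testProg_spec {b n q X : ℕ} {t : ℝ} (ht : Amplitude O b t) (hn : 0 < n) (s : St)
    (hs : Candidate b n q X s.mem O.idx) (hc : s.circuit = []) :
    Sure O testProg s (Tested s (testTime (width O.idx b) n q (s.mem 24))) ∧
      Likely O testProg s (Tested s (testTime (width O.idx b) n q (s.mem 24)))
        (TestedWell s (prob (s.mem 24) t - prob (s.mem 24) (X / 2 ^ q))) (testErr n) := by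
  have hpq : ENNReal.ofReal (prob (s.mem 24) t) + ENNReal.ofReal (1 - prob (s.mem 24) t) = 1 := by
    rw [← ENNReal.ofReal_add (prob_nonneg _ _) (by linarith [prob_le_one (s.mem 24) t])]
    simp
  refine ⟨fun K Φ B hB => ?_, fun K Φ A B hAB hB hA => ?_⟩
  · exact (testProg_bd ht s hs hc (fun _ => B) Φ K fun h _ s' hs' _ => hB s' hs').mono
      (binE_const hpq n B).le
  · classical
    obtain ⟨hD, hF⟩ := evalIter_prob hs.le (s.mem 24)
    have hn' : (0 : ℝ) < n := by exact_mod_cast hn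
    refine (testProg_bd ht s hs hc
      (fun h => if |(h : ℝ) - n * prob (s.mem 24) t| ≤ n * (1 / 512) then A else B) Φ K
      fun h _ s' hs' h22 => ?_).mono ((binE_le (ε := 1 / 512) (A := A) (B := B) (prob_nonneg _ _)
        (prob_le_one _ _) (by norm_num) (by norm_num) n (fun i _ hi => by rw [if_pos hi])
        fun i _ => ?_).trans (le_of_eq ?_))
    · split_ifs with hh
      · have hh' : |(h : ℝ) / n - prob (s.mem 24) t| ≤ 1 / 512 := by
          have e : (h : ℝ) / n - prob (s.mem 24) t = (h - n * prob (s.mem 24) t) / n := by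
            field_simp
          rw [e, abs_div, abs_of_pos hn', div_le_iff₀ hn']
          linarith
        rw [passes_iff hn hD, hF] at h22
        refine hA s' hs' ⟨fun hd => ?_, fun h0 => ?_⟩
        · rw [if_pos] at h22
          · exact h22
          · rw [abs_le] at hd hh' ⊢
            constructor <;> linarith [hd.1, hd.2, hh'.1, hh'.2]
        · by_cases hp : |(h : ℝ) / n - prob (s.mem 24) (X / 2 ^ q)| ≤ 1 / 256
          · rw [if_pos hp] at h22
            refine ⟨h22 ▸ h0, ?_⟩
            rw [abs_le] at hp hh' ⊢
            constructor <;> linarith [hp.1, hp.2, hh'.1, hh'.2]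
          · rw [if_neg hp] at h22
            exact absurd h22 h0
      · exact hB s' hs'
    · split_ifs
      · exact hAB
      · exact le_rfl
    · unfold testErr
      congr 4
      ring_nf

/-! ### Composition of specifications -/

/-- From `s` the program `P` always ends in a state that satisfies `S`, and if `C` holds, with
probability at least `1 - ε` it ends in one that also satisfies `G`. -/
def Spec (O : Oracle) (P : Prog) (s : St) (S : St → Prop) (C : Prop) (G : St → Prop)
    (ε : ℝ≥0∞) : Prop :=
  Sure O P s S ∧ (C → Likely O P s S G ε)

lemma Spec.det_seq {P Q : Prog} {s s' : St} {S G : St → Prop} {C : Prop} {ε : ℝ≥0∞}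
    (h : Det O P s.tick s') (h' : Spec O Q s' S C G ε) : Spec O (.seq P Q) s S C G ε :=
  ⟨fun K Φ B hB => Bd.of_pure (τ := s.tick.cfg (P :: Q :: K)) rfl
      (Bd.det_trans h (h'.1 K Φ B hB)),
    fun hC K Φ A B hAB hB hA => Bd.of_pure (τ := s.tick.cfg (P :: Q :: K)) rfl
      (Bd.det_trans h (h'.2 hC K Φ A B hAB hB hA))⟩

lemma Spec.seq_det {P Q : Prog} {s : St} {S G S' G' : St → Prop} {C : Prop} {ε : ℝ≥0∞}
    (h : Spec O P s.tick S C G ε)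
    (h' : ∀ s₁, S s₁ → ∃ s', Det O Q s₁ s' ∧ S' s' ∧ (C → G s₁ → G' s')) :
    Spec O (.seq P Q) s S' C G' ε := by
  refine ⟨fun K Φ B hB => Bd.of_pure (τ := s.tick.cfg (P :: Q :: K)) rfl ?_,
    fun hC K Φ A B hAB hB hA => Bd.of_pure (τ := s.tick.cfg (P :: Q :: K)) rfl ?_⟩
  · refine h.1.trans fun s₁ hs₁ => ?_
    obtain ⟨s', d, hS, -⟩ := h' s₁ hs₁
    exact (d K Φ).mono (hB s' hS)
  · refine (h.2 hC).trans (fun s₁ hs₁ => ?_) fun s₁ hs₁ hg => ?_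
    · obtain ⟨s', d, hS, -⟩ := h' s₁ hs₁
      exact (d K Φ).mono (hB s' hS)
    · obtain ⟨s', d, hS, hG⟩ := h' s₁ hs₁
      exact (d K Φ).mono (hA s' hS (hG hC hg))

lemma Spec.while {P : Prog} {r N : ℕ} {I G : ℕ → St → Prop} {ε : ℝ≥0∞}
    (hstep : ∀ i < N, ∀ s, I i s → s.mem r ≠ 0 ∧ Spec O P s.tick (I (i + 1)) (G i s) (G (i + 1)) ε)
    (hend : ∀ s, I N s → s.mem r = 0) {s : St} (hs : I 0 s) :
    Spec O (.whileDo r P) s (fun s => ∃ s₀, I N s₀ ∧ s = s₀.tick) (G 0 s)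
      (fun s => ∃ s₀, I N s₀ ∧ G N s₀ ∧ s = s₀.tick) (N * ε) :=
  Trip.while (fun i hi s hs => (hstep i hi s hs).1) (fun i hi s hs => (hstep i hi s hs).2) hend s hs

lemma Spec.mono {P : Prog} {s : St} {S G S' G' : St → Prop} {C C' : Prop} {ε : ℝ≥0∞}
    (h : Spec O P s S C G ε) (hS : ∀ s, S s → S' s) (hC : C' → C) 
    (hG : ∀ s, S s → C' → G s → G' s) :
    Spec O P s S' C' G' ε :=
  ⟨fun K Φ B hB => h.1 K Φ B fun s' hs' => hB s' (hS s' hs'),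
    fun hc K Φ A B hAB hB hA => h.2 (hC hc) K Φ A B hAB (fun s' hs' => hB s' (hS s' hs'))
      fun s' hs' hg => hA s' (hS s' hs') (hG s' hs' hc hg)⟩

/-! ### Testing a candidate -/

/-- Test the candidate for all numbers of rounds of a stage. -/
def roundsProg : Prog :=
  .seq (block [.add 23 17 17])
    (.whileDo 23 (.seq (block [.half 37 23, .add 24 17 37]) (.seq testProg (block [.half 23 23]))))

lemma testTime_mono {w n q r r' : ℕ} (h : r ≤ r') : testTime w n q r ≤ testTime w n q r' := by
  unfold testTime
  gcongr

/-- What `roundsProg` changes in any case. -/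
structure Checked (s : St) (T : ℕ) (s' : St) : Prop where
  frame : ∀ r < 27, r < 22 ∨ 24 < r → s'.mem r = s.mem r
  circuit : s'.circuit = []
  time : s'.time ≤ s.time + T

/-- What is known after the tests for the first `j` numbers of rounds. -/
structure CheckedWell (s : St) (d : ℕ → ℝ) (k j : ℕ) (s' : St) : Prop where
  passes : (∀ i ≤ k, |d i| ≤ 1 / 512) → s'.mem 22 = s.mem 22
  fails : s'.mem 22 ≠ 0 → s.mem 22 ≠ 0 ∧ ∀ i ≤ k, k < i + j → |d i| ≤ 3 / 512

lemma Candidate.congr {b n q X L : ℕ} {m m' : ℕ → ℕ} (h : Candidate b n q X m L)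
    (hm : ∀ r < 27, r < 22 ∨ 24 < r → m' r = m r) : Candidate b n q X m' L :=
  ⟨h.env.congr fun r hr => hm r (by omega) (by omega),
    by rw [hm 14 (by norm_num) (by norm_num), h.samples],
    by rw [hm 18 (by norm_num) (by norm_num), h.scale],
    by rw [hm 25 (by norm_num) (by norm_num), h.sq],
    by rw [hm 26 (by norm_num) (by norm_num), h.rest], h.le⟩

/-- A union bound over the `k+1` numbers of rounds of a stage. All are tested even after a
rejection, which keeps the length of the loop fixed. -/
lemma roundsProg_spec {b n q X k T : ℕ} {t : ℝ} (ht : Amplitude O b t) (hn : 0 < n) (s : St)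
    (hs : Candidate b n q X s.mem O.idx) (hk : 1 ≤ k) (h17 : s.mem 17 = 2 ^ (k - 1))
    (hc : s.circuit = []) (hT : testTime (width O.idx b) n q (2 ^ k) ≤ T) :
    Spec O roundsProg s (Checked s ((k + 1) * (T + 20) + 20)) True
      (CheckedWell s (fun i => prob (rounds k i) t - prob (rounds k i) (X / 2 ^ q)) k (k + 1))
      ((k + 1 : ℕ) * testErr n) := by
  set d : ℕ → ℝ := fun i => prob (rounds k i) t - prob (rounds k i) (X / 2 ^ q) with hd
  refine Spec.det_seq (det_block _ (by simp) _) ?_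
  set s₁ := acts [.add 23 17 17] s.tick with hs₁
  have hk2 : 2 ^ (k - 1) + 2 ^ (k - 1) = 2 ^ k := by
    rw [← two_mul, ← pow_succ']; congr 1; omega
  have h0 : s₁.time = s.time + 4 := by simp [hs₁, acts, Op.act]
  refine (Spec.while (N := k + 1) (ε := testErr n)
    -- Register `23` runs through `2^k, …, 2, 1, 0`, and round `j` treats `i = k - j`; the
    -- truncation of `1/2` ends the loop and yields `rounds k 0`.
    (I := fun j s' => Checked s (4 + j * (T + 20)) s' ∧ s'.mem 23 = 2 ^ (k + 1 - j) / 2)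
    (G := CheckedWell s d k) (fun j hj u ⟨hu, h23⟩ => ?_) (fun u ⟨_, h23⟩ => by simp [h23])
    (s := s₁) ⟨⟨fun r hr hr' => ?_, by simp [hs₁, acts, Op.act, hc], by omega⟩, ?_⟩).mono ?_ ?_ ?_
  · have hpow : 2 ^ (k + 1 - j) / 2 = 2 ^ (k - j) := by
      rw [show k + 1 - j = k - j + 1 by omega, pow_succ]; simp
    refine ⟨by rw [h23, hpow]; positivity, ?_⟩
    refine Spec.det_seq (det_block _ (by simp) _) ?_
    set v := acts [.half 37 23, .add 24 17 37] u.tick.tick with hv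
    have fv : ∀ r < 27, r ≠ 24 → v.mem r = u.mem r := by
      intro r hr hr'
      simp [hv, acts, Op.act, hr', show r ≠ 37 by omega]
    have tv : v.time = u.time + 7 := by simp [hv, acts, Op.act]
    have e24 : v.mem 24 = rounds k (k - j) := by
      simp [hv, acts, Op.act, h23, hpow, hu.frame 17, h17, rounds]
    have hr2 : rounds k (k - j) ≤ 2 ^ k := by
      have : 2 ^ (k - j) ≤ 2 ^ k := Nat.pow_le_pow_right (by norm_num) (by omega)
      unfold rounds
      omega
    have hcand : Candidate b n q X v.mem O.idx := hs.congr fun r hr hr' => by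
      rw [fv r hr (by omega), hu.frame r hr hr']
    have hsp := testProg_spec ht hn v.tick hcand
      (by simp [hv, acts, Op.act, hu.circuit])
    refine Spec.seq_det (S := Tested v.tick (testTime (width O.idx b) n q (v.mem 24)))
      (G := TestedWell v.tick (d (k - j)))
      ⟨hsp.1, fun _ => by have := hsp.2; simp only [St.tick_mem, e24] at this ⊢; exact this⟩
      fun v' hv' => ⟨_, det_block _ (by simp) _, ⟨⟨fun r hr hr' => ?_, ?_, ?_⟩, ?_⟩, fun hg hw => ?_⟩
    · simp [acts, Op.act, show r ≠ 23 by omega]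
      rw [hv'.frame r hr (by omega), St.tick_mem, fv r hr (by omega), hu.frame r hr hr']
    · simp [acts, Op.act, hv'.circuit]
    · have h1 := hv'.time
      have h2 := hu.time
      have h3 := testTime_mono (w := width O.idx b) (n := n) (q := q) hr2
      rw [e24] at h1
      simp [acts, Op.act] at h1 ⊢
      rw [add_mul]
      omega
    · have : v'.mem 23 = 2 ^ (k - j) := by
        rw [hv'.frame 23 (by norm_num) (by norm_num), St.tick_mem, fv 23 (by norm_num) (by norm_num),
          h23, hpow]
      simp [acts, Op.act, this]
    · have e22 : v.tick.mem 22 = u.mem 22 := by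
        rw [St.tick_mem, fv 22 (by norm_num) (by norm_num)]
      have e : (acts [.half 23 23] v').mem 22 = v'.mem 22 := by simp [acts, Op.act]
      refine ⟨fun hp => ?_, fun hp => ?_⟩
      · rw [e, hw.passes (hp _ (by omega)), e22, hg.passes hp]
      · rw [e] at hp
        obtain ⟨h1, h2⟩ := hw.fails hp
        rw [e22] at h1
        obtain ⟨h3, h4⟩ := hg.fails h1
        refine ⟨h3, fun i hi hij => ?_⟩
        rcases Nat.lt_or_ge k (i + j) with h | h
        · exact h4 i hi h
        · rw [show i = k - j by omega]; exact h2
  · simp [hs₁, acts, Op.act, show r ≠ 23 by omega]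
  · simp [hs₁, acts, Op.act, h17, hk2]
    rw [pow_succ]; simp
  · rintro _ ⟨u, ⟨hu, -⟩, rfl⟩
    exact ⟨hu.frame, hu.circuit, by have := hu.time; rw [St.tick_time]; omega⟩
  · intro _
    have e : s₁.mem 22 = s.mem 22 := by simp [hs₁, acts, Op.act]
    exact ⟨fun _ => e, fun h => ⟨by rwa [e] at h, fun i hi hij => absurd hij (by omega)⟩⟩
  · rintro _ - - ⟨u, -, hg, rfl⟩
    exact ⟨hg.passes, hg.fails⟩

/-! ### The search for the amplitude -/

/-- Test the candidate in register `19`; if it passes, keep it. -/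
def candProg : Prog :=
  .seq (block [.const 22 1]) (.seq (mulProg 25 19 19) (.seq (block [.add 37 25 25, .sub 26 18 37])
    (.seq roundsProg (.seq (.ifElse 22 (block [.add 21 19 6]) .skip)
      (block [.add 19 19 7, .sub 20 20 7])))))

/-- The registers of the stage `k`. -/
structure StageEnv (b n k : ℕ) (m : ℕ → ℕ) (L : ℕ) : Prop where
  env : CircEnv m L b
  samples : m 14 = n
  half : m 17 = 2 ^ (k - 1)
  scale : m 18 = 4 ^ (k + 11)

/-- After `i` candidates. -/
structure Searching (m : ℕ → ℕ) (B k T c i : ℕ) (s : St) : Prop where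
  frame : ∀ r < 19, s.mem r = m r
  cand : s.mem 19 = B + i
  rest : s.mem 20 + i = 2049
  bound : s.mem 21 + 1024 ≤ 2 ^ (k + 10)
  circuit : s.circuit = []
  time : s.time ≤ T + i * c

lemma two_mul_sq_le {X q : ℕ} (h : 2 * X ≤ 2 ^ q) : 2 * X ^ 2 ≤ 4 ^ q := by
  have h1 : (2 * X) ^ 2 ≤ (2 ^ q) ^ 2 := Nat.pow_le_pow_left h 2
  rw [← pow_mul, mul_comm q, pow_mul] at h1
  norm_num at h1
  nlinarith

/-- In units of the mesh: a candidate at distance at most `1` passes and is stored, and any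
candidate that passes is at distance at most `512`. A stored candidate can thus only be replaced by
one that is good enough. The bound on `B` keeps candidates below `1/2` on every run, so that the
evaluation is exact and the sure assertions do not depend on luck. -/
lemma candProg_spec {m : ℕ → ℕ} {b n k B T c T' i : ℕ} {t : ℝ} (ht : Amplitude O b t)
    (hn : 0 < n) (hk : 2 ≤ k) (hm : StageEnv b n k m O.idx) (hB : B + 3072 ≤ 2 ^ (k + 10))
    (hi : i < 2049) (hT : testTime (width O.idx b) n (k + 11) (2 ^ k) ≤ T)
    (hc : (k + 1) * (T + 20) + 20 * (k + 11) + 100 ≤ c) (s : St)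
    (hs : Searching m B k T' c i s) :
    Spec O candProg s.tick (Searching m B k T' c (i + 1))
      (|t * 2 ^ (k + 11) - ((B + i : ℕ) : ℝ)| ≤ 2048)
      (fun s' => (|t * 2 ^ (k + 11) - ((B + i : ℕ) : ℝ)| ≤ 1 ∨
          |t * 2 ^ (k + 11) - s.mem 21| ≤ 512 → |t * 2 ^ (k + 11) - s'.mem 21| ≤ 512))
      ((k + 1 : ℕ) * testErr n) := by
  set X := B + i with hX
  have hX2 : 2 * X ≤ 2 ^ (k + 11) := by rw [pow_succ]; omega
  have hpos := Nat.two_pow_pos (k + 11)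
  have e6 : s.mem 6 = 0 := by rw [hs.frame 6 (by norm_num), hm.env.zero]
  have e7 : s.mem 7 = 1 := by rw [hs.frame 7 (by norm_num), hm.env.one]
  have e18 : s.mem 18 = 4 ^ (k + 11) := by rw [hs.frame 18 (by norm_num), hm.scale]
  obtain ⟨s₁, d₁, m₁, c₁, -, t₁⟩ := Calc.block (O := O) (l := [.const 22 1]) (by simp [Op.plain])
    s.mem s.tick.tick (fun _ _ => rfl)
  obtain ⟨s₂, d₂, m₂, c₂, -, t₂⟩ := mulProg_calc (O := O) (d := 25) (a := 19) (c := 19)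
    (N := k + 11) (m := s₁.mem) (by norm_num) (by norm_num)
    (by rw [m₁ 6 (by norm_num)]; simp [Op.memAct, e6])
    (by rw [m₁ 19 (by norm_num)]; simp [Op.memAct, hs.cand]; rw [← hX]; omega) s₁.tick (fun _ _ => rfl)
  obtain ⟨s₃, d₃, m₃, c₃, -, t₃⟩ := Calc.block (O := O) (l := [.add 37 25 25, .sub 26 18 37])
    (by simp [Op.plain]) s₂.mem s₂.tick (fun _ _ => rfl)
  have f₃ : ∀ r < 25, r ≠ 22 → s₃.mem r = s.mem r := by
    intro r hr hr'
    rw [m₃ r (by omega)]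
    simp [Op.memAct, show r ≠ 26 by omega, show r ≠ 37 by omega]
    rw [m₂ r (by omega)]
    simp [show r ≠ 25 by omega]
    rw [m₁ r (by omega)]
    simp [Op.memAct, hr']
  have e22 : s₃.mem 22 = 1 := by
    rw [m₃ 22 (by norm_num)]
    simp [Op.memAct]
    rw [m₂ 22 (by norm_num)]
    simp
    rw [m₁ 22 (by norm_num)]
    simp [Op.memAct]
  have e25 : s₂.mem 25 = X ^ 2 := by
    rw [m₂ 25 (by norm_num)]
    simp
    rw [m₁ 19 (by norm_num)]
    simp [Op.memAct, hs.cand, sq, hX]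
  have e18' : s₂.mem 18 = 4 ^ (k + 11) := by
    rw [m₂ 18 (by norm_num)]
    simp
    rw [m₁ 18 (by norm_num)]
    simp [Op.memAct, e18]
  have hcand : Candidate b n (k + 11) X s₃.mem O.idx := by
    refine ⟨hm.env.congr fun r hr => ?_, ?_, ?_, ?_, ?_, two_mul_sq_le hX2⟩
    · rw [f₃ r (by omega) (by omega), hs.frame r (by omega)]
    · rw [f₃ 14 (by norm_num) (by norm_num), hs.frame 14 (by norm_num), hm.samples]
    · rw [f₃ 18 (by norm_num) (by norm_num), e18]
    · rw [m₃ 25 (by norm_num)]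
      simp [Op.memAct, e25]
    · rw [m₃ 26 (by norm_num)]
      simp [Op.memAct, e25, e18', two_mul]
  have h17 : s₃.mem 17 = 2 ^ (k - 1) := by
    rw [f₃ 17 (by norm_num) (by norm_num), hs.frame 17 (by norm_num), hm.half]
  have hsp := roundsProg_spec (k := k) ht hn s₃.tick hcand (by omega) h17
    (by simp [c₃, c₂, c₁, hs.circuit]) hT
  simp only [List.length_cons, List.length_nil, St.tick_time] at t₁ t₂ t₃
  refine Spec.det_seq d₁ (Spec.det_seq d₂ (Spec.det_seq d₃ ?_))
  refine Spec.seq_det (hsp.mono (fun _ h => h) (fun _ => trivial) fun _ _ _ h => h) fun u hu => ?_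
  obtain ⟨v, dv, mv, v21, cv, tv⟩ : ∃ v, Det O (.ifElse 22 (block [.add 21 19 6]) .skip) u.tick v ∧
      (∀ r < 21, v.mem r = u.mem r) ∧
      v.mem 21 = (if u.mem 22 = 0 then s.mem 21 else X) ∧ v.circuit = u.circuit ∧
      v.time ≤ u.time + 10 := by
    have f : ∀ r < 22, u.mem r = s.mem r := fun r hr => by
      rw [hu.frame r (by omega) (by omega)]
      exact f₃ r (by omega) (by omega)
    by_cases h : u.mem 22 = 0
    · exact ⟨_, Det.ite_neg h (det_skip _), fun _ _ => rfl, by simp [h, f 21], rfl, by simp⟩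
    · refine ⟨_, Det.ite_pos h (det_block _ (by simp) _), fun r hr => ?_, ?_, ?_, ?_⟩
      · simp [acts, Op.act, show r ≠ 21 by omega]
      · simp [acts, Op.act, h, f 19, f 6, e6, hs.cand, hX]
      · simp [acts, Op.act]
      · simp [acts, Op.act]
  have fv : ∀ r < 21, v.mem r = s.mem r := fun r hr => by
    rw [mv r hr, hu.frame r (by omega) (by omega)]
    exact f₃ r (by omega) (by omega)
  refine ⟨_, dv.seq (det_block _ (by simp) v), ⟨fun r hr => ?_, ?_, ?_, ?_, ?_, ?_⟩, ?_⟩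
  · simp [acts, Op.act, show r ≠ 19 by omega, show r ≠ 20 by omega]
    rw [fv r (by omega), hs.frame r hr]
  · simp [acts, Op.act, fv, hs.cand, e7, add_assoc]
  · have := hs.rest
    simp [acts, Op.act, fv, e7]
    omega
  · simp [acts, Op.act, v21]
    split_ifs
    · exact hs.bound
    · omega
  · simp [acts, Op.act, cv, hu.circuit]
  · have h1 := hu.time
    have h2 := hs.time
    simp [acts, Op.act] at h1 ⊢
    rw [add_mul]
    omega
  · intro hC hG hor
    have ht0 := ht.pos.le
    have ht1 := ht.le
    have hP : (0 : ℝ) < 2 ^ k := by positivity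
    have hk4 : (4 : ℝ) ≤ 2 ^ k := by
      calc (4 : ℝ) = 2 ^ 2 := by norm_num
        _ ≤ 2 ^ k := pow_le_pow_right₀ (by norm_num) hk
    have e11 : (2 : ℝ) ^ (k + 11) = 2 ^ k * 2048 := by rw [pow_add]; norm_num
    have habs := abs_sub_div_mul (t := t) (c := X) (q := k + 11)
    have hclose : |t - X / 2 ^ (k + 11)| * 2 ^ k ≤ 1 := by
      rw [← habs, e11] at hC
      rw [e11]
      linarith
    -- `t ≤ 1/8`, and `k ≥ 2` makes the candidate differ from it by at most `1/4`.
    have ht' : (X : ℝ) / 2 ^ (k + 11) ≤ 3 / 8 := by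
      have h1 : |t - X / 2 ^ (k + 11)| ≤ 1 / 4 := by
        by_contra! h
        nlinarith
      have := (abs_le.1 h1).1
      linarith
    have e : (acts [.add 19 19 7, .sub 20 20 7] v).mem 21 = v.mem 21 := by simp [acts, Op.act]
    rw [e, v21]
    split_ifs with h0
    · refine hor.resolve_left fun h1 => ?_
      have := hG.passes fun j hj => prob_close hk hj ht0 (by linarith) (by positivity) ht'
        (by rw [habs]; exact h1)
      rw [h0, St.tick_mem, e22] at this
      exact absurd this (by norm_num)
    · have h1 := close_of_prob hk ht0 (by linarith) (by positivity) ht' hclose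
        fun j hj => (hG.fails h0).2 j hj (by omega)
      rw [← habs]
      rw [e11] at h1 ⊢
      linarith

/-- One stage of the search: all candidates at the next precision. -/
def stageProg : Prog :=
  .seq (block [.add 19 16 16, .const 37 1024, .sub 19 19 37, .const 20 2049, .const 21 0])
    (.seq (.whileDo 20 candProg)
      (block [.add 16 21 6, .add 17 17 17, .add 18 18 18, .add 18 18 18, .sub 15 15 7]))

/-- The search after `j` of `N` stages. -/
structure Located (m : ℕ → ℕ) (N T c j : ℕ) (s : St) : Prop where
  frame : ∀ r < 15, s.mem r = m r
  rest : s.mem 15 = N - j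
  bound : s.mem 16 + 1024 ≤ 2 ^ (j + 11)
  half : s.mem 17 = 2 ^ (j + 1)
  scale : s.mem 18 = 4 ^ (j + 13)
  circuit : s.circuit = []
  time : s.time ≤ T + j * c

/-- With `k = j + 2`: an error of `512` units of the old mesh is `1024` of the new one, so the
window of 2049 candidates from `2X - 1024` on contains a neighbour of `t`; the error after the stage
is again at most `512` units. -/
lemma stageProg_spec {m : ℕ → ℕ} {b n N T c T' j : ℕ} {t : ℝ} (ht : Amplitude O b t)
    (hn : 0 < n) (hm : CircEnv m O.idx b) (h14 : m 14 = n)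
    (hT : testTime (width O.idx b) n (j + 13) (2 ^ (j + 2)) ≤ T)
    (hc : 2049 * ((j + 3) * (T + 20) + 20 * (j + 13) + 101) + 100 ≤ c) (s : St)
    (hs : Located m N T' c j s) :
    Spec O stageProg s.tick (Located m N T' c (j + 1))
      (|t * 2 ^ (j + 12) - s.mem 16| ≤ 512)
      (fun s' => |t * 2 ^ (j + 1 + 12) - s'.mem 16| ≤ 512)
      (2049 * ((j + 3 : ℕ) * testErr n)) := by
  have ht0 := ht.pos.le
  set X := s.mem 16 with hX
  set l : List Op := [.add 19 16 16, .const 37 1024, .sub 19 19 37, .const 20 2049, .const 21 0]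
    with hl
  obtain ⟨s₁, d₁, m₁, c₁, -, t₁⟩ := Calc.block (O := O) (l := l) (by simp [hl, Op.plain])
    s.mem s.tick.tick (fun _ _ => rfl)
  have f₁ : ∀ r < 19, s₁.mem r = s.mem r := by
    intro r hr
    rw [m₁ r (by omega)]
    simp [hl, Op.memAct, show r ≠ 19 by omega, show r ≠ 20 by omega, show r ≠ 21 by omega,
      show r ≠ 37 by omega]
  have e19 : s₁.mem 19 = 2 * X - 1024 := by
    rw [m₁ 19 (by norm_num)]
    simp [hl, Op.memAct, hX, two_mul]
  have e20 : s₁.mem 20 = 2049 := by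
    rw [m₁ 20 (by norm_num)]
    simp [hl, Op.memAct]
  have e21 : s₁.mem 21 = 0 := by
    rw [m₁ 21 (by norm_num)]
    simp [hl, Op.memAct]
  simp only [hl, List.length_cons, List.length_nil, St.tick_time] at t₁
  have hbd := hs.bound
  have hp : 2 ^ (j + 2 + 10) = 2 * 2 ^ (j + 11) := by rw [← pow_succ']
  have hp1 : 2048 ≤ 2 ^ (j + 11) := by
    calc 2048 = 2 ^ 11 := by norm_num
      _ ≤ 2 ^ (j + 11) := Nat.pow_le_pow_right (by norm_num) (by omega)
  have hstage : StageEnv b n (j + 2) s₁.mem O.idx :=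
    ⟨hm.congr fun r hr => by rw [f₁ r (by omega), hs.frame r (by omega)],
      by rw [f₁ 14 (by norm_num), hs.frame 14 (by norm_num), h14],
      by rw [f₁ 17 (by norm_num), hs.half]; rfl,
      by rw [f₁ 18 (by norm_num), hs.scale]⟩
  set c' := (j + 3) * (T + 20) + 20 * (j + 13) + 100 with hc'
  set B := 2 * X - 1024 with hB
  have hsp := Spec.while (O := O) (P := candProg) (r := 20) (N := 2049)
    (ε := (j + 2 + 1 : ℕ) * testErr n)
    (I := Searching s₁.mem B (j + 2) (s₁.time + 1) c')
    -- Once a neighbour of `t` has been tested, the stored candidate is good, and remains so.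
    (G := fun i u => |t * 2 ^ (j + 12) - X| ≤ 512 ∧
      ((∃ i' < i, |t * 2 ^ (j + 2 + 11) - ((B + i' : ℕ) : ℝ)| ≤ 1) →
        |t * 2 ^ (j + 2 + 11) - u.mem 21| ≤ 512))
    (fun i hi u hu => ⟨by have := hu.rest; omega, ?_⟩) (fun u hu => by have := hu.rest; omega)
    (s := s₁.tick)
    ⟨fun _ _ => rfl, by rw [St.tick_mem, e19, add_zero], by rw [St.tick_mem, e20], by rw [St.tick_mem, e21, hp]; omega,
      by rw [St.tick_circuit, c₁]; exact hs.circuit, by simp⟩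
  · refine Spec.det_seq d₁ (Spec.seq_det (hsp.mono (fun _ h => h) (fun h => ⟨h, ?_⟩)
      fun _ _ _ h => h) ?_)
    · rintro ⟨i', h, -⟩
      omega
    · rintro _ ⟨u, hu, rfl⟩
      have f : ∀ r < 19, u.mem r = s.mem r := fun r hr => by rw [hu.frame r hr, f₁ r hr]
      have e6 : s.mem 6 = 0 := by rw [hs.frame 6 (by norm_num), hm.zero]
      have e7 : s.mem 7 = 1 := by rw [hs.frame 7 (by norm_num), hm.one]
      set l' : List Op := [.add 16 21 6, .add 17 17 17, .add 18 18 18, .add 18 18 18, .sub 15 15 7]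
        with hl'
      have e16 : (acts l' u.tick).mem 16 = u.mem 21 := by
        simp [hl', acts, Op.act, f, e6]
      refine ⟨acts l' u.tick, det_block _ (by simp [hl']) _, ⟨fun r hr => ?_, ?_, ?_, ?_, ?_, ?_, ?_⟩,
        ?_⟩
      · simp [hl', acts, Op.act, show r ≠ 15 by omega, show r ≠ 16 by omega, show r ≠ 17 by omega,
          show r ≠ 18 by omega]
        rw [f r (by omega), hs.frame r hr]
      · simp [hl', acts, Op.act, f, e7, hs.rest]
        omega
      · rw [e16]
        exact hu.bound
      · simp [hl', acts, Op.act, f, hs.half]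
        ring
      · simp [hl', acts, Op.act, f, hs.scale]
        ring
      · simp [hl', acts, Op.act, hu.circuit]
      · have h1 := hu.time
        have h2 := hs.time
        simp [hl', acts, Op.act]
        rw [add_mul]
        omega
      · rintro hC ⟨u', hu', ⟨-, hg⟩, he⟩
        rw [e16]
        have e : u.mem = u'.mem := by simpa using congrArg St.mem he
        rw [e]
        obtain ⟨i, hi, h⟩ := exists_candidate (X := X) (k := j + 2) ht0 hC
        exact hg ⟨i, by omega, h⟩
  · refine (candProg_spec ht hn (by omega) hstage (by rw [hp]; omega) hi hT le_rfl u hu).mono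
      (fun _ h => h) (fun h => ?_) fun u' hu' hC h => ?_
    · exact candidate_close ht0 h.1 (by omega) (by omega)
    · refine ⟨hC.1, fun ⟨i', hi', h1⟩ => h ?_⟩
      rcases Nat.lt_succ_iff_lt_or_eq.1 hi' with h2 | rfl
      · exact Or.inr (hC.2 ⟨i', h2, h1⟩)
      · exact Or.inl h1

/-- The search for the amplitude, in as many stages as register `15` says. -/
def searchProg : Prog :=
  .seq (block [.const 16 0, .const 17 2, .const 18 67108864]) (.whileDo 15 stageProg)

lemma Spec.mono_err {P : Prog} {s : St} {S G : St → Prop} {C : Prop} {ε ε' : ℝ≥0∞}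
    (h : Spec O P s S C G ε) (hε : ε ≤ ε') : Spec O P s S C G ε' :=
  ⟨h.1, fun hC K Φ A B hAB hB hA => (h.2 hC K Φ A B hAB hB hA).mono (by gcongr)⟩

/-- A bound for the time of a stage, if there are `N` stages. -/
def stageTime (w n N : ℕ) : ℕ :=
  2049 * ((N + 3) * (testTime w n (N + 13) (2 ^ (N + 2)) + 20) + 20 * (N + 13) + 101) + 100

lemma testTime_mono' {w n q q' r r' : ℕ} (h : r ≤ r') (hq : q ≤ q') :
    testTime w n q r ≤ testTime w n q' r' := by
  unfold testTime
  gcongr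

/-- The error probabilities of the stages are bounded by the one with the largest number of tests.
The start value `67108864` of the scale is `4^13`. -/
lemma searchProg_spec {b n N : ℕ} {t : ℝ} (ht : Amplitude O b t) (hn : 0 < n) (s : St)
    (hm : CircEnv s.mem O.idx b) (h14 : s.mem 14 = n) (h15 : s.mem 15 = N)
    (hc : s.circuit = []) :
    Spec O searchProg s
      (fun s' => Located s.mem N (s.time + 10) (stageTime (width O.idx b) n N) N s') True
      (fun s' => |t * 2 ^ (N + 12) - s'.mem 16| ≤ 512)
      (N * (2049 * ((N + 3 : ℕ) * testErr n))) := by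
  have d := det_block (O := O) [.const 16 0, .const 17 2, .const 18 67108864] (by simp) s.tick
  set s₁ := acts [.const 16 0, .const 17 2, .const 18 67108864] s.tick with hs₁
  have t₁ : s₁.time = s.time + 8 := by simp [hs₁, acts, Op.act]
  have h0 : Located s.mem N (s.time + 8) (stageTime (width O.idx b) n N) 0 s₁ :=
    ⟨fun r hr => by
        simp [hs₁, acts, Op.act, show r ≠ 16 by omega, show r ≠ 17 by omega,
          show r ≠ 18 by omega],
      by simp [hs₁, acts, Op.act, h15], by simp [hs₁, acts, Op.act], by simp [hs₁, acts, Op.act],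
      by simp [hs₁, acts, Op.act], by simp [hs₁, acts, Op.act, hc], by omega⟩
  refine Spec.det_seq d ((Spec.while (N := N)
    (ε := 2049 * ((N + 3 : ℕ) * testErr n))
    (I := fun j s' => Located s.mem N (s.time + 8) (stageTime (width O.idx b) n N) j s')
    (G := fun j s' => |t * 2 ^ (j + 12) - s'.mem 16| ≤ 512) (fun j hj u hu => ⟨?_, ?_⟩)
    (fun u hu => by rw [hu.rest]; omega) h0).mono ?_ ?_ ?_)
  · rw [hu.rest]; omega
  · refine (stageProg_spec ht hn hm h14 (T := testTime (width O.idx b) n (N + 13) (2 ^ (N + 2)))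
      (testTime_mono' (Nat.pow_le_pow_right (by norm_num) (by omega)) (by omega))
      ?_ u hu).mono_err ?_
    · unfold stageTime
      gcongr
    · gcongr
  · rintro _ ⟨u, hu, rfl⟩
    refine ⟨hu.frame, hu.rest, hu.bound, hu.half, hu.scale, hu.circuit, ?_⟩
    have := hu.time
    rw [St.tick_time]
    omega
  · intro _
    -- The search starts from `X = 0`, which is within `512` units of `2^-12` because `t ≤ 1/8`.
    have e : s₁.mem 16 = 0 := by simp [hs₁, acts, Op.act]
    have h0 := ht.pos
    have h1 := ht.le
    rw [e, abs_of_nonneg (by simp; linarith)]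
    norm_num
    linarith
  · rintro _ - - ⟨u, -, hg, rfl⟩
    exact hg

/-! ### Initialization and output -/

lemma Calc.congr {P : Prog} {m m' m₁ m₁' : ℕ → ℕ} {T T' : ℕ} (h : Calc O P m m' T)
    (h1 : ∀ r < 60, m₁ r = m r) (h2 : ∀ r < 60, m' r = m₁' r) (hT : T ≤ T') :
    Calc O P m₁ m₁' T' := by
  intro s hs
  obtain ⟨s', d, hm, hc, ho, ht⟩ := h s fun r hr => (hs r hr).trans (h1 r hr)
  exact ⟨s', d, fun r hr => (hm r hr).trans (h2 r hr), hc, ho, by omega⟩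

lemma Calc.while {P : Prog} {M : ℕ → ℕ → ℕ} {r N c : ℕ} (hr : r < 60)
    (h : ∀ i < N, M i r ≠ 0 ∧ Calc O P (M i) (M (i + 1)) c) (hN : M N r = 0) :
    Calc O (.whileDo r P) (M 0) (M N) (N * (c + 1) + 1) := by
  intro s hs
  obtain ⟨s', d, ⟨h1, h2, h3⟩, t⟩ := Det.while_inv (O := O) (P := P) (r := r) (N := N) (c := c + 1)
    (fun i s' => (∀ r < 60, s'.mem r = M i r) ∧ s'.circuit = s.circuit ∧ s'.outcome = s.outcome)
    (fun i hi u ⟨h1, h2, h3⟩ => by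
      obtain ⟨h4, h5⟩ := h i hi
      obtain ⟨u', d, h6, h7, h8, h9⟩ := h5 u.tick h1
      refine ⟨by rwa [h1 r hr], u', d, ⟨h6, h7.trans h2, h8.trans h3⟩, ?_⟩
      rw [St.tick_time] at h9
      omega)
    (fun u ⟨h1, h2, h3⟩ => ⟨by rw [h1 r hr, hN], h1, h2, h3⟩) (s := s) ⟨hs, rfl, rfl⟩
  exact ⟨s', d, h1, h2, h3, t.trans (by omega)⟩

/-- `R[d] :=` the least `i` with `R[c] ≤ R[a] * 2 ^ i` -/
def logProg (d a c : ℕ) : Prog :=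
  .seq (block [.add 37 a 6, .const d 0, .sub 38 c 37])
    (.whileDo 38 (block [.add 37 37 37, .add d d 7, .sub 38 c 37]))

lemma logProg_calc {d a c i : ℕ} (hd : d < 37) (ha : a < 37) (hc : c < 37) (hac : c ≠ d)
    (hd6 : d ≠ 7) {m : ℕ → ℕ} (h6 : m 6 = 0) (h7 : m 7 = 1) (hi : m c ≤ m a * 2 ^ i)
    (hlt : ∀ j < i, m a * 2 ^ j < m c) :
    Calc O (logProg d a c) m
      (Function.update (Function.update (Function.update m 37 (m a * 2 ^ i)) d i) 38 0)
      (8 * i + 9) := by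
  set M : ℕ → ℕ → ℕ := fun j =>
    Function.update (Function.update (Function.update m 37 (m a * 2 ^ j)) d j) 38
      (m c - m a * 2 ^ j) with hM
  have h1 := Calc.block (O := O) (l := [.add 37 a 6, .const d 0, .sub 38 c 37])
    (by simp [Op.plain]; omega) m
  have h2 := Calc.while (O := O) (P := block [.add 37 37 37, .add d d 7, .sub 38 c 37]) (M := M)
    (r := 38) (N := i) (c := 7) (by norm_num) (fun j hj => ⟨by
      have := hlt j hj
      simp [hM]
      omega, (Calc.block (O := O) (by simp [Op.plain]; omega) _).congr (fun _ _ => rfl)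
      (fun r hr => ?_) (by simp)⟩) (by simp [hM]; omega)
  · have h3 := h2.congr (m₁ := List.foldl Op.memAct m [.add 37 a 6, .const d 0, .sub 38 c 37])
      (fun r hr => ?_) (fun _ _ => rfl) le_rfl
    · refine (h1.seq h3).congr (fun _ _ => rfl) (fun r hr => ?_) (by simp; omega)
      simp [hM, Function.update_apply]
      split_ifs <;> omega
    · simp [hM, Op.memAct, Function.update_apply, h6, show c ≠ 37 by omega, hac,
        show 37 ≠ d by omega]
  · simp [hM, Op.memAct, Function.update_apply, h7, show c ≠ 37 by omega, show c ≠ 38 by omega,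
      hac, show d ≠ 37 by omega, show d ≠ 38 by omega, hd6.symm, show 37 ≠ d by omega]
    split_ifs <;> first | rfl | (rw [pow_succ]; ring_nf)

/-- `R[d] := R[d] * 2 ^ R[c]` -/
def shiftProg (d c : ℕ) : Prog := .whileDo c (block [.add d d d, .sub c c 7])

lemma shiftProg_calc {d c : ℕ} (hd : d < 60) (hc : c < 60) (hcd : c ≠ d) (hd7 : d ≠ 7)
    (hc7 : c ≠ 7) {m : ℕ → ℕ} (h7 : m 7 = 1) :
    Calc O (shiftProg d c) m (Function.update (Function.update m d (m d * 2 ^ m c)) c 0)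
      (6 * m c + 1) := by
  refine (Calc.while (O := O)
    (M := fun j => Function.update (Function.update m d (m d * 2 ^ j)) c (m c - j)) (r := c)
    (N := m c) (c := 5) hc (fun j hj => ⟨by simp; omega, (Calc.block (O := O)
      (by simp [Op.plain]; omega) _).congr (fun _ _ => rfl) (fun r hr => ?_) (by simp)⟩)
    (by simp)).congr (fun r hr => ?_) (fun r hr => ?_) (by omega)
  · simp [Op.memAct, Function.update_apply, h7, hcd, hcd.symm, hd7.symm, hc7.symm]
    split_ifs
    · omega
    · ring
    · rfl
  · by_cases h : r = c <;> simp [h]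
  · simp

/-- The number of stages. -/
def stages (L ld : ℕ) : ℕ := (L + 1) / 2 + ld + 4

/-- The number of samples for a test. -/
def samples (lη N : ℕ) : ℕ := (lη + 2 * N + 17) * 1048576

/-- From the input, compute the constants that the search needs. -/
def initProg : Prog :=
  .seq (block [.const 6 0, .const 7 1, .const 8 2, .const 36 6, .add 11 1 36, .const 27 1])
    (.seq (logProg 9 27 0) (.seq (logProg 28 2 3) (.seq (logProg 29 4 5)
      (.seq (block [.add 12 9 1, .add 10 12 11, .add 13 10 10, .add 13 13 7, .add 30 9 7,
        .half 30 30, .add 30 30 28, .const 36 4, .add 15 30 36, .add 31 15 15, .add 31 31 29,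
        .const 36 17, .add 31 31 36, .const 32 1048576]) (mulProg 14 31 32)))))

lemma initProg_det (s : St) {L ld lη : ℕ} (hL : s.mem 0 ≤ 2 ^ L)
    (hL' : ∀ j < L, 2 ^ j < s.mem 0) (hd : s.mem 3 ≤ s.mem 2 * 2 ^ ld)
    (hd' : ∀ j < ld, s.mem 2 * 2 ^ j < s.mem 3) (hη : s.mem 5 ≤ s.mem 4 * 2 ^ lη)
    (hη' : ∀ j < lη, s.mem 4 * 2 ^ j < s.mem 5) :
    ∃ s', Det O initProg s s' ∧ CircEnv s'.mem L (s.mem 1) ∧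
      s'.mem 15 = stages L ld ∧ s'.mem 14 = samples lη (stages L ld) ∧
      s'.circuit = s.circuit ∧ s'.time ≤ s.time + 8 * (L + ld + lη) + 600 := by
  have h1 := Calc.block (O := O) (l := [.const 6 0, .const 7 1, .const 8 2, .const 36 6,
    .add 11 1 36, .const 27 1]) (by simp [Op.plain]) s.mem
  have h2 := h1.seq ((logProg_calc (O := O) (d := 9) (a := 27) (c := 0) (i := L) (by norm_num)
    (by norm_num) (by norm_num) (by norm_num) (by norm_num) (by simp [Op.memAct])
    (by simp [Op.memAct]) (by simpa [Op.memAct] using hL)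
    (fun j hj => by simpa [Op.memAct] using hL' j hj)).seq
    ((logProg_calc (O := O) (d := 28) (a := 2) (c := 3) (i := ld) (by norm_num)
    (by norm_num) (by norm_num) (by norm_num) (by norm_num) (by simp [Op.memAct])
    (by simp [Op.memAct]) (by simpa [Op.memAct] using hd)
    (fun j hj => by simpa [Op.memAct] using hd' j hj)).seq
    ((logProg_calc (O := O) (d := 29) (a := 4) (c := 5) (i := lη) (by norm_num)
    (by norm_num) (by norm_num) (by norm_num) (by norm_num) (by simp [Op.memAct])
    (by simp [Op.memAct]) (by simpa [Op.memAct] using hη)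
    (fun j hj => by simpa [Op.memAct] using hη' j hj)).seq
    ((Calc.block (l := [.add 12 9 1, .add 10 12 11, .add 13 10 10, .add 13 13 7, .add 30 9 7,
        .half 30 30, .add 30 30 28, .const 36 4, .add 15 30 36, .add 31 15 15, .add 31 31 29,
        .const 36 17, .add 31 31 36, .const 32 1048576]) (by simp [Op.plain]) _).seq
    -- The second factor is `2^20`, hence the length `21`.
    (mulProg_calc (O := O) (d := 14) (a := 31) (c := 32) (N := 21) (by norm_num) (by norm_num)
      (by simp [Op.memAct]) (by simp [Op.memAct]))))))
  obtain ⟨s', d, m', c', -, t'⟩ := h2 s (fun _ _ => rfl)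
  simp only [List.foldl_cons, List.foldl_nil, Op.memAct] at m'
  refine ⟨s', d, ⟨?_, ?_, ?_, ?_, ?_, ?_, ?_, ?_, ?_⟩, ?_, ?_, c', ?_⟩
  · rw [m' 6 (by norm_num)]; simp
  · rw [m' 7 (by norm_num)]; simp
  · rw [m' 8 (by norm_num)]; simp
  · rw [m' 1 (by norm_num)]; simp
  · rw [m' 9 (by norm_num)]; simp
  · rw [m' 10 (by norm_num)]; simp [width]; omega
  · rw [m' 11 (by norm_num)]; simp
  · rw [m' 12 (by norm_num)]; simp
  · rw [m' 13 (by norm_num)]; simp [flagBit, width]; omega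
  · rw [m' 15 (by norm_num)]; simp [stages]
  · rw [m' 14 (by norm_num)]; simp [samples, stages]; omega
  · simp at t'
    linarith

/-- `R[25] := R[25] / R[18]` if `R[18]` is a power of `2`, at least `2`, and was halved before -/
def divProg : Prog := .whileDo 18 (block [.half 25 25, .half 18 18])

lemma divProg_calc {m : ℕ → ℕ} {j : ℕ} (h : m 18 = 2 ^ j) :
    Calc O divProg m
      (Function.update (Function.update m 25 (m 25 / 2 ^ (j + 1))) 18 0) (6 * j + 7) := by
  -- The loop only ends when `R[18]` is `0`, one halving after it has reached `1`; hence the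
  -- exponent `j + 1`.
  refine (Calc.while (O := O) (M := fun i => Function.update (Function.update m 25 (m 25 / 2 ^ i))
    18 (2 ^ j / 2 ^ i)) (r := 18) (N := j + 1) (c := 5) (by norm_num)
    (fun i hi => ⟨?_, (Calc.block (O := O) (by simp [Op.plain]) _).congr (fun _ _ => rfl)
      (fun r hr => ?_) (by simp)⟩) ?_).congr (fun r hr => ?_) (fun r hr => ?_) (by omega)
  · simp
    exact Nat.pow_le_pow_right (by norm_num) (by omega)
  · simp [Op.memAct, Function.update_apply, Nat.div_div_eq_div_mul, pow_succ]
    split_ifs <;> rfl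
  · simp [pow_succ]
  · by_cases h1 : r = 18
    · simp [h1, h]
    · by_cases h2 : r = 25 <;> simp [h1, h2]
  · by_cases h1 : r = 18
    · simp [h1, pow_succ]
    · by_cases h2 : r = 25 <;> simp [h1, h2]

/-- The output for the result `X` of a search in `N` stages. -/
def result (L b N X : ℕ) : ℕ := min (X ^ 2 * 2 ^ (L + b + 6) / 4 ^ (N + 12)) (2 ^ (L + 1 + b) - 1)

/-- The three initial halvings turn `4^(N+13)` into half of `4^(N+12)`, since `divProg` divides by
twice its register. The minimum with the largest admissible number is formed as `x - (x - y)` with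
truncated subtraction; it guarantees the output format even if the search has failed. -/
def outputProg : Prog :=
  .seq (mulProg 25 16 16)
    (.seq (block [.half 18 18, .half 18 18, .half 18 18, .add 20 9 11])
      (.seq (shiftProg 25 20) (.seq divProg (.seq (block [.const 26 1, .add 20 12 7])
        (.seq (shiftProg 26 20) (block [.sub 26 26 7, .sub 27 25 26, .sub 0 25 27]))))))

lemma outputProg_det (s : St) {L b N : ℕ} (hm : CircEnv s.mem L b)
    (h16 : s.mem 16 + 1024 ≤ 2 ^ (N + 11)) (h18 : s.mem 18 = 4 ^ (N + 13)) :
    ∃ s', Det O outputProg s s' ∧ s'.mem 0 = result L b N (s.mem 16) ∧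
      s'.time ≤ s.time + 100 * (width L b + N) + 1000 := by
  have h2 : (4 : ℕ) ^ (N + 13) = 2 ^ (2 * N + 23) * 2 * 2 * 2 := by
    rw [show (4 : ℕ) = 2 ^ 2 by norm_num, ← pow_mul]; ring
  have h3 : 2 ^ (2 * N + 23 + 1) = 4 ^ (N + 12) := by
    rw [show (4 : ℕ) = 2 ^ 2 by norm_num, ← pow_mul]; ring
  have h1 := (mulProg_calc (O := O) (d := 25) (a := 16) (c := 16) (N := N + 11) (by norm_num)
    (by norm_num) hm.zero (by omega)).seq
    ((Calc.block (l := [.half 18 18, .half 18 18, .half 18 18, .add 20 9 11])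
      (by simp [Op.plain]) _).seq
    ((shiftProg_calc (O := O) (d := 25) (c := 20) (by norm_num) (by norm_num) (by norm_num)
      (by norm_num) (by norm_num) (by simp [Op.memAct, hm.one])).seq
    ((divProg_calc (j := 2 * N + 23) (by simp [Op.memAct, h18, h2])).seq
    ((Calc.block (l := [.const 26 1, .add 20 12 7]) (by simp [Op.plain]) _).seq
    ((shiftProg_calc (O := O) (d := 26) (c := 20) (by norm_num) (by norm_num) (by norm_num)
      (by norm_num) (by norm_num) (by simp [Op.memAct, hm.one])).seq
    (Calc.block (l := [.sub 26 26 7, .sub 27 25 26, .sub 0 25 27]) (by simp [Op.plain]) _))))))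
  obtain ⟨s', d, m', -, -, t'⟩ := h1 s (fun _ _ => rfl)
  simp only [List.foldl_cons, List.foldl_nil, Op.memAct] at m'
  refine ⟨s', d, ?_, ?_⟩
  · rw [m' 0 (by norm_num)]
    simp [hm.one, hm.idx, hm.pos, hm.first, h3, result]
    rw [← sq, show L + (b + 6) = L + b + 6 by omega, show L + b + 1 = L + 1 + b by omega]
    generalize s.mem 16 ^ 2 * 2 ^ (L + b + 6) / 4 ^ (N + 12) = x
    omega
  · simp [Op.memAct, hm.one, hm.idx, hm.pos, hm.first] at t'
    unfold width
    omega

/-- The program for approximate summation. -/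
def sumProg : Prog := .seq initProg (.seq searchProg outputProg)

/-- The time that the program takes. -/
def sumTime (L b ld lη : ℕ) : ℕ :=
  stages L ld * stageTime (width L b) (samples lη (stages L ld)) (stages L ld)
    + 100 * (width L b + stages L ld) + 8 * (L + ld + lη) + 2000

lemma sumProg_spec {b L ld lη : ℕ} {t : ℝ} (ht : Amplitude O b t) (s : St) (hidx : O.idx = L)
    (hb : s.mem 1 = b) (hc : s.circuit = []) (hL : s.mem 0 ≤ 2 ^ L)
    (hL' : ∀ j < L, 2 ^ j < s.mem 0) (hd : s.mem 3 ≤ s.mem 2 * 2 ^ ld)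
    (hd' : ∀ j < ld, s.mem 2 * 2 ^ j < s.mem 3) (hη : s.mem 5 ≤ s.mem 4 * 2 ^ lη)
    (hη' : ∀ j < lη, s.mem 4 * 2 ^ j < s.mem 5) :
    Spec O sumProg s
      (fun s' => (∃ X, s'.mem 0 = result L b (stages L ld) X) ∧
        s'.time ≤ s.time + sumTime L b ld lη) True
      (fun s' => ∃ X : ℕ, |t * 2 ^ (stages L ld + 12) - X| ≤ 512 ∧
        s'.mem 0 = result L b (stages L ld) X)
      (stages L ld * (2049 * ((stages L ld + 3 : ℕ) * testErr (samples lη (stages L ld))))) := by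
  subst hidx hb
  obtain ⟨s₁, d₁, hm, h15, h14, c₁, t₁⟩ := initProg_det (O := O) s.tick hL hL' hd hd' hη hη'
  refine Spec.det_seq d₁ (Spec.seq_det (searchProg_spec ht (by unfold samples; omega) s₁.tick hm
    h14 h15 (by rw [St.tick_circuit, c₁]; exact hc)) fun u hu => ?_)
  obtain ⟨s', d, h0, t'⟩ := outputProg_det (O := O) u (hm.congr fun r hr => hu.frame r (by omega))
    hu.bound hu.scale
  refine ⟨s', d, ⟨⟨_, h0⟩, ?_⟩, fun _ hg => ⟨_, hg, h0⟩⟩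
  have := hu.time
  simp only [St.tick_time, St.tick_mem] at this t₁ t'
  unfold sumTime
  linarith

/-! ### From specifications to distributions -/

/-- As every step takes time, `T` steps suffice. Weighting violations of `S` with `⊤` against the
bound `0` shows that they are impossible; the weight `1` on violations of `G` turns the bound on the
expectation into the failure probability. -/
lemma Spec.steps {P : Prog} {input : List ℕ} {S G : St → Prop} {ε : ℝ≥0∞} {T : ℕ}
    (h : Spec O P ⟨fun i => input.getD i 0, [], 0, 0⟩ S True G ε) (hT : ∀ s, S s → s.time ≤ T) :
    (∀ σ ∈ (QC.steps O T (start P input)).support,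
      σ.todo = [] ∧ S ⟨σ.mem, σ.circuit, σ.outcome, σ.time⟩) ∧
    ∀ E : Set Config, (∀ σ, σ.todo = [] → S ⟨σ.mem, σ.circuit, σ.outcome, σ.time⟩ →
      G ⟨σ.mem, σ.circuit, σ.outcome, σ.time⟩ → σ ∈ E) →
      1 ≤ (QC.steps O T (start P input)).toOuterMeasure E + ε := by
  classical
  constructor
  · have h1 := (h.1 [] (fun s => if S s then 0 else ⊤) 0 (fun s hs => by simp [hs])).steps
      (T := T) (fun s hs => hT s (by by_contra h'; simp [h'] at hs)) T (by simp)
    intro σ hσ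
    have h2 := (ENNReal.tsum_eq_zero.1 (le_zero_iff.1 h1)) σ
    rw [PMF.mem_support_iff] at hσ
    have h3 := (mul_eq_zero.1 h2).resolve_left hσ
    by_cases h4 : σ.todo = []
    · refine ⟨h4, ?_⟩
      by_contra h5
      simp [h4, h5] at h3
    · simp [h4] at h3
  · intro E hE
    have h1 := (h.2 trivial [] (fun s => if S s then (if G s then 0 else 1) else ⊤) 0 1 (by simp)
      (fun s hs => by split_ifs <;> simp) (fun s hs hg => by simp [hs, hg])).steps
      (T := T) (fun s hs => hT s (by by_contra h'; simp [h'] at hs)) T (by simp)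
    rw [zero_add, mul_one] at h1
    rw [PMF.toOuterMeasure_apply]
    refine le_trans ?_ (add_le_add (le_refl (∑' σ, Set.indicator E _ σ)) h1)
    rw [← ENNReal.tsum_add]
    refine (PMF.tsum_coe (QC.steps O T (start P input))).symm.le.trans ?_
    refine ENNReal.tsum_le_tsum fun σ => ?_
    by_cases hσ : σ ∈ E
    · simp [hσ]
    · rw [Set.indicator_of_notMem hσ, zero_add]
      refine le_mul_of_one_le_right (by simp) ?_
      split_ifs with h2 h3 h4
      · exact absurd (hE σ h2 h3 h4) hσ
      · exact le_rfl
      · simp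
      · simp

/-! ### Accuracy -/

/-- If `t` is known up to `δ t / 8`, the output is accurate. -/
lemma result_accurate {L b N X : ℕ} {t δ S : ℝ} (ht0 : 0 < t) (hδ0 : 0 < δ) (hδ : δ ≤ 1 / 2)
    (hS : t ^ 2 * 2 ^ (L + 6) = S) (hS4 : 1 / 4 ≤ S) (hSL : S ≤ 3 / 4 * 2 ^ L)
    (hX : |t * 2 ^ (N + 12) - X| ≤ 512) (hN : 1 ≤ δ * t * 2 ^ N) (hb : 64 ≤ δ * 2 ^ b) :
    IsMulApprox δ ((result L b N X : ℝ) / 2 ^ b) S := by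
  have hpb : (0 : ℝ) < 2 ^ b := by positivity
  have hpN : (0 : ℝ) < 2 ^ N := by positivity
  have hpL : (0 : ℝ) < 2 ^ L := by positivity
  set t' : ℝ := X / 2 ^ (N + 12) with ht'
  -- `512 / 2^(N+12) = 2^-N / 8`, and `2^-N ≤ δt` by `hN`.
  have hd : |t - t'| ≤ δ * t / 8 := by
    have h1 := abs_sub_div_mul (t := t) (c := X) (q := N + 12)
    have e : (2 : ℝ) ^ (N + 12) = 2 ^ N * 4096 := by rw [pow_add]; norm_num
    rw [← h1, ← ht', e] at hX
    have h2 : |t - t'| * 2 ^ N ≤ 1 / 8 := by linarith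
    by_contra! h3
    have : δ * t / 8 * 2 ^ N < |t - t'| * 2 ^ N := by gcongr
    linarith
  -- The relative error of the square is at most `δ/4 + δ²/64 ≤ 9δ/32`.
  have hy : |t' ^ 2 * 2 ^ (L + 6) - S| ≤ 9 / 32 * δ * S := by
    rw [← hS, ← sub_mul, abs_mul, abs_of_pos (by positivity : (0 : ℝ) < 2 ^ (L + 6)), ← mul_assoc]
    gcongr
    rw [abs_le] at hd ⊢
    have h1 : 0 ≤ δ * t := by positivity
    have h2 : δ * t ≤ t / 2 := by nlinarith
    constructor <;> nlinarith
  set y : ℝ := t' ^ 2 * 2 ^ (L + 6) with hy'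
  have hy0 : 0 ≤ y := by positivity
  have hδS : δ * S ≤ S / 2 := by nlinarith
  rw [abs_le] at hy
  have hfl : X ^ 2 * 2 ^ (L + b + 6) / 4 ^ (N + 12) = ⌊y * 2 ^ b⌋₊ := by
    rw [← Nat.floor_div_eq_div (K := ℝ)]
    congr 1
    push_cast
    rw [hy', ht', div_pow, ← pow_mul, show (4 : ℝ) = 2 ^ 2 by norm_num, ← pow_mul,
      mul_comm (N + 12) 2]
    ring
  -- The upper limit on the output is inactive: `(1 + 9/64) · 3/4 < 1`.
  have hlt : y * 2 ^ b < 2 ^ (L + b) := by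
    rw [pow_add]
    gcongr
    linarith
  have hcap : ⌊y * 2 ^ b⌋₊ ≤ 2 ^ (L + 1 + b) - 1 := by
    have h1 : ⌊y * 2 ^ b⌋₊ < 2 ^ (L + b) := by
      rw [Nat.floor_lt (by positivity)]
      exact_mod_cast hlt
    have h2 : 2 ^ (L + b) ≤ 2 ^ (L + 1 + b) := Nat.pow_le_pow_right (by norm_num) (by omega)
    omega
  rw [result, hfl, min_eq_left hcap]
  have h1 := Nat.floor_le (by positivity : 0 ≤ y * 2 ^ b)
  have h2 := Nat.lt_floor_add_one (y * 2 ^ b)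
  -- Rounding down loses at most one unit `2^-b`, which is at most `δS/16`.
  have h3 : 16 ≤ δ * S * 2 ^ b := by nlinarith
  constructor
  · rw [le_div_iff₀ hpb]
    have : (1 - 9 / 32 * δ) * S * 2 ^ b ≤ y * 2 ^ b := by gcongr; linarith
    linarith
  · rw [div_le_iff₀ hpb]
    refine h1.trans ?_
    gcongr
    have : 0 ≤ δ * S := by nlinarith
    linarith

/-! ### The failure probability -/

/-- The union bound `N · 2049 · (N+3) · 2e^-(lη+2N+17)`: the summands `2N + 17` of the exponent
absorb `N ≤ e^N`, `N + 3 ≤ e^(N+2)` and `4098 ≤ e^15`, and `e^-lη ≤ 2^-lη ≤ η` remains. -/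
lemma err_le {lη N : ℕ} {η : ℝ} (hη : 1 ≤ η * 2 ^ lη) :
    (N : ℝ≥0∞) * (2049 * ((N + 3 : ℕ) * testErr (samples lη N))) ≤ ENNReal.ofReal η := by
  have h0 : ((samples lη N : ℕ) : ℝ) / 2 ^ 20 = lη + 2 * N + 17 := by
    unfold samples
    push_cast
    norm_num
  rw [testErr, h0, ← ENNReal.ofReal_natCast, ← ENNReal.ofReal_natCast,
    ← ENNReal.ofReal_mul (by positivity), show (2049 : ℝ≥0∞) = ENNReal.ofReal 2049 by simp,
    ← ENNReal.ofReal_mul (by positivity), ← ENNReal.ofReal_mul (by positivity)]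
  refine ENNReal.ofReal_le_ofReal ?_
  have h1 : (N : ℝ) ≤ Real.exp N := (by linarith [Real.add_one_le_exp (N : ℝ)])
  have h2 : (N : ℝ) + 3 ≤ Real.exp (N + 2) := (by linarith [Real.add_one_le_exp ((N : ℝ) + 2)])
  have h3 : (4098 : ℝ) ≤ Real.exp 15 := by
    have : Real.exp 15 = Real.exp 1 ^ 15 := by rw [← Real.exp_nat_mul]; norm_num
    rw [this]
    calc (4098 : ℝ) ≤ 2 ^ 15 := by norm_num
      _ ≤ Real.exp 1 ^ 15 := by
        gcongr
        linarith [Real.add_one_le_exp (1 : ℝ)]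
  have h4 : (2 : ℝ) ^ lη ≤ Real.exp lη := by
    have : Real.exp lη = Real.exp 1 ^ lη := by rw [← Real.exp_nat_mul]; simp
    rw [this]
    gcongr
    linarith [Real.add_one_le_exp (1 : ℝ)]
  have hη0 : 0 < η := by
    by_contra! h
    have : η * 2 ^ lη ≤ 0 := mul_nonpos_of_nonpos_of_nonneg h (by positivity)
    linarith
  have h5 : 1 ≤ η * Real.exp lη := hη.trans (by gcongr)
  have h6 : (N : ℝ) * ((N + 3) * 4098) ≤ Real.exp N * (Real.exp (N + 2) * Real.exp 15) := by gcongr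
  have h7 : Real.exp N * (Real.exp (N + 2) * Real.exp 15) * Real.exp lη
      * Real.exp (-(lη + 2 * N + 17)) = 1 := by
    rw [← Real.exp_add, ← Real.exp_add, ← Real.exp_add, ← Real.exp_add, ← Real.exp_zero]
    congr 1
    ring
  push_cast
  calc (N : ℝ) * (2049 * ((N + 3) * (2 * Real.exp (-(lη + 2 * N + 17)))))
      = N * ((N + 3) * 4098) * Real.exp (-(lη + 2 * N + 17)) := by ring
    _ ≤ Real.exp N * (Real.exp (N + 2) * Real.exp 15) * Real.exp (-(lη + 2 * N + 17))
        * (η * Real.exp lη) := by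
      refine le_trans ?_ (le_mul_of_one_le_right (by positivity) h5)
      gcongr
    _ = η * (Real.exp N * (Real.exp (N + 2) * Real.exp 15) * Real.exp lη
      * Real.exp (-(lη + 2 * N + 17))) := by ring
    _ = η := by rw [h7, mul_one]

/-! ### The running time -/

lemma log_le_of_pow_lt {i : ℕ} {x : ℝ} (hx : 1 ≤ x) (h : ∀ j < i, (2 : ℝ) ^ j < x) :
    (i : ℝ) ≤ 2 * (1 + Real.log x) := by
  have h0 := Real.log_nonneg hx
  cases i with
  | zero => simp; linarith
  | succ i =>
    have h1 := Real.log_le_log (by positivity) (h i (by omega)).le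
    rw [Real.log_pow] at h1
    have h2 := Real.log_two_gt_d9
    push_cast
    nlinarith [(Nat.cast_nonneg i : (0 : ℝ) ≤ i)]

/-- `Z` bounds the polylogarithmic quantities. The four powers of `Z` come from the number of
stages, the tests per candidate, the part of the number of samples besides `log(1/η)`, and the width
of the circuit; `R` comes from the number of rounds and `M` from the samples. -/
lemma sumTime_le {L b ld lη : ℕ} {Z M R : ℝ} (hZ : 1 ≤ Z) (hM : 1 ≤ M) (hR : 1 ≤ R)
    (hL : (L : ℝ) ≤ 2 * Z) (hb : (1 + b : ℝ) ≤ Z) (hld : (ld : ℝ) ≤ 2 * Z) (hlη : (lη : ℝ) ≤ 4 * M)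
    (hN : (2 : ℝ) ^ stages L ld ≤ 64 * R) : (sumTime L b ld lη : ℝ) ≤ 10 ^ 20 * (Z ^ 4 * (R * M)) := by
  set N := stages L ld with hNdef
  have hNZ : (N : ℝ) ≤ 8 * Z := by
    have : ((2 * N : ℕ) : ℝ) ≤ ((L + 1 + 2 * ld + 8 : ℕ) : ℝ) := by
      exact_mod_cast (by rw [hNdef]; unfold stages; omega)
    push_cast at this
    linarith
  have hw : ((width L b : ℕ) : ℝ) ≤ 10 * Z := by
    unfold width
    push_cast
    linarith
  have hZM : Z ≤ Z * M := le_mul_of_one_le_right (by linarith) hM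
  have hMZ : M ≤ Z * M := le_mul_of_one_le_left (by linarith) hZ
  have hn : ((samples lη N : ℕ) : ℝ) ≤ 1048576 * (40 * (Z * M)) := by
    unfold samples
    push_cast
    rw [mul_comm]
    gcongr
    linarith
  have hZ0 : 0 ≤ Z := by linarith
  have hM0 : 0 ≤ M := by linarith
  have hR0 : 0 ≤ R := by linarith
  have hT : ((testTime (width L b) (samples lη N) (N + 13) (2 ^ (N + 2)) : ℕ) : ℝ)
      ≤ 10 ^ 14 * (Z ^ 2 * (R * M)) := by
    unfold testTime
    push_cast
    have h1 : (2 : ℝ) ^ (N + 2) ≤ 256 * R := by rw [pow_add]; linarith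
    have h2 : 200 * ((N : ℝ) + 13) + 200 ≤ 4400 * Z := by linarith
    have h3 : (2 : ℝ) ^ (N + 2) + 1 ≤ 257 * R := by linarith
    have h4 : Z * R ≤ Z ^ 2 * (R * M) := by
      have : 1 ≤ Z * M := hZ.trans hZM
      calc Z * R ≤ Z * R * (Z * M) := le_mul_of_one_le_right (by positivity) this
        _ = _ := by ring
    have h5 : 1 ≤ Z ^ 2 * (R * M) := by
      refine le_trans ?_ h4
      nlinarith
    calc 2 * (2 : ℝ) ^ (N + 2) * (200 * ((N : ℝ) + 13) + 200)
          + (samples lη N) * (500 * (width L b) * (2 ^ (N + 2) + 1)) + 100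
        ≤ 2 * (256 * R) * (4400 * Z)
          + (1048576 * (40 * (Z * M))) * (500 * (10 * Z) * (257 * R)) + 100 := by gcongr
      _ = 2252800 * (Z * R) + 53896806400000 * (Z ^ 2 * (R * M)) + 100 := by ring
      _ ≤ _ := by linarith
  set T := testTime (width L b) (samples lη N) (N + 13) (2 ^ (N + 2))
  set Q := R * M with hQ
  have hQ1 : 1 ≤ Q := by rw [hQ]; nlinarith
  have p1 : 1 ≤ Z ^ 2 * Q := by nlinarith [one_le_pow₀ hZ (n := 2)]
  have p2 : Z ≤ Z ^ 3 * Q := by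
    calc Z ≤ Z * (Z ^ 2 * Q) := le_mul_of_one_le_right hZ0 p1
      _ = _ := by ring
  have hS : ((stageTime (width L b) (samples lη N) N : ℕ) : ℝ) ≤ 10 ^ 19 * (Z ^ 3 * Q) := by
    unfold stageTime
    push_cast
    calc 2049 * (((N : ℝ) + 3) * (T + 20) + 20 * (N + 13) + 101) + 100
        ≤ 2049 * ((11 * Z) * (10 ^ 14 * (Z ^ 2 * Q) + 20 * (Z ^ 2 * Q)) + 20 * (8 * Z + 13) + 101)
          + 100 := by
          gcongr
          · linarith
          · linarith
      _ ≤ 2049 * ((11 * Z) * (10 ^ 14 * (Z ^ 2 * Q) + 20 * (Z ^ 2 * Q)) + 600 * Z) := by linarith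
      _ = 2049 * 11 * (10 ^ 14 + 20) * (Z ^ 3 * Q) + 2049 * 600 * Z := by ring
      _ ≤ _ := by linarith
  have p3 : Z ≤ Z ^ 4 * Q := by
    calc Z ≤ Z ^ 3 * Q := p2
      _ ≤ Z * (Z ^ 3 * Q) := le_mul_of_one_le_left (by positivity) hZ
      _ = _ := by ring
  have p4 : M ≤ Z ^ 4 * Q := by
    calc M ≤ Q := by rw [hQ]; exact le_mul_of_one_le_left hM0 hR
      _ ≤ _ := le_mul_of_one_le_left (by linarith) (one_le_pow₀ hZ)
  unfold sumTime
  push_cast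
  calc (N : ℝ) * (stageTime (width L b) (samples lη N) N) + 100 * ((width L b) + N)
        + 8 * (L + ld + lη) + 2000
      ≤ 8 * Z * (10 ^ 19 * (Z ^ 3 * Q)) + 100 * (10 * Z + 8 * Z) + 8 * (2 * Z + 2 * Z + 4 * M)
        + 2000 * Z := by
        gcongr
        linarith
    _ = 8 * 10 ^ 19 * (Z ^ 4 * Q) + 3832 * Z + 32 * M := by ring
    _ ≤ _ := by linarith

/-! ### From the input to the amplitude, the precision and the number of stages -/

lemma floor_eq_of_isFixedPoint {b : ℕ} {a : ℝ} (h : IsFixedPoint 0 b a) (ha : 0 ≤ a) :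
    ⌊a * 2 ^ b⌋₊ < 2 ^ b ∧ (⌊a * 2 ^ b⌋₊ : ℝ) = a * 2 ^ b := by
  obtain ⟨m, hm, h⟩ := h
  rw [abs_of_nonneg ha] at h
  have e : a * 2 ^ b = m := by rw [h]; field_simp
  rw [e, Nat.floor_natCast]
  exact ⟨by simpa using hm, rfl⟩

lemma sum_vecOracle {n b : ℕ} {v : Fin n → ℝ} (hv : ∀ j, IsFixedPoint 0 b (v j))
    (h0 : ∀ j, 0 ≤ v j) :
    ((∑ i ∈ Finset.range (2 ^ (vecOracle b v).idx), (vecOracle b v).val i : ℕ) : ℝ)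
      = (∑ j, v j) * 2 ^ b := by
  have hle : n ≤ 2 ^ Nat.clog 2 n := Nat.le_pow_clog (by norm_num) n
  have h1 : ∑ i ∈ Finset.range (2 ^ (vecOracle b v).idx), (vecOracle b v).val i
      = ∑ i ∈ Finset.range n, (vecOracle b v).val i := by
    refine (Finset.sum_subset (Finset.range_mono hle) fun i _ hi => ?_).symm
    rw [Finset.mem_range] at hi
    simp [vecOracle, hi]
  rw [h1, Finset.sum_range, Finset.sum_mul]
  push_cast
  refine Finset.sum_congr rfl fun j _ => ?_
  simp only [vecOracle, Fin.is_lt, dif_pos]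
  exact (floor_eq_of_isFixedPoint (hv j) (h0 j)).2

/-- `t = √(S / 2^(L+6))`. The six surplus position qubits ensure `t ≤ 1/8`, from which the search
starts. -/
lemma exists_amplitude {n b : ℕ} {v : Fin n → ℝ} (hv : ∀ j, IsFixedPoint 0 b (v j))
    (h0 : ∀ j, 0 ≤ v j ∧ v j ≤ 3 / 4) (h1 : ∃ j, 1 / 4 ≤ v j) :
    ∃ t : ℝ, Amplitude (vecOracle b v) b t ∧
      t ^ 2 * 2 ^ (Nat.clog 2 n + 6) = ∑ j, v j ∧ 1 / 4 ≤ ∑ j, v j ∧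
      ∑ j, v j ≤ 3 / 4 * 2 ^ Nat.clog 2 n := by
  set L := Nat.clog 2 n with hL
  set S := ∑ j, v j with hS
  have hS4 : 1 / 4 ≤ S := by
    obtain ⟨j, hj⟩ := h1
    exact hj.trans (Finset.single_le_sum (fun i _ => (h0 i).1) (Finset.mem_univ j))
  have hn : (n : ℝ) ≤ 2 ^ L := by exact_mod_cast Nat.le_pow_clog (by norm_num) n
  have hSL : S ≤ 3 / 4 * 2 ^ L := by
    have : S ≤ ∑ _j : Fin n, (3 / 4 : ℝ) := Finset.sum_le_sum fun j _ => (h0 j).2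
    rw [Finset.sum_const, Finset.card_univ, Fintype.card_fin, nsmul_eq_mul] at this
    linarith
  have hp : (0 : ℝ) < 2 ^ (L + 6) := by positivity
  have hsq : √(S / 2 ^ (L + 6)) ^ 2 * 2 ^ (L + 6) = S := by
    rw [Real.sq_sqrt (by positivity), div_mul_cancel₀ _ hp.ne']
  refine ⟨√(S / 2 ^ (L + 6)), ⟨fun i => ?_, Real.sqrt_pos.2 (by positivity), ?_, ?_⟩, hsq, hS4, hSL⟩
  · simp only [vecOracle]
    split_ifs with hi
    · exact (floor_eq_of_isFixedPoint (hv _) (h0 _).1).1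
    · positivity
  · rw [Real.sqrt_le_left (by norm_num), div_le_iff₀ hp, pow_add]
    have : (0 : ℝ) < 2 ^ L := by positivity
    linarith
  · rw [sum_vecOracle hv fun j => (h0 j).1, show (vecOracle b v).idx = L from rfl,
      show L + b + 6 = L + 6 + b by omega, pow_add _ (L + 6), ← mul_assoc, hsq]

/-- For a positive rational `q`, the least `i` with `1 / q ≤ 2 ^ i`. -/
lemma exists_log_inv {q : ℚ} (hq : 0 < q) : ∃ i : ℕ, q.den ≤ q.num.toNat * 2 ^ i ∧
    (∀ j < i, q.num.toNat * 2 ^ j < q.den) ∧ 1 ≤ (q : ℝ) * 2 ^ i ∧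
    ∀ j < i, (2 : ℝ) ^ j < 1 / (q : ℝ) := by
  have hnum : 0 < q.num.toNat := by have := Rat.num_pos.2 hq; omega
  have hex : ∃ i, q.den ≤ q.num.toNat * 2 ^ i :=
    ⟨q.den, (Nat.lt_two_pow_self (n := q.den)).le.trans (Nat.le_mul_of_pos_left _ hnum)⟩
  have hden : (0 : ℝ) < q.den := by exact_mod_cast q.den_pos
  have hnum' : (0 : ℝ) < q.num.toNat := by exact_mod_cast hnum
  have e : (q : ℝ) = (q.num.toNat : ℝ) / q.den := by
    conv_lhs => rw [Rat.cast_def]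
    congr 1
    have : ((q.num.toNat : ℤ) : ℝ) = q.num := by
      rw [Int.toNat_of_nonneg (Rat.num_pos.2 hq).le]
    exact_mod_cast this.symm
  have hlt : ∀ j < Nat.find hex, q.num.toNat * 2 ^ j < q.den := fun j hj =>
    not_le.1 (Nat.find_min hex hj)
  refine ⟨Nat.find hex, Nat.find_spec hex, hlt, ?_, fun j hj => ?_⟩
  · rw [e, div_mul_eq_mul_div, le_div_iff₀ hden, one_mul]
    exact_mod_cast Nat.find_spec hex
  · rw [e, one_div_div, lt_div_iff₀ hnum', mul_comm]
    exact_mod_cast hlt j hj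

lemma ceil_logb_add_one {n : ℕ} (hn : 1 ≤ n) : ⌈Real.logb 2 n + 1⌉₊ = Nat.clog 2 n + 1 := by
  have h : 0 ≤ Real.logb 2 n := Real.logb_nonneg (by norm_num) (by exact_mod_cast hn)
  rw [Nat.ceil_add_one h]
  congr 1
  exact_mod_cast Real.natCeil_logb_natCast 2 n

lemma result_lt (L b N X : ℕ) : result L b N X < 2 ^ (L + 1 + b) :=
  (min_le_right _ _).trans_lt (Nat.sub_lt (Nat.two_pow_pos _) one_pos)

/-- `S ≥ 1/4` means `t ≥ 2^-(L+8)/2`, which the first and last summand of `stages` compensate; `ld`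
compensates `δ`. -/
lemma one_le_mul_two_pow_stages {L ld : ℕ} {t δ S : ℝ} (ht : 0 < t)
    (hld : 1 ≤ δ * 2 ^ ld) (hS : t ^ 2 * 2 ^ (L + 6) = S) (hS4 : 1 / 4 ≤ S) :
    1 ≤ δ * t * 2 ^ stages L ld := by
  have h1 : 1 ≤ (t * 2 ^ ((L + 1) / 2 + 4)) ^ 2 := by
    rw [mul_pow, ← pow_mul]
    calc (1 : ℝ) ≤ t ^ 2 * 2 ^ (L + 6) * 4 := by linarith
      _ = t ^ 2 * 2 ^ (L + 8) := by ring
      _ ≤ _ := by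
        gcongr
        · norm_num
        · omega
  have h2 : 1 ≤ t * 2 ^ ((L + 1) / 2 + 4) := by
    rwa [one_le_sq_iff₀ (by positivity)] at h1
  calc (1 : ℝ) ≤ (δ * 2 ^ ld) * (t * 2 ^ ((L + 1) / 2 + 4)) :=
        one_le_mul_of_one_le_of_one_le hld h2
    _ = _ := by
      unfold stages
      ring

/-- `2^⌈L/2⌉ ≤ 2√n`, `2^ld ≤ 2/δ`, and a factor `2^4`: the source of `√n / δ` in the running time.
-/
lemma two_pow_stages_le {n ld : ℕ} {δ : ℝ} (hn : 1 ≤ n) (hδ' : 1 ≤ 1 / δ)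
    (hld : ∀ j < ld, (2 : ℝ) ^ j < 1 / δ) :
    (2 : ℝ) ^ stages (Nat.clog 2 n) ld ≤ 64 * (√(n : ℝ) * (1 / δ)) := by
  set L := Nat.clog 2 n with hL
  have h1 : 2 ^ L ≤ 2 * n := by
    rcases Nat.eq_zero_or_pos L with h | h
    · rw [h]; omega
    · have h2 : 2 ^ (L - 1) < n := by
        by_contra! h3
        exact absurd (Nat.clog_le_of_le_pow h3) (by omega)
      have h3 : 2 ^ L = 2 * 2 ^ (L - 1) := by rw [← pow_succ']; congr 1; omega
      omega
  have h2 : (2 : ℝ) ^ ((L + 1) / 2) ≤ 2 * √n := by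
    refine (pow_le_pow_iff_left₀ (by positivity) (by positivity) two_ne_zero).1 ?_
    rw [mul_pow, Real.sq_sqrt (by positivity), ← pow_mul]
    calc (2 : ℝ) ^ ((L + 1) / 2 * 2) ≤ 2 ^ (L + 1) :=
          pow_le_pow_right₀ (by norm_num) (by omega)
      _ = 2 * 2 ^ L := by ring
      _ ≤ 2 * (2 * n) := by gcongr; exact_mod_cast h1
      _ = _ := by ring
  have h3 : (2 : ℝ) ^ ld ≤ 2 * (1 / δ) := by
    cases ld with
    | zero => rw [pow_zero]; linarith
    | succ j => rw [pow_succ]; linarith [hld j (by omega)]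
  calc (2 : ℝ) ^ stages L ld = 2 ^ ((L + 1) / 2) * 2 ^ ld * 16 := by unfold stages; ring
    _ ≤ 2 * √n * (2 * (1 / δ)) * 16 := by gcongr
    _ = _ := by ring

lemma le_mul_two_pow {b : ℕ} {δ : ℝ} (hδ : 0 < δ) (hb : ⌈Real.logb 2 (1 / δ)⌉₊ + 6 ≤ b) :
    64 ≤ δ * 2 ^ b := by
  have h1 := Nat.le_ceil (Real.logb 2 (1 / δ))
  rw [Real.logb_le_iff_le_rpow (by norm_num) (by positivity), Real.rpow_natCast,
    div_le_iff₀ hδ] at h1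
  calc (64 : ℝ) ≤ 2 ^ ⌈Real.logb 2 (1 / δ)⌉₊ * δ * 64 := by linarith
    _ = δ * 2 ^ (⌈Real.logb 2 (1 / δ)⌉₊ + 6) := by ring
    _ ≤ δ * 2 ^ b := by gcongr; norm_num

end QC

/-! ### The theorem -/

theorem mainTheorem9 :
    ∃ (P : QC.Prog) (C : ℝ) (k : ℕ),
      ∀ (n b : ℕ) (δ η : ℚ) (v : Fin n → ℝ),
        0 < δ → δ ≤ 1 / 2 → 0 < η →
        (∀ j, IsFixedPoint 0 b (v j)) →
        (∀ j, 0 ≤ v j ∧ v j ≤ 3 / 4) →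
        (∃ j, 1 / 4 ≤ v j) →
        ∃ N : ℕ,
          (∀ σ ∈ (QC.steps (QC.vecOracle b v) N (QC.start P (QC.sumInput n b δ η))).support,
            σ.todo = [] ∧
            (σ.time : ℝ) ≤
              C * ((1 + (b : ℝ)) * (1 + Real.log n) * (1 + Real.log (1 / (δ : ℝ)))) ^ k *
                (Real.sqrt n * (1 / (δ : ℝ)) * max 1 (Real.log (1 / (η : ℝ)))) ∧
            IsFixedPoint ⌈Real.logb 2 n + 1⌉₊ b (QC.sumOutput b σ)) ∧
          (⌈Real.logb 2 (1 / (δ : ℝ))⌉₊ + 6 ≤ b →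
            ENNReal.ofReal (1 - (η : ℝ)) ≤
              (QC.steps (QC.vecOracle b v) N
                  (QC.start P (QC.sumInput n b δ η))).toOuterMeasure
                {σ | IsMulApprox (δ : ℝ) (QC.sumOutput b σ) (∑ j, v j)}) := by
  refine ⟨QC.sumProg, 10 ^ 20, 4, fun n b δ η v hδ0 hδ hη hv h0 h1 => ?_⟩
  obtain ⟨t, ht, hS, hS4, hSL⟩ := QC.exists_amplitude hv h0 h1
  obtain ⟨ld, hd1, hd2, hd3, hd4⟩ := QC.exists_log_inv hδ0
  obtain ⟨lη, hη1, hη2, hη3, hη4⟩ := QC.exists_log_inv hη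
  set L := Nat.clog 2 n with hL
  have hn : 1 ≤ n := by obtain ⟨j, -⟩ := h1; exact j.pos
  have hnL : n ≤ 2 ^ L := Nat.le_pow_clog (by norm_num) n
  have hlt : ∀ j < L, 2 ^ j < n := fun j hj => by
    by_contra! h
    exact absurd (Nat.clog_le_of_le_pow h) (by omega)
  have hδR : (0 : ℝ) < δ := by exact_mod_cast hδ0
  have hδR' : (δ : ℝ) ≤ 1 / 2 := by
    have : ((δ : ℚ) : ℝ) ≤ ((1 / 2 : ℚ) : ℝ) := by exact_mod_cast hδ
    simpa using this
  have hηR : (0 : ℝ) < η := by exact_mod_cast hη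
  have hnR : (1 : ℝ) ≤ n := by exact_mod_cast hn
  set N := QC.stages L ld with hN
  have hspec := QC.sumProg_spec (O := QC.vecOracle b v) ht
    ⟨fun i => (QC.sumInput n b δ η).getD i 0, [], 0, 0⟩ (L := L) (ld := ld) (lη := lη) rfl rfl rfl
    hnL hlt hd1 hd2 hη1 hη2
  obtain ⟨hsure, hlikely⟩ := hspec.steps (T := QC.sumTime L b ld lη)
    fun s hs => by simpa using hs.2
  refine ⟨QC.sumTime L b ld lη, fun σ hσ => ?_, fun hb => ?_⟩
  · obtain ⟨h2, ⟨X, hX⟩, h3⟩ := hsure σ hσ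
    refine ⟨h2, ?_, ?_⟩
    · have h5 : 1 ≤ 1 / (δ : ℝ) := by rw [le_div_iff₀ hδR]; linarith
      have hA : (1 : ℝ) ≤ 1 + b := by simp
      have hB : 1 ≤ 1 + Real.log n := by linarith [Real.log_nonneg hnR]
      have hD : 1 ≤ 1 + Real.log (1 / δ) := by linarith [Real.log_nonneg h5]
      set A : ℝ := 1 + b
      set B : ℝ := 1 + Real.log n
      set D : ℝ := 1 + Real.log (1 / δ)
      have hAB : 1 ≤ A * B := one_le_mul_of_one_le_of_one_le hA hB
      have hlη : (lη : ℝ) ≤ 4 * max 1 (Real.log (1 / η)) := by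
        -- For `η > 1` the logarithm is negative, but then `lη = 0`; if `lη > 0`, then `1/η > 1`.
        rcases Nat.eq_zero_or_pos lη with h | h
        · rw [h]
          have := le_max_left 1 (Real.log (1 / (η : ℝ)))
          push_cast
          linarith
        · have h6 := QC.log_le_of_pow_lt (by simpa using (hη4 0 h).le) hη4
          have h7 := le_max_left 1 (Real.log (1 / (η : ℝ)))
          have h8 := le_max_right 1 (Real.log (1 / (η : ℝ)))
          linarith
      have hR : 1 ≤ √(n : ℝ) * (1 / δ) :=
        one_le_mul_of_one_le_of_one_le (Real.one_le_sqrt.2 hnR) h5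
      have h9 : σ.time ≤ QC.sumTime L b ld lη := by simpa using h3
      refine (Nat.cast_le.2 h9).trans ((QC.sumTime_le (Z := A * B * D)
        (one_le_mul_of_one_le_of_one_le hAB hD) (le_max_left _ _) hR ?_ ?_ ?_ hlη
        (QC.two_pow_stages_le hn h5 hd4)).trans (le_of_eq (by ring)))
      · refine (QC.log_le_of_pow_lt hnR fun j hj => by exact_mod_cast hlt j hj).trans ?_
        have : B ≤ A * B * D := by
          calc B ≤ A * B := le_mul_of_one_le_left (by linarith) hA
            _ ≤ _ := le_mul_of_one_le_right (by linarith) hD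
        linarith
      · calc A ≤ A * B := le_mul_of_one_le_right (by linarith) hB
          _ ≤ _ := le_mul_of_one_le_right (by linarith) hD
      · refine (QC.log_le_of_pow_lt h5 hd4).trans ?_
        have : D ≤ A * B * D := le_mul_of_one_le_left (by linarith) hAB
        linarith
    · refine ⟨QC.result L b N X, ?_, ?_⟩
      · rw [QC.ceil_logb_add_one hn]
        exact QC.result_lt L b N X
      · simp only at hX
        rw [QC.sumOutput, hX, abs_of_nonneg (by positivity)]
  · have h2 := hlikely {σ | IsMulApprox (δ : ℝ) (QC.sumOutput b σ) (∑ j, v j)}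
      fun σ _ _ ⟨X, hX, h0⟩ => by
        have := QC.result_accurate (b := b) ht.pos hδR hδR' hS hS4 hSL hX
          (QC.one_le_mul_two_pow_stages ht.pos hd3 hS hS4) (QC.le_mul_two_pow hδR hb)
        simp only at h0
        rw [Set.mem_ofPred_eq, QC.sumOutput, h0]
        exact this
    rw [ENNReal.ofReal_sub _ hηR.le, ENNReal.ofReal_one, tsub_le_iff_right]
    exact h2.trans (add_le_add le_rfl (QC.err_le hη3))
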